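/- Let $D_0,D_1,D_2$ be complex Hermitian $m\times m$ matrices such that $\Delta(x)=\det D(x)$, where $D(x)=x_0D_0+x_1D_1+x_2D_2$, is an irreducible polynomial in $\mathbb C[x_0,x_1,x_2]$, and let $C=\{\Delta=0\}\subset\mathbb{CP}^2$. For $k\ge 1$ let $W_k$ be the space of families $(w_i)$, $w_i\in\mathbb C^m$, indexed by $i=(i_0,i_1,i_2)\in\mathbb N^3$ with $|i|=k-1$, and let the principal subspace $V_k\subseteq W_k$ consist of the families with $$D_0w_{j_0+1,j_1,j_2}+D_1w_{j_0,j_1+1,j_2}+D_2w_{j_0,j_1,j_2+1}=0\qquad(j_0+j_1+j_2=k-2).$$ Let $n\ge 1$ and let $p,q\in\mathbb C[x_0,x_1,x_2]$ be homogeneous of degree $n$ (the zero polynomial is allowed). Let $T(p)$ be the matrix whose row with index $i$, $|i|=n-1$, consists of the coefficients of $x^ip(x)$ (columns: monomials of degree $2n-1$). The matrix $T(p)\otimes I_m$ maps $V_{2n}$ into $V_n$; let $T'(p):V_{2n}\to V_n$ be the restriction. Then $\dim V_n=nm$ and $\dim V_{2n}=2nm$. In any bases of $V_{2n}$ and $V_n$,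 form the $2nm\times 2nm$ Sylvester matrix $S(p,q)=\begin{pmatrix}T'(p)\\T'(q)\end{pmatrix}$. For $x\in C$ let $\mathcal O_x$ be the local ring of $C$ at $x$, let $F_x$ be the cokernel of the representation at $x$, that is, $\mathcal O_x^m$ modulo the rows of $D$ (written in a local trivialization, like $p$ and $q$), and let $\mu_x(p,q)=\dim_{\mathbb C}F_x/(p,q)F_x$ be the multiplicity of $x$ as a common zero of $p$ and $q$ along the determinantal representation. 1. If $p$ and $q$ do not both vanish identically on $C$, they have finitely many common zeros on $C$, and $$\dim\ker S(p,q)=\sum_{x\in C,\ p(x)=q(x)=0}\mu_x(p,q),$$ the number of common zeros on $C$, counted with multiplicity. If a common zero $x$ is a regular point of $C$, or if the representation is saturated at $x$ (all entries of the adjugate matrix of $D$, written in a local trivialization, lie in the conductor of $\mathcal O_x$ in its integral closure), then $$\mu_x(p,q)=\sum_{y\mapsto x}\min(\operatorname{ord}_y p,\operatorname{ord}_y q),$$ where $y$ runs through the points over $x$ of the desingularization of $C$. 2. $\det S(p,q)=0$ if and only if $p$ and $q$ have a common zero on $C$. -/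

import Mathlib

open MvPolynomial

noncomputable section

namespace DetCurve

/-! ### The curve and its determinantal representation -/

/-- The linear pencil `x₀ D₀ + x₁ D₁ + x₂ D₂`, as a matrix of linear forms. -/
def pencil {m : ℕ} (D : Fin 3 → Matrix (Fin m) (Fin m) ℂ) :
    Matrix (Fin m) (Fin m) (MvPolynomial (Fin 3) ℂ) :=
  fun a b => ∑ k, X k * C (D k a b)

/-- `Δ(x₀, x₁, x₂) = det (x₀ D₀ + x₁ D₁ + x₂ D₂)`. -/
def disc {m : ℕ} (D : Fin 3 → Matrix (Fin m) (Fin m) ℂ) : MvPolynomial (Fin 3) ℂ :=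
  (pencil D).det

/-- The common zeros of the homogeneous polynomials `p` and `q` on the projective plane curve
`Δ = 0`. -/
def commonZeros {m : ℕ} (D : Fin 3 → Matrix (Fin m) (Fin m) ℂ) (p q : MvPolynomial (Fin 3) ℂ) :
    Set (Projectivization ℂ (Fin 3 → ℂ)) :=
  {x | eval x.rep (disc D) = 0 ∧ eval x.rep p = 0 ∧ eval x.rep q = 0}

/-! ### Blown space, principal subspace, matrices of shifts, Sylvester matrix -/

/-- Exponents `(i₀, i₁, i₂)` with `i₀ + i₁ + i₂ = n - 1` (none if `n = 0`). -/
abbrev Expo (n : ℕ) : Type := {i : Fin 3 →₀ ℕ // i.degree + 1 = n}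

instance (n : ℕ) : Fintype (Expo n) :=
  ((Finsupp.finite_of_degree_le (σ := Fin 3) n).subset
    (fun i (hi : i.degree + 1 = n) => show i.degree ≤ n by omega)).fintype

/-- The blown space `W_n = ℂ^(m n (n + 1) / 2)`, with coordinates `w_(i₀, i₁, i₂) ∈ ℂ^m`. -/
abbrev Blown (m n : ℕ) : Type := Expo n × Fin m → ℂ

/-- The exponent `j + e_k`. -/
def Expo.succ {n : ℕ} (j : Fin 3 →₀ ℕ) (hj : j.degree + 2 = n) (k : Fin 3) : Expo n :=
  ⟨j + Finsupp.single k 1, by rw [map_add, Finsupp.degree_single]; omega⟩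

/-- The principal subspace `V_n` of `W_n`: the vectors with
`D₀ w_(j₀+1, j₁, j₂) + D₁ w_(j₀, j₁+1, j₂) + D₂ w_(j₀, j₁, j₂+1) = 0`
for all `j₀ + j₁ + j₂ = n - 2`. -/
def principal {m : ℕ} (D : Fin 3 → Matrix (Fin m) (Fin m) ℂ) (n : ℕ) :
    Submodule ℂ (Blown m n) where
  carrier := {w | ∀ (j : Fin 3 →₀ ℕ) (hj : j.degree + 2 = n),
    ∑ k, (D k).mulVec (fun b => w (Expo.succ j hj k, b)) = 0}
  zero_mem' := by
    intro j hj
    refine Finset.sum_eq_zero fun k _ => ?_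
    exact Matrix.mulVec_zero (D k)
  add_mem' := by
    intro v w hv hw j hj
    have h : ∀ k, (D k).mulVec (fun b => (v + w) (Expo.succ j hj k, b))
        = (D k).mulVec (fun b => v (Expo.succ j hj k, b))
          + (D k).mulVec (fun b => w (Expo.succ j hj k, b)) :=
      fun k => Matrix.mulVec_add (D k) _ _
    rw [Finset.sum_congr rfl fun k _ => h k, Finset.sum_add_distrib, hv j hj, hw j hj, add_zero]
  smul_mem' := by
    intro c w hw j hj
    have h : ∀ k, (D k).mulVec (fun b => (c • w) (Expo.succ j hj k, b))
        = c • (D k).mulVec (fun b => w (Expo.succ j hj k, b)) :=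
      fun k => Matrix.mulVec_smul (D k) c _
    rw [Finset.sum_congr rfl fun k _ => h k, ← Finset.smul_sum, hw j hj, smul_zero]

/-- The matrix `T(p)`, whose row with index `i` consists of the coefficients of `x^i p(x)`. -/
def shiftCoeff (n : ℕ) (p : MvPolynomial (Fin 3) ℂ) : Matrix (Expo n) (Expo (2 * n)) ℂ :=
  fun i j => coeff j.1 (monomial i.1 1 * p)

/-- The matrix `T(p) ⊗ I`, with `I` the `m × m` unit matrix. -/
def blownShift (m n : ℕ) (p : MvPolynomial (Fin 3) ℂ) :
    Matrix (Expo n × Fin m) (Expo (2 * n) × Fin m) ℂ :=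
  Matrix.kroneckerMap (fun a b => a * b) (shiftCoeff n p) (1 : Matrix (Fin m) (Fin m) ℂ)

theorem blownShift_mulVec (m n : ℕ) (p : MvPolynomial (Fin 3) ℂ) (w : Blown m (2 * n))
    (i : Expo n) (b : Fin m) :
    (blownShift m n p).mulVec w (i, b)
      = ∑ j : Expo (2 * n), coeff j.1 (monomial i.1 1 * p) * w (j, b) := by
  simp [blownShift, shiftCoeff, Matrix.mulVec, dotProduct, Fintype.sum_prod_type,
    Matrix.kroneckerMap_apply, Matrix.one_apply]

theorem sum_coeff_succ (m n : ℕ) (p : MvPolynomial (Fin 3) ℂ) (w : Blown m (2 * n))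
    (l : Fin 3 →₀ ℕ) (hl : l.degree + 2 = n) (k : Fin 3) (b : Fin m) :
    (∑ j : Expo (2 * n), coeff j.1 (monomial (Expo.succ l hl k).1 1 * p) * w (j, b))
      = ∑ r : Expo (2 * n - 1), coeff r.1 (monomial l 1 * p)
          * w (Expo.succ r.1 (by have := r.2; omega) k, b) := by
  have key : (monomial (Expo.succ l hl k).1 1 * p : MvPolynomial (Fin 3) ℂ)
      = monomial l 1 * p * X k := by
    have : (monomial (Expo.succ l hl k).1 1 : MvPolynomial (Fin 3) ℂ) = monomial l 1 * X k := by
      rw [X, monomial_mul, one_mul]; rfl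
    rw [this]; ring
  rw [key]
  symm
  refine Finset.sum_of_injOn
    (fun r : Expo (2 * n - 1) =>
      (Expo.succ r.1 (by have := r.2; omega) k : Expo (2 * n))) ?_ ?_ ?_ ?_
  · intro r _ s _ h
    have h1 := congrArg Subtype.val h
    exact Subtype.ext (add_right_cancel h1)
  · intro r _; simp
  · intro j _ hj
    rw [coeff_mul_X']
    split_ifs with hk
    · exfalso
      apply hj
      have hpos : Finsupp.single k 1 ≤ j.1 := by
        rw [Finsupp.single_le_iff]
        have := Finsupp.mem_support_iff.1 hk
        omega
      have hd : j.1 - Finsupp.single k 1 + Finsupp.single k 1 = j.1 := tsub_add_cancel_of_le hpos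
      have hdeg : (j.1 - Finsupp.single k 1).degree + 1 = j.1.degree := by
        conv_rhs => rw [← hd, map_add, Finsupp.degree_single]
      refine ⟨⟨j.1 - Finsupp.single k 1, by have := j.2; omega⟩, by simp, ?_⟩
      exact Subtype.ext hd
    · simp
  · intro r _
    simp [Expo.succ, coeff_mul_X]

/-- `(T(p) ⊗ I) V_(2n) ⊆ V_n`. -/
theorem blownShift_mem {m : ℕ} (D : Fin 3 → Matrix (Fin m) (Fin m) ℂ) (n : ℕ)
    (p : MvPolynomial (Fin 3) ℂ) (w : Blown m (2 * n)) (hw : w ∈ principal D (2 * n)) :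
    (blownShift m n p).mulVecLin w ∈ principal D n := by
  intro l hl
  funext a
  simp only [Matrix.mulVecLin_apply, Finset.sum_apply, Pi.zero_apply, Matrix.mulVec, dotProduct]
  have h1 : ∀ k b, (∑ x, blownShift m n p (Expo.succ l hl k, b) x * w x)
      = ∑ r : Expo (2 * n - 1), coeff r.1 (monomial l 1 * p)
          * w (Expo.succ r.1 (by have := r.2; omega) k, b) := by
    intro k b
    rw [← sum_coeff_succ]
    exact blownShift_mulVec m n p w _ b
  simp only [h1]
  have h2 : ∀ r : Expo (2 * n - 1), (∑ k, ∑ b, D k a b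
      * w (Expo.succ r.1 (by have := r.2; omega) k, b)) = 0 := by
    intro r
    have := congrFun (hw r.1 (by have := r.2; omega)) a
    simpa [Matrix.mulVec, dotProduct] using this
  calc _ = ∑ r : Expo (2 * n - 1), coeff r.1 (monomial l 1 * p) * (∑ k, ∑ b, D k a b
      * w (Expo.succ r.1 (by have := r.2; omega) k, b)) := by
        simp only [Finset.mul_sum]
        rw [Finset.sum_comm (s := (Finset.univ : Finset (Expo (2 * n - 1))))]
        refine Finset.sum_congr rfl fun k _ => ?_
        rw [Finset.sum_comm (s := (Finset.univ : Finset (Expo (2 * n - 1))))]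
        exact Finset.sum_congr rfl fun b _ => Finset.sum_congr rfl fun r _ => by ring
    _ = 0 := by simp [h2]

/-- The restriction `T'(p) : V_(2n) → V_n` of `T(p) ⊗ I`. -/
def shiftMap {m : ℕ} (D : Fin 3 → Matrix (Fin m) (Fin m) ℂ) (n : ℕ)
    (p : MvPolynomial (Fin 3) ℂ) : principal D (2 * n) →ₗ[ℂ] principal D n :=
  (blownShift m n p).mulVecLin.restrict (blownShift_mem D n p)

/-- The generalized Sylvester matrix `S(p, q) = (T'(p); T'(q))`, with `T'(p)` and `T'(q)` written
in a basis `b` of `V_(2n)` and a basis `c` of `V_n`. -/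
def sylvester {m : ℕ} (D : Fin 3 → Matrix (Fin m) (Fin m) ℂ) {n : ℕ}
    (b : Module.Basis (Fin (n * m) ⊕ Fin (n * m)) ℂ (principal D (2 * n)))
    (c : Module.Basis (Fin (n * m)) ℂ (principal D n)) (p q : MvPolynomial (Fin 3) ℂ) :
    Matrix (Fin (n * m) ⊕ Fin (n * m)) (Fin (n * m) ⊕ Fin (n * m)) ℂ :=
  Matrix.fromRows (LinearMap.toMatrix b c (shiftMap D n p)) (LinearMap.toMatrix b c (shiftMap D n q))

/-! ### Local rings of the curve and their normalization -/

/-- The total ring of fractions of the homogeneous coordinate ring `ℂ[x₀, x₁, x₂] / (Δ)` of the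
curve (a field if `Δ` is irreducible). -/
abbrev HomFrac {m : ℕ} (D : Fin 3 → Matrix (Fin m) (Fin m) ℂ) : Type :=
  FractionRing (MvPolynomial (Fin 3) ℂ ⧸ Ideal.span {disc D})

/-- A polynomial, as an element of the ring of fractions of the homogeneous coordinate ring. -/
def toFrac {m : ℕ} (D : Fin 3 → Matrix (Fin m) (Fin m) ℂ) :
    MvPolynomial (Fin 3) ℂ →+* HomFrac D :=
  (algebraMap (MvPolynomial (Fin 3) ℂ ⧸ Ideal.span {disc D}) (HomFrac D)).comp
    (Ideal.Quotient.mk (Ideal.span {disc D}))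

/-- The field of rational functions on the curve: the fractions `f / g` of homogeneous polynomials
of the same degree, with `g` not a zero divisor modulo `Δ`. -/
def functionField {m : ℕ} (D : Fin 3 → Matrix (Fin m) (Fin m) ℂ) : Subring (HomFrac D) where
  carrier := {z | ∃ (d : ℕ) (f g : MvPolynomial (Fin 3) ℂ), f.IsHomogeneous d ∧
    g.IsHomogeneous d ∧ IsUnit (toFrac D g) ∧ z * toFrac D g = toFrac D f}
  zero_mem' := ⟨0, 0, 1, isHomogeneous_zero _ _ _, isHomogeneous_one _ _, by simp, by simp⟩
  one_mem' := ⟨0, 1, 1, isHomogeneous_one _ _, isHomogeneous_one _ _, by simp, by simp⟩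
  add_mem' := by
    rintro z w ⟨d, f, g, hf, hg, hu, h⟩ ⟨d', f', g', hf', hg', hu', h'⟩
    refine ⟨d + d', f * g' + g * f', g * g', (hf.mul hg').add (hg.mul hf'), hg.mul hg',
      by rw [map_mul]; exact hu.mul hu', ?_⟩
    rw [map_mul, map_add, map_mul, map_mul, ← h, ← h']; ring
  neg_mem' := by
    rintro z ⟨d, f, g, hf, hg, hu, h⟩
    exact ⟨d, -f, g, hf.neg, hg, hu, by rw [map_neg, ← h]; ring⟩
  mul_mem' := by
    rintro z w ⟨d, f, g, hf, hg, hu, h⟩ ⟨d', f', g', hf', hg', hu', h'⟩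
    refine ⟨d + d', f * f', g * g', hf.mul hf', hg.mul hg',
      by rw [map_mul]; exact hu.mul hu', ?_⟩
    rw [map_mul, map_mul, ← h, ← h']; ring

/-- The local ring of the curve at its point with homogeneous coordinates `a`: the fractions
`f / g` of homogeneous polynomials of the same degree with `g(a) ≠ 0`. -/
def localRing {m : ℕ} (D : Fin 3 → Matrix (Fin m) (Fin m) ℂ) (a : Fin 3 → ℂ) :
    Subring (HomFrac D) where
  carrier := {z | ∃ (d : ℕ) (f g : MvPolynomial (Fin 3) ℂ), f.IsHomogeneous d ∧
    g.IsHomogeneous d ∧ eval a g ≠ 0 ∧ z * toFrac D g = toFrac D f}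
  zero_mem' := ⟨0, 0, 1, isHomogeneous_zero _ _ _, isHomogeneous_one _ _, by simp, by simp⟩
  one_mem' := ⟨0, 1, 1, isHomogeneous_one _ _, isHomogeneous_one _ _, by simp, by simp⟩
  add_mem' := by
    rintro z w ⟨d, f, g, hf, hg, hu, h⟩ ⟨d', f', g', hf', hg', hu', h'⟩
    refine ⟨d + d', f * g' + g * f', g * g', (hf.mul hg').add (hg.mul hf'), hg.mul hg',
      by rw [map_mul]; exact mul_ne_zero hu hu', ?_⟩
    rw [map_mul, map_add, map_mul, map_mul, ← h, ← h']; ring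
  neg_mem' := by
    rintro z ⟨d, f, g, hf, hg, hu, h⟩
    exact ⟨d, -f, g, hf.neg, hg, hu, by rw [map_neg, ← h]; ring⟩
  mul_mem' := by
    rintro z w ⟨d, f, g, hf, hg, hu, h⟩ ⟨d', f', g', hf', hg', hu', h'⟩
    refine ⟨d + d', f * f', g * g', hf.mul hf', hg.mul hg',
      by rw [map_mul]; exact mul_ne_zero hu hu', ?_⟩
    rw [map_mul, map_mul, ← h, ← h']; ring

/-- The integral closure of the local ring at `a` in the function field. Its maximal ideals are the
points of the desingularization of the curve that lie over the point `a`. -/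
def normalRing {m : ℕ} (D : Fin 3 → Matrix (Fin m) (Fin m) ℂ) (a : Fin 3 → ℂ) :
    Subring (HomFrac D) :=
  functionField D ⊓ (integralClosure (localRing D a) (HomFrac D)).toSubring

/-- `u = f / h` on the curve for some form `h` of degree `d` with `h(a) ≠ 0`; for a form `f` of
degree `d`, the elements `u` are the local equations of `f = 0` at `a`, and differ by units. -/
def IsGerm {m : ℕ} (D : Fin 3 → Matrix (Fin m) (Fin m) ℂ) (a : Fin 3 → ℂ) (d : ℕ)
    (f : MvPolynomial (Fin 3) ℂ) (u : HomFrac D) : Prop :=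
  ∃ h : MvPolynomial (Fin 3) ℂ, h.IsHomogeneous d ∧ eval a h ≠ 0 ∧ u * toFrac D h = toFrac D f

/-- The order of vanishing of the form `f` of degree `d` at the point `P` of the desingularization
over `a` (it is `⊤` if `f` vanishes identically on the curve). -/
def orderAt {m : ℕ} (D : Fin 3 → Matrix (Fin m) (Fin m) ℂ) (a : Fin 3 → ℂ)
    (P : MaximalSpectrum (normalRing D a)) (d : ℕ) (f : MvPolynomial (Fin 3) ℂ) : ℕ∞ :=
  emultiplicity P.asIdeal (Ideal.span {u : normalRing D a | IsGerm D a d f u})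

/-- The number of common zeros of the forms `p`, `q` of degree `n` over the point `a` of the curve,
counted with multiplicities on the desingularization. -/
def branchMult {m : ℕ} (D : Fin 3 → Matrix (Fin m) (Fin m) ℂ) (n : ℕ)
    (p q : MvPolynomial (Fin 3) ℂ) (a : Fin 3 → ℂ) : ℕ∞ :=
  ∑ᶠ P : MaximalSpectrum (normalRing D a), min (orderAt D a P n p) (orderAt D a P n q)

/-- The point `a` is a regular point of the curve. -/
def IsRegularAt {m : ℕ} (D : Fin 3 → Matrix (Fin m) (Fin m) ℂ) (a : Fin 3 → ℂ) : Prop :=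
  ∃ k : Fin 3, eval a (pderiv k (disc D)) ≠ 0

/-- The determinantal representation is saturated at the point `a`: the entries of the adjugate of
the pencil lie in the conductor of the local ring in its integral closure, that is, the cokernel of
the pencil at `a` is the direct image of a line bundle on the desingularization. -/
def IsSaturatedAt {m : ℕ} (D : Fin 3 → Matrix (Fin m) (Fin m) ℂ) (a : Fin 3 → ℂ) : Prop :=
  ∀ (i j : Fin m) (u : HomFrac D), IsGerm D a (m - 1) ((pencil D).adjugate i j) u →
    ∀ z ∈ normalRing D a, z * u ∈ localRing D a

/-! ### Multiplicity along the determinantal representation -/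

/-- The submodule of `O^m`, with `O` the local ring at `a`, that is generated by the rows of the
pencil and by `p O^m` and `q O^m`. -/
def localRelations {m : ℕ} (D : Fin 3 → Matrix (Fin m) (Fin m) ℂ) (n : ℕ)
    (p q : MvPolynomial (Fin 3) ℂ) (a : Fin 3 → ℂ) :
    Submodule (localRing D a) (Fin m → localRing D a) :=
  Submodule.span (localRing D a)
    ({v | ∃ (i : Fin m) (h : MvPolynomial (Fin 3) ℂ), h.IsHomogeneous 1 ∧ eval a h ≠ 0 ∧
        ∀ j, (v j : HomFrac D) * toFrac D h = toFrac D (pencil D i j)} ∪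
      {v | ∃ (j : Fin m) (u : localRing D a), (IsGerm D a n p u ∨ IsGerm D a n q u) ∧
        v = Pi.single j u})

/-- The multiplicity of the point `a` as a common zero of `p` and `q` along the determinantal
representation: the length of `F / (p, q) F`, where `F` is the cokernel of the pencil at `a` (the
module over the local ring `O` generated by `m` elements with the rows of the pencil as relations).
The residue field is `ℂ`, so the length is the complex dimension. -/
def zeroMult {m : ℕ} (D : Fin 3 → Matrix (Fin m) (Fin m) ℂ) (n : ℕ)
    (p q : MvPolynomial (Fin 3) ℂ) (a : Fin 3 → ℂ) : ℕ∞ :=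
  Module.length (localRing D a) ((Fin m → localRing D a) ⧸ localRelations D n p q a)

end DetCurve

end

/-! Write S for the polynomial ring and M for the graded cokernel S^m / S^m D of the pencil D, a
module over S/(Δ). The equations of V_k say that w, read as a functional on vectors of forms of
degree k-1, kills all monomial multiples of rows of D. So V_k is the dual of M_{k-1}
(`principal_succ`), and its dimension is km because D is injective. Under this duality T'(p) is the
transpose of p : M_{n-1} → M_{2n-1}, so ker S(p,q) is the dual of the part of degree 2n-1 of
M/(p,q)M, whatever p and q are (`annihilator_relMod_span_pair`, `finrank_ker_sylvester`).

Suppose Δ does not divide p. Since D · adj D = Δ, the module M is torsion free over S/(Δ). Hence p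
is injective on M, and M/pM has dimension nm in every degree ≥ n-1
(`finrank_inf_relSpace_singleton`). A linear form ℓ that misses the finitely many zeros of p on C is
injective on M/pM (`mem_relMod_of_linForm_smul_mem`), hence bijective from degree n-1 on. Therefore
the part of degree 2n-1 of M/(p,q)M is all of M/(p,q,ℓ-1)M (`finite_affCoker_and_finrank`). This
finite-dimensional S-module is the product of its localizations at the common zeros
(`bijective_of_localizations`), which are the modules F_x/(p,q)F_x.

At a saturated point, a column of the adjugate that is nonzero on C maps O^m to the integral closure
N with kernel the row relations, and its image is an ideal of N. As N is a semilocal principal ideal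
domain, F_x is isomorphic to N, and the length of N/(p,q) is a sum of minima of orders
(`zeroMult_eq_branchMult_of_isSaturatedAt`). At a regular point O is integrally closed, so the point
is saturated.

For the determinant: at a common zero x, evaluation paired with a kernel vector of D(x) is a nonzero
functional on M/(p,q)M, even if p and q vanish on C. If there is no common zero, p and q do not both
vanish on C, and the formula gives a zero kernel. -/

open MvPolynomial

noncomputable section

namespace DetCurve

/-! ### Forms in three variables -/

/-- The polynomial ring `ℂ[x₀, x₁, x₂]`. -/
abbrev Poly : Type := MvPolynomial (Fin 3) ℂ

/-- The target ring is arbitrary because two cases are needed: rescaling the coordinates of a point,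
and dividing the variables by a linear form in the fraction field of the coordinate ring. -/
theorem eval₂_mul_of_isHomogeneous {K : Type*} [CommRing K] (φ : ℂ →+* K) {f : Poly} {d : ℕ}
    (hf : f.IsHomogeneous d) (t : K) (g : Fin 3 → K) :
    eval₂ φ (fun k => t * g k) f = t ^ d * eval₂ φ g f := by
  rw [eval₂_eq', eval₂_eq', Finset.mul_sum]
  refine Finset.sum_congr rfl fun i hi => ?_
  have h : ∑ k, i k = d := by
    have := hf (mem_support_iff.1 hi)
    simpa [Finsupp.weight_apply, Finsupp.sum_fintype] using this
  simp only [mul_pow, Finset.prod_mul_distrib]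
  rw [Finset.prod_pow_eq_pow_sum, h]; ring

theorem eval_smul_of_isHomogeneous {f : Poly} {d : ℕ} (hf : f.IsHomogeneous d) (t : ℂ)
    (b : Fin 3 → ℂ) : eval (t • b) f = t ^ d * eval b f :=
  eval₂_mul_of_isHomogeneous (RingHom.id ℂ) hf t b

/-- A nonzero factor of a homogeneous polynomial is homogeneous. -/
theorem isHomogeneous_of_mul {f g : Poly} {d : ℕ} (h : (f * g).IsHomogeneous d)
    (h0 : f * g ≠ 0) : f.IsHomogeneous f.totalDegree := by
  have hf : f ≠ 0 := left_ne_zero_of_mul h0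
  have hg : g ≠ 0 := right_ne_zero_of_mul h0
  -- The order as a power series (the lowest degree) and the total degree are both additive on
  -- products. On `f * g` the order is at least the total degree `d`, so no factor can have order
  -- below its total degree.
  have hle : ∀ {q : Poly}, q ≠ 0 → (q : MvPowerSeries (Fin 3) ℂ).order ≤ q.totalDegree := by
    intro q hq
    obtain ⟨i, hi⟩ := ne_zero_iff.1 hq
    refine (MvPowerSeries.order_le (d := i) (by simpa using hi)).trans ?_
    exact_mod_cast le_totalDegree (mem_support_iff.2 hi)
  have hge : (d : ℕ∞) ≤ ((f * g : Poly) : MvPowerSeries (Fin 3) ℂ).order := by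
    refine MvPowerSeries.nat_le_order fun i hi => ?_
    rw [coeff_coe]
    exact h.coeff_eq_zero hi.ne
  rw [coe_mul, MvPowerSeries.order_mul] at hge
  have hd := h.totalDegree h0
  rw [totalDegree_mul_of_isDomain hf hg] at hd
  have hfo : (f.totalDegree : ℕ∞) ≤ (f : MvPowerSeries (Fin 3) ℂ).order := by
    by_contra hlt
    push Not at hlt
    have h1 := ENat.add_lt_add_of_lt_of_le (by simpa using hg) hlt (hle hg)
    have h2 := hge.trans_lt h1
    rw [← hd] at h2
    exact absurd h2 (by simp)
  have key : ∀ i, coeff i f ≠ 0 → i.degree = f.totalDegree := by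
    intro i hi
    refine le_antisymm (le_totalDegree (mem_support_iff.2 hi)) ?_
    have := hfo.trans (MvPowerSeries.order_le (d := i) (f := (f : MvPowerSeries (Fin 3) ℂ))
      (by simpa using hi))
    exact_mod_cast this
  intro i hi
  rw [← key i hi, Finsupp.degree_eq_weight_one]
  rfl

/-- A form of positive degree vanishes somewhere on every line. -/
theorem exists_zero_on_line {f : Poly} {d : ℕ} (hf : f.IsHomogeneous d) (hd : d ≠ 0)
    (b c : Fin 3 → ℂ) : ∃ s t : ℂ, (s ≠ 0 ∨ t ≠ 0) ∧ eval (s • b + t • c) f = 0 := by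
  set g : Polynomial ℂ := aeval (fun k => Polynomial.C (b k) + Polynomial.X * Polynomial.C (c k)) f
  have hg : ∀ t, g.eval t = eval (b + t • c) f := by
    intro t
    rw [← Polynomial.coe_aeval_eq_eval]
    simp only [g]
    rw [← AlgHom.comp_apply, comp_aeval, ← coe_aeval_eq_eval]
    simp only [map_add, map_mul, Polynomial.aeval_C, Polynomial.aeval_X, Algebra.algebraMap_self,
      RingHom.id_apply]
    rfl
  -- If `g` is a nonzero constant `r`, then `f (s b + c) = r s ^ d` for all `s`, and `c` itself is a
  -- zero. Otherwise `g`, possibly zero, has a root.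
  by_cases hdeg : g.degree = 0
  · set g' : Polynomial ℂ :=
      aeval (fun k => Polynomial.X * Polynomial.C (b k) + Polynomial.C (c k)) f
    have hg' : ∀ t, g'.eval t = eval (t • b + c) f := by
      intro t
      rw [← Polynomial.coe_aeval_eq_eval]
      simp only [g']
      rw [← AlgHom.comp_apply, comp_aeval, ← coe_aeval_eq_eval]
      simp only [map_add, map_mul, Polynomial.aeval_C, Polynomial.aeval_X,
        Algebra.algebraMap_self, RingHom.id_apply]
      rfl
    obtain ⟨r, hr⟩ : ∃ r, g = Polynomial.C r := ⟨_, Polynomial.eq_C_of_degree_eq_zero hdeg⟩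
    -- The factor `X` makes the identity trivial at `s = 0`, where the rescaling by `s` is not
    -- available.
    have h0 : Polynomial.X * (g' - Polynomial.C r * Polynomial.X ^ d) = 0 := by
      refine Polynomial.funext fun s => ?_
      by_cases hs : s = 0
      · simp [hs]
      · have h1 : s • b + c = s • (b + s⁻¹ • c) := by
          rw [smul_add, smul_smul, mul_inv_cancel₀ hs, one_smul]
        have h2 : g'.eval s = s ^ d * r := by
          rw [hg', h1, eval_smul_of_isHomogeneous hf, ← hg, hr, Polynomial.eval_C]
        rw [Polynomial.eval_mul, Polynomial.eval_sub, h2, Polynomial.eval_mul, Polynomial.eval_C,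
          Polynomial.eval_pow, Polynomial.eval_X, mul_comm r, sub_self, mul_zero,
          Polynomial.eval_zero]
    have h1 := (mul_eq_zero.1 h0).resolve_left Polynomial.X_ne_zero
    refine ⟨0, 1, by simp, ?_⟩
    have h2 := congrArg (Polynomial.eval 0) h1
    have h3 := hg' 0
    simp only [Polynomial.eval_sub, Polynomial.eval_mul, Polynomial.eval_pow, Polynomial.eval_X,
      zero_pow hd, mul_zero, sub_zero, Polynomial.eval_zero] at h2
    rw [h2] at h3
    simpa using h3.symm
  · obtain ⟨t, ht⟩ := IsAlgClosed.exists_root g hdeg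
    exact ⟨1, t, by simp, by rw [one_smul, ← hg]; exact ht⟩

/-- The linear form with coefficients `c`. -/
def linForm (c : Fin 3 → ℂ) : Poly := ∑ k, C (c k) * X k

theorem linForm_isHomogeneous (c : Fin 3 → ℂ) : (linForm c).IsHomogeneous 1 :=
  IsHomogeneous.sum _ _ _ fun k _ => isHomogeneous_C_mul_X (c k) k

@[simp] theorem eval_linForm (c b : Fin 3 → ℂ) : eval b (linForm c) = c ⬝ᵥ b := by
  simp [linForm, dotProduct]

/-- The projection along the vector `e`. -/
def shear (e : Fin 3 → ℂ) (L : Poly) : Poly →ₐ[ℂ] Poly := aeval fun k => X k - C (e k) * L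

theorem dvd_sub_shear (e : Fin 3 → ℂ) (L f : Poly) : L ∣ f - shear e L f := by
  induction f using MvPolynomial.induction_on with
  | C a => simp [shear]
  | add p q hp hq =>
    have := dvd_add hp hq
    rw [map_add]; convert this using 1; ring
  | mul_X p k hp =>
    have h : p * X k - shear e L (p * X k)
        = (p - shear e L p) * X k + shear e L p * (C (e k) * L) := by
      rw [map_mul]; simp only [shear, aeval_X]; ring
    rw [h]
    exact dvd_add (hp.mul_right _) ((Dvd.intro_left _ rfl).mul_left _)

theorem shear_linForm {e c : Fin 3 → ℂ} (h : c ⬝ᵥ e = 1) (t : ℂ) :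
    shear e (linForm c - C t) (linForm c - C t) = 0 := by
  have h1 : shear e (linForm c - C t) (linForm c)
      = linForm c - C (c ⬝ᵥ e) * (linForm c - C t) := by
    conv_lhs => arg 2; rw [linForm]
    simp only [map_sum, map_mul, shear, aeval_X, algHom_C, algebraMap_eq]
    rw [dotProduct, map_sum, Finset.sum_mul]
    conv_rhs => arg 1; rw [linForm]
    rw [← Finset.sum_sub_distrib]
    refine Finset.sum_congr rfl fun k _ => ?_
    rw [map_mul]
    ring
  rw [map_sub, h1, h]
  simp [shear]

/-- The shear is an endomorphism whose kernel is generated by the linear polynomial, so computations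
modulo that polynomial take place in the domain `Poly` itself. The value `t = 0` serves for the line
`ℓ = 0`, and `t = 1` for the affine plane `ℓ = 1`. -/
theorem dvd_iff_shear_eq_zero {e c : Fin 3 → ℂ} (h : c ⬝ᵥ e = 1) (t : ℂ) (f : Poly) :
    linForm c - C t ∣ f ↔ shear e (linForm c - C t) f = 0 := by
  constructor
  · rintro ⟨g, rfl⟩
    rw [map_mul, shear_linForm h, zero_mul]
  · intro h0
    have := dvd_sub_shear e (linForm c - C t) f
    rwa [h0, sub_zero] at this

theorem shear_isHomogeneous {f : Poly} {d : ℕ} (hf : f.IsHomogeneous d) (e c : Fin 3 → ℂ) :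
    (shear e (linForm c) f).IsHomogeneous d := by
  have := hf.aeval (fun k => X k - C (e k) * linForm c) (n := 1)
    (fun k => (isHomogeneous_X ℂ k).sub ((linForm_isHomogeneous c).C_mul (e k)))
  rwa [one_mul] at this

theorem eval_shear {e c b : Fin 3 → ℂ} (h : c ⬝ᵥ b = 0) (f : Poly) :
    eval b (shear e (linForm c) f) = eval b f := by
  obtain ⟨g, hg⟩ := dvd_sub_shear e (linForm c) f
  have h1 := congrArg (eval b) hg
  rw [map_sub, map_mul, eval_linForm, h, zero_mul, sub_eq_zero] at h1
  exact h1.symm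

/-- There are two independent vectors on the plane `c · b = 0`. -/
theorem exists_basis_of_plane (c : Fin 3 → ℂ) : ∃ b b' : Fin 3 → ℂ, c ⬝ᵥ b = 0 ∧ c ⬝ᵥ b' = 0 ∧
    ∀ s t : ℂ, s • b + t • b' = 0 → s = 0 ∧ t = 0 := by
  simp only [funext_iff, dotProduct, Fin.sum_univ_three, Fin.forall_fin_succ, Pi.add_apply,
    Pi.smul_apply, smul_eq_mul, Pi.zero_apply]
  by_cases h0 : c 0 = 0
  · by_cases h1 : c 1 = 0
    · exact ⟨![1, 0, 0], ![0, 1, 0], by simp [h0, h1], by simp [h0, h1], by simp⟩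
    · exact ⟨![1, 0, 0], ![0, c 2, - c 1], by simp [h0], by simp [h0, mul_comm],
        by intro s t; simp [h1]; tauto⟩
  · refine ⟨![c 1, - c 0, 0], ![c 2, 0, - c 0], by simp; ring, by simp; ring, ?_⟩
    intro s t; simp [h0]

/-- A form of positive degree vanishes somewhere on every plane through the origin. -/
theorem exists_zero_on_plane {f : Poly} {d : ℕ} (hf : f.IsHomogeneous d) (hd : d ≠ 0)
    (c : Fin 3 → ℂ) : ∃ b : Fin 3 → ℂ, b ≠ 0 ∧ c ⬝ᵥ b = 0 ∧ eval b f = 0 := by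
  obtain ⟨b, b', h1, h2, h3⟩ := exists_basis_of_plane c
  obtain ⟨s, t, hst, h⟩ := exists_zero_on_line hf hd b b'
  refine ⟨_, fun h0 => ?_, ?_, h⟩
  · obtain ⟨hs, ht⟩ := h3 s t h0
    simp [hs, ht] at hst
  · simp [dotProduct_add, h1, h2]

/-- Two forms without common zeros on a line are relatively prime on it. -/
theorem isRelPrime_shear {f g : Poly} {d n : ℕ} (hf : f.IsHomogeneous d) (hg : g.IsHomogeneous n)
    (hn : n ≠ 0) {e c : Fin 3 → ℂ}
    (hc : ∀ b : Fin 3 → ℂ, b ≠ 0 → eval b f = 0 → eval b g = 0 → c ⬝ᵥ b ≠ 0) :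
    shear e (linForm c) f ≠ 0 ∧ IsRelPrime (shear e (linForm c) f) (shear e (linForm c) g) := by
  -- Otherwise `f` vanishes on the whole plane, and a zero of `g` on it contradicts `hc`.
  have hf0 : shear e (linForm c) f ≠ 0 := by
    intro h0
    obtain ⟨b, hb0, hb, hbg⟩ := exists_zero_on_plane hg hn c
    refine hc b hb0 ?_ hbg hb
    rw [← eval_shear (e := e) hb, h0, map_zero]
  refine ⟨hf0, ?_⟩
  rintro u ⟨v, hv⟩ ⟨w, hw⟩
  have hu := isHomogeneous_of_mul (f := u) (g := v) (d := d)
    (by rw [← hv]; exact shear_isHomogeneous hf e c) (by rwa [← hv])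
  have hu0 : u ≠ 0 := by rintro rfl; exact hf0 (by rw [hv, zero_mul])
  -- A common divisor is a form. If its degree were positive, it would vanish at a point of the
  -- plane, and `f` and `g` with it.
  by_cases h : u.totalDegree = 0
  · rw [totalDegree_eq_zero_iff_eq_C] at h
    rw [h] at hu0 ⊢
    exact (isUnit_iff_ne_zero.2 (by rintro h0; simp [h0] at hu0)).map C
  · obtain ⟨b, hb0, hb, hbu⟩ := exists_zero_on_plane hu h c
    refine absurd hb (hc b hb0 ?_ ?_)
    · rw [← eval_shear (e := e) hb, hv, map_mul, hbu, zero_mul]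
    · rw [← eval_shear (e := e) hb, hw, map_mul, hbu, zero_mul]

/-! ### Relations of the pencil -/

section Relations

variable {m : ℕ} (D : Fin 3 → Matrix (Fin m) (Fin m) ℂ)

/-- The combinations of the rows of the pencil, modulo the ideal `I`. -/
def relMod (I : Ideal Poly) : Submodule Poly (Fin m → Poly) where
  carrier := {v | ∃ u : Fin m → Poly, ∀ j, v j - Matrix.vecMul u (pencil D) j ∈ I}
  zero_mem' := ⟨0, by simp⟩
  add_mem' := by
    rintro v v' ⟨u, hu⟩ ⟨u', hu'⟩
    refine ⟨u + u', fun b => ?_⟩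
    rw [Matrix.add_vecMul]
    convert I.add_mem (hu b) (hu' b) using 1
    simp only [Pi.add_apply]; ring
  smul_mem' := by
    rintro f v ⟨u, hu⟩
    refine ⟨f • u, fun b => ?_⟩
    rw [Matrix.smul_vecMul]
    convert I.mul_mem_left f (hu b) using 1
    simp only [Pi.smul_apply, smul_eq_mul]; ring

variable {D}

theorem mem_relMod {I : Ideal Poly} {v : Fin m → Poly} :
    v ∈ relMod D I ↔ ∃ u : Fin m → Poly, ∀ b, v b - Matrix.vecMul u (pencil D) b ∈ I := Iff.rfl

theorem mem_relMod_bot {v : Fin m → Poly} :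
    v ∈ relMod D ⊥ ↔ ∃ u : Fin m → Poly, Matrix.vecMul u (pencil D) = v := by
  simp only [mem_relMod, Ideal.mem_bot, sub_eq_zero, funext_iff, eq_comm]

theorem relMod_mono {I J : Ideal Poly} (h : I ≤ J) : relMod D I ≤ relMod D J :=
  fun _ ⟨u, hu⟩ => ⟨u, fun b => h (hu b)⟩

theorem vecMul_mem_relMod (I : Ideal Poly) (u : Fin m → Poly) :
    Matrix.vecMul u (pencil D) ∈ relMod D I := ⟨u, fun b => by simp⟩

theorem mem_relMod_of_forall_mem {I : Ideal Poly} {v : Fin m → Poly} (h : ∀ b, v b ∈ I) :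
    v ∈ relMod D I := ⟨0, by simpa using h⟩

theorem smul_mem_relMod {I : Ideal Poly} {f : Poly} (hf : f ∈ I) (v : Fin m → Poly) :
    f • v ∈ relMod D I := mem_relMod_of_forall_mem fun _ => I.mul_mem_right _ hf

/-- The pencil and its adjugate form a matrix factorization of Δ: each inverts the other up to the
factor Δ. Most statements about the cokernel come from this pair of identities. -/
theorem vecMul_adjugate_vecMul (u : Fin m → Poly) :
    Matrix.vecMul (Matrix.vecMul u (pencil D).adjugate) (pencil D) = disc D • u := by
  rw [Matrix.vecMul_vecMul, Matrix.adjugate_mul, Matrix.vecMul_smul, Matrix.vecMul_one]; rfl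

theorem vecMul_vecMul_adjugate (u : Fin m → Poly) :
    Matrix.vecMul (Matrix.vecMul u (pencil D)) (pencil D).adjugate = disc D • u := by
  rw [Matrix.vecMul_vecMul, Matrix.mul_adjugate, Matrix.vecMul_smul, Matrix.vecMul_one]; rfl

theorem disc_smul_mem (I : Ideal Poly) (v : Fin m → Poly) : disc D • v ∈ relMod D I :=
  ⟨Matrix.vecMul v (pencil D).adjugate, by
    rw [vecMul_adjugate_vecMul]; simp⟩

theorem vecMul_pencil_injective (h0 : disc D ≠ 0) {u u' : Fin m → Poly}
    (h : Matrix.vecMul u (pencil D) = Matrix.vecMul u' (pencil D)) : u = u' := by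
  have := congrArg (fun v => Matrix.vecMul v (pencil D).adjugate) h
  simp only [vecMul_vecMul_adjugate] at this
  exact smul_right_injective _ h0 this

theorem pencil_isHomogeneous (i j : Fin m) : (pencil D i j).IsHomogeneous 1 := by
  refine IsHomogeneous.sum _ _ _ fun k _ => ?_
  rw [mul_comm]
  exact isHomogeneous_C_mul_X _ k

theorem isHomogeneous_det {k : ℕ} (A : Matrix (Fin k) (Fin k) Poly)
    (h : ∀ i j, (A i j).IsHomogeneous 1) : A.det.IsHomogeneous k := by
  rw [Matrix.det_apply]
  refine IsHomogeneous.sum _ _ _ fun s _ => ?_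
  have h1 : (∏ i, A (s i) i).IsHomogeneous k := by
    have := IsHomogeneous.prod Finset.univ (fun i => A (s i) i) (fun _ => 1) (fun i _ => h _ _)
    simpa using this
  rcases Int.units_eq_one_or (Equiv.Perm.sign s) with h2 | h2 <;> rw [h2]
  · simpa using h1
  · simpa using h1.neg

theorem disc_isHomogeneous : (disc D).IsHomogeneous m :=
  isHomogeneous_det _ pencil_isHomogeneous

theorem adjugate_isHomogeneous (i j : Fin m) :
    ((pencil D).adjugate i j).IsHomogeneous (m - 1) := by
  obtain _ | m := m
  · exact i.elim0
  · rw [Matrix.adjugate_fin_succ_eq_det_submatrix]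
    have h := isHomogeneous_det ((pencil D).submatrix j.succAbove i.succAbove)
      (fun _ _ => pencil_isHomogeneous _ _)
    rcases neg_one_pow_eq_or Poly (j + i : ℕ) with h2 | h2 <;> rw [h2]
    · simpa using h
    · simpa using h.neg

/-- The cokernel of the pencil is torsion free over `ℂ[x₀, x₁, x₂] / (Δ)`. -/
theorem mem_relMod_bot_of_smul_mem (hirr : Irreducible (disc D)) {f : Poly}
    (hf : ¬ disc D ∣ f) {v : Fin m → Poly} (h : f • v ∈ relMod D ⊥) : v ∈ relMod D ⊥ := by
  obtain ⟨u, hu⟩ := mem_relMod_bot.1 h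
  -- From `f v = u D` follows `f (v adj) = Δ u`, and Δ is a prime that does not divide `f`. So `v
  -- adj = Δ w`, which means `v = w D`.
  have h1 : ∀ j, disc D ∣ Matrix.vecMul v (pencil D).adjugate j := by
    intro j
    have h2 := congrFun (congrArg (fun v => Matrix.vecMul v (pencil D).adjugate) hu) j
    simp only [vecMul_vecMul_adjugate, Matrix.smul_vecMul, Pi.smul_apply, smul_eq_mul] at h2
    exact (hirr.prime.dvd_or_dvd ⟨u j, h2.symm⟩).resolve_left hf
  choose w hw using h1
  refine mem_relMod_bot.2 ⟨w, ?_⟩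
  refine smul_right_injective _ hirr.ne_zero ?_
  have h2 : disc D • w = Matrix.vecMul v (pencil D).adjugate := funext fun j => (hw j).symm
  show disc D • Matrix.vecMul w (pencil D) = disc D • v
  rw [← Matrix.smul_vecMul, h2, vecMul_adjugate_vecMul]

/-- If the linear form `c` does not vanish at the common zeros of `Δ` and `p`, it is not a zero
divisor on the cokernel of the pencil modulo `p`. -/
theorem mem_relMod_of_linForm_smul_mem (hirr : Irreducible (disc D)) {p : Poly} {n : ℕ}
    (hp : p.IsHomogeneous n) (hn : n ≠ 0) {c : Fin 3 → ℂ} (hc0 : c ≠ 0)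
    (hc : ∀ b : Fin 3 → ℂ, b ≠ 0 → eval b (disc D) = 0 → eval b p = 0 → c ⬝ᵥ b ≠ 0)
    {v : Fin m → Poly} (h : linForm c • v ∈ relMod D (Ideal.span {p})) :
    v ∈ relMod D (Ideal.span {p}) := by
  obtain ⟨k, hk⟩ := Function.ne_iff.1 hc0
  obtain ⟨e, he⟩ : ∃ e, c ⬝ᵥ e = 1 := ⟨Pi.single k (c k)⁻¹, by simp [mul_inv_cancel₀ hk]⟩
  set ℓ := linForm c with hℓ
  have hdvd : ∀ f, ℓ ∣ f ↔ shear e ℓ f = 0 := by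
    intro f
    have := dvd_iff_shear_eq_zero he 0 f
    simpa using this
  obtain ⟨hΔ, hrel⟩ := isRelPrime_shear (e := e) disc_isHomogeneous hp hn hc
  have hprime : ∀ f, ℓ ∣ disc D * f → ℓ ∣ f := by
    intro f hf
    rw [hdvd, map_mul] at hf
    exact (hdvd f).2 ((mul_eq_zero.1 hf).resolve_left hΔ)
  -- If `ℓ = Δ g`, then `ℓ` divides `g` by `hprime`, and Δ would be a unit.
  have hnd : ¬ disc D ∣ ℓ := by
    rintro ⟨g, hg⟩
    have h1 : ℓ ∣ disc D * g := hg ▸ dvd_rfl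
    obtain ⟨g', rfl⟩ := hprime g h1
    have hℓ0 : ℓ ≠ 0 := by
      intro h0
      have := eval_linForm c e
      rw [← hℓ, h0, he] at this
      simp at this
    have h2 : disc D * g' = 1 := by
      apply mul_left_cancel₀ hℓ0
      rw [mul_one]; conv_rhs => rw [hg]
      ring
    exact hirr.not_isUnit (IsUnit.of_mul_eq_one _ h2)
  obtain ⟨u, hu⟩ := h
  choose w hw using fun b => Ideal.mem_span_singleton'.1 (hu b)
  have hw' : p • w = ℓ • v - Matrix.vecMul u (pencil D) := by
    funext b
    simp only [Pi.smul_apply, Pi.sub_apply, smul_eq_mul, mul_comm p]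
    exact hw b
  -- Multiplying `p w = ℓ v - u D` by the adjugate gives `p (w adj) = ℓ (v adj) - Δ u`. Modulo `ℓ`,
  -- Δ divides `p (w adj)` and is prime to `p`, so `w adj` lies in the ideal `(ℓ, Δ)`.
  have h1 : ∀ j, ∃ a b, Matrix.vecMul w (pencil D).adjugate j = ℓ * a + disc D * b := by
    intro j
    have h2 := congrFun (congrArg (fun v => Matrix.vecMul v (pencil D).adjugate) hw') j
    simp only [Matrix.sub_vecMul, vecMul_vecMul_adjugate, Matrix.smul_vecMul, Pi.smul_apply,
      smul_eq_mul, Pi.sub_apply] at h2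
    have h3 : shear e ℓ (disc D) ∣ shear e ℓ p
        * shear e ℓ (Matrix.vecMul w (pencil D).adjugate j) := by
      refine ⟨- shear e ℓ (u j), ?_⟩
      have := congrArg (shear e ℓ) h2
      rw [map_sub, map_mul, map_mul, map_mul, (hdvd ℓ).1 dvd_rfl, zero_mul] at this
      linear_combination this
    obtain ⟨b, hb⟩ := hrel.dvd_of_dvd_mul_left h3
    obtain ⟨x, hx⟩ := dvd_sub_shear e ℓ (Matrix.vecMul w (pencil D).adjugate j)
    obtain ⟨y, hy⟩ := dvd_sub_shear e ℓ (disc D)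
    exact ⟨x - y * b, b, by linear_combination hx + hb - b * hy⟩
  choose a b hab using h1
  have h2 : disc D • w = ℓ • Matrix.vecMul a (pencil D) + disc D • Matrix.vecMul b (pencil D) := by
    rw [← vecMul_adjugate_vecMul, ← Matrix.smul_vecMul, ← Matrix.smul_vecMul, ← Matrix.add_vecMul]
    congr 1
    funext j; simpa using hab j
  have h3 : ∀ j, ℓ ∣ w j - Matrix.vecMul b (pencil D) j := by
    intro j
    refine hprime _ ⟨Matrix.vecMul a (pencil D) j, ?_⟩
    have := congrFun h2 j
    simp only [Pi.smul_apply, Pi.add_apply, smul_eq_mul] at this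
    linear_combination this
  choose z hz using h3
  have h4 : ℓ • (v - p • z) ∈ relMod D ⊥ := by
    refine mem_relMod_bot.2 ⟨u + p • b, ?_⟩
    rw [Matrix.add_vecMul, Matrix.smul_vecMul]
    funext j
    have h5 := congrFun hw' j
    simp only [Pi.smul_apply, Pi.sub_apply, Pi.add_apply, smul_eq_mul] at h5 ⊢
    linear_combination h5 - p * hz j
  have h5 := mem_relMod_bot_of_smul_mem hirr hnd h4
  have h6 := Submodule.add_mem _ (relMod_mono bot_le h5)
    (smul_mem_relMod (D := D) (Ideal.mem_span_singleton_self p) z)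
  simpa using h6

end Relations

/-! ### Graded parts -/

/-- The part of degree `k - 1` of a polynomial (zero if `k = 0`). -/
def part : ℕ → Poly →ₗ[ℂ] Poly
  | 0 => 0
  | k + 1 => homogeneousComponent k

theorem coeff_part (k : ℕ) (f : Poly) (i : Fin 3 →₀ ℕ) :
    coeff i (part k f) = if i.degree + 1 = k then coeff i f else 0 := by
  cases k with
  | zero => simp [part]
  | succ k => simp [part, coeff_homogeneousComponent]

/-- The pencil, `p` and `q` are homogeneous, so a relation can be cut down to one degree. The shift
by one in `part` agrees with the indexing of `Expo`. -/
theorem part_mul {L : Poly} {e : ℕ} (hL : L.IsHomogeneous e) (k : ℕ) (f : Poly) :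
    part (k + e) (f * L) = part k f * L := by
  induction f using MvPolynomial.induction_on' with
  | add p q hp hq => simp only [add_mul, map_add, hp, hq]
  | monomial i a =>
    have h1 : part k (monomial i a) = if i.degree + 1 = k then monomial i a else 0 := by
      ext j
      rw [coeff_part, coeff_monomial]
      split_ifs with h1 h2 h3 h4 h5
      · rw [coeff_monomial, if_pos h2]
      · rw [← h2] at h1; exact absurd h1 ‹_›
      · rw [coeff_monomial, if_neg h2]
      · simp
      · rw [coeff_monomial, if_neg]; rintro rfl; contradiction
      · simp
    have h2 : (monomial i a * L).IsHomogeneous (i.degree + e) :=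
      (isHomogeneous_monomial a rfl).mul hL
    rw [h1]
    ext j
    rw [coeff_part]
    by_cases hj : j.degree = i.degree + e
    · by_cases hk : i.degree + 1 = k
      · rw [if_pos (by omega), if_pos hk]
      · rw [if_neg (by omega), if_neg hk]; simp
    · have h3 := h2.coeff_eq_zero hj
      split_ifs <;> simp [h3]

variable {m : ℕ}

/-- The vectors of forms of degree `k - 1`. -/
def vecPart (m k : ℕ) : Submodule ℂ (Fin m → Poly) where
  carrier := {v | ∀ b i, i.degree + 1 ≠ k → coeff i (v b) = 0}
  zero_mem' := by simp
  add_mem' := fun hv hw b i hi => by simp [hv b i hi, hw b i hi]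
  smul_mem' := fun c v hv b i hi => by simp [hv b i hi]

theorem mem_vecPart {k : ℕ} {v : Fin m → Poly} :
    v ∈ vecPart m k ↔ ∀ b i, i.degree + 1 ≠ k → coeff i (v b) = 0 := Iff.rfl

theorem isHomogeneous_iff_coeff {f : Poly} {d : ℕ} :
    f.IsHomogeneous d ↔ ∀ i, i.degree + 1 ≠ d + 1 → coeff i f = 0 := by
  constructor
  · intro h i hi
    exact h.coeff_eq_zero (by omega)
  · intro h i hi
    by_contra h1
    refine hi (h i fun h2 => h1 ?_)
    rw [Finsupp.degree_eq_weight_one] at h2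
    exact Nat.succ_injective h2

theorem mem_vecPart_succ {k : ℕ} {v : Fin m → Poly} :
    v ∈ vecPart m (k + 1) ↔ ∀ b, (v b).IsHomogeneous k := by
  simp only [mem_vecPart, isHomogeneous_iff_coeff]

theorem part_mem_vecPart (k : ℕ) (v : Fin m → Poly) : (fun b => part k (v b)) ∈ vecPart m k :=
  fun b i hi => by rw [coeff_part, if_neg hi]

theorem part_eq_self {k : ℕ} {v : Fin m → Poly} (hv : v ∈ vecPart m k) (b : Fin m) :
    part k (v b) = v b := by
  ext i
  rw [coeff_part]
  split_ifs with h
  · rfl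
  · exact (hv b i h).symm

theorem smul_mem_vecPart {L : Poly} {e k : ℕ} (hL : L.IsHomogeneous e) {v : Fin m → Poly}
    (hv : v ∈ vecPart m k) : L • v ∈ vecPart m (k + e) := by
  have : L • v = fun b => part (k + e) (v b * L) := by
    funext b
    rw [part_mul hL, part_eq_self hv, mul_comm]; rfl
  rw [this]
  exact part_mem_vecPart _ fun b => v b * L

theorem part_vecMul_pencil (D : Fin 3 → Matrix (Fin m) (Fin m) ℂ) (k : ℕ) (u : Fin m → Poly)
    (b : Fin m) : part (k + 1) (Matrix.vecMul u (pencil D) b)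
      = Matrix.vecMul (fun a => part k (u a)) (pencil D) b := by
  simp only [Matrix.vecMul, dotProduct, map_sum, part_mul (pencil_isHomogeneous _ _)]

theorem vecMul_mem_vecPart (D : Fin 3 → Matrix (Fin m) (Fin m) ℂ) {k : ℕ} {u : Fin m → Poly}
    (hu : u ∈ vecPart m k) : Matrix.vecMul u (pencil D) ∈ vecPart m (k + 1) := by
  have : Matrix.vecMul u (pencil D)
      = fun b => part (k + 1) (Matrix.vecMul u (pencil D) b) := by
    funext b
    rw [part_vecMul_pencil]
    congr 1
    funext a
    exact (part_eq_self hu a).symm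
  rw [this]
  exact part_mem_vecPart _ _

/-- The coordinates of a vector of forms of degree `k - 1`. -/
def coeffEquiv (m k : ℕ) : vecPart m k ≃ₗ[ℂ] Blown m k where
  toFun v x := coeff x.1.1 (v.1 x.2)
  map_add' _ _ := by ext; simp
  map_smul' _ _ := by ext; simp
  invFun w := ⟨fun b => ∑ i : Expo k, monomial i.1 (w (i, b)), fun b j hj => by
    rw [coeff_sum]
    refine Finset.sum_eq_zero fun i _ => ?_
    rw [coeff_monomial, if_neg]
    rintro rfl
    exact hj i.2⟩
  left_inv v := by
    ext b j
    simp only [coeff_sum, coeff_monomial]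
    by_cases hj : j.degree + 1 = k
    · rw [Finset.sum_eq_single ⟨j, hj⟩] <;> simp +contextual [Subtype.ext_iff]
    · rw [v.2 b j hj]
      refine Finset.sum_eq_zero fun i _ => if_neg ?_
      rintro rfl
      exact hj i.2
  right_inv w := by
    ext ⟨i, b⟩
    simp only [coeff_sum, coeff_monomial]
    rw [Finset.sum_eq_single i] <;> simp +contextual [Subtype.ext_iff]

instance (k : ℕ) : Module.Finite ℂ (vecPart m k) :=
  Module.Finite.equiv (coeffEquiv m k).symm

instance (k : ℕ) (B : Submodule ℂ (Fin m → Poly)) :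
    Module.Finite ℂ (vecPart m k ⊓ B : Submodule ℂ (Fin m → Poly)) :=
  Submodule.finiteDimensional_of_le inf_le_left

theorem finrank_vecPart (m k : ℕ) :
    Module.finrank ℂ (vecPart m k) = Fintype.card (Expo k) * m := by
  rw [(coeffEquiv m k).finrank_eq]
  simp

theorem card_expo_succ (k : ℕ) : Fintype.card (Expo (k + 1)) = (k + 2).choose 2 := by
  have e : Expo (k + 1) ≃ {P : Fin 3 →₀ ℕ // P.sum (fun _ ↦ id) = k} :=
    Equiv.subtypeEquivRight fun i => by
      rw [Nat.succ_inj]; rfl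
  classical
  rw [Fintype.card_congr (e.trans (Sym.equivNatSum (Fin 3) k).symm), Sym.card_sym_eq_choose]
  simp only [Fintype.card_fin]
  rw [show 3 + k - 1 = k + 2 by omega]
  exact Nat.choose_symm_add

theorem card_expo_zero : Fintype.card (Expo 0) = 0 := by
  rw [Fintype.card_eq_zero_iff]
  exact ⟨fun i => absurd i.2 (by omega)⟩

/-- Pascal's rule. The increment `k + 1` becomes the dimension `(k + 1) * m` of the cokernel in
degree `k`. -/
theorem card_expo_add_one (k : ℕ) :
    Fintype.card (Expo (k + 1)) = Fintype.card (Expo k) + (k + 1) := by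
  cases k with
  | zero => rw [card_expo_succ, card_expo_zero]; rfl
  | succ k =>
    rw [card_expo_succ, card_expo_succ, Nat.choose_succ_succ' (k + 2) 1, Nat.choose_one_right]
    ring

/-! ### Hilbert functions -/

theorem linForm_ne_zero {c : Fin 3 → ℂ} (hc : c ≠ 0) : linForm c ≠ 0 := by
  obtain ⟨k, hk⟩ := Function.ne_iff.1 hc
  intro h
  have := eval_linForm c (Pi.single k 1)
  rw [h, map_zero, dotProduct_single, mul_one] at this
  exact hk this.symm

/-- Counting dimensions for the multiplication map `X → Y` by a form. -/
theorem finrank_map_sup_add_finrank_inf {V : Type*} [AddCommGroup V] [Module ℂ V]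
    {X Y B : Submodule ℂ V} [Module.Finite ℂ X] [Module.Finite ℂ Y] (f : V →ₗ[ℂ] V)
    (hf : Function.Injective f) (hX : X.map f ≤ Y) (hB : ∀ x, f x ∈ B → x ∈ B)
    (hB' : ∀ x ∈ B, f x ∈ B) :
    Module.finrank ℂ (X.map f ⊔ Y ⊓ B : Submodule ℂ V)
        + Module.finrank ℂ (X ⊓ B : Submodule ℂ V)
      = Module.finrank ℂ X + Module.finrank ℂ (Y ⊓ B : Submodule ℂ V) := by
  have : Module.Finite ℂ (Y ⊓ B : Submodule ℂ V) := Submodule.finiteDimensional_of_le inf_le_left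
  have h1 := Submodule.finrank_sup_add_finrank_inf_eq (X.map f) (Y ⊓ B)
  have h2 : X.map f ⊓ (Y ⊓ B) = (X ⊓ B).map f := by
    ext x
    constructor
    · rintro ⟨⟨y, hy, rfl⟩, -, h⟩
      exact ⟨y, ⟨hy, hB y h⟩, rfl⟩
    · rintro ⟨y, ⟨hy, hy'⟩, rfl⟩
      exact ⟨⟨y, hy, rfl⟩, hX ⟨y, hy, rfl⟩, hB' y hy'⟩
  have h3 : ∀ Z : Submodule ℂ V, Module.finrank ℂ (Z.map f) = Module.finrank ℂ Z := fun Z =>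
    (Submodule.equivMapOfInjective f hf Z).finrank_eq.symm
  rwa [h2, h3, h3] at h1

/-- Multiplication by `f`. -/
def mulBy (m : ℕ) (f : Poly) : (Fin m → Poly) →ₗ[ℂ] (Fin m → Poly) :=
  (LinearMap.lsmul Poly (Fin m → Poly) f).restrictScalars ℂ

@[simp] theorem mulBy_apply (f : Poly) (v : Fin m → Poly) : mulBy m f v = f • v := rfl

theorem mulBy_injective {f : Poly} (hf : f ≠ 0) : Function.Injective (mulBy m f) :=
  smul_right_injective _ hf

/-- `relMod` as a complex vector space. -/
abbrev relSpace (D : Fin 3 → Matrix (Fin m) (Fin m) ℂ) (I : Ideal Poly) :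
    Submodule ℂ (Fin m → Poly) := (relMod D I).restrictScalars ℂ

variable {D : Fin 3 → Matrix (Fin m) (Fin m) ℂ}

/-- The coefficients of a relation can be replaced by their parts of the right degree. -/
theorem exists_of_mem_relMod_span_pair {p q : Poly} {n : ℕ} (hp : p.IsHomogeneous n)
    (hq : q.IsHomogeneous n) {k : ℕ} {v : Fin m → Poly} (hv : v ∈ vecPart m (k + n + 1))
    (h : v ∈ relMod D (Ideal.span {p, q})) :
    ∃ u ∈ vecPart m (k + n), ∃ w ∈ vecPart m (k + 1), ∃ z ∈ vecPart m (k + 1),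
      v = Matrix.vecMul u (pencil D) + p • w + q • z := by
  obtain ⟨u, hu⟩ := h
  choose w z hwz using fun b => Ideal.mem_span_pair.1 (hu b)
  refine ⟨_, part_mem_vecPart (k + n) u, _, part_mem_vecPart (k + 1) w, _,
    part_mem_vecPart (k + 1) z, funext fun b => ?_⟩
  have h1 : v b = Matrix.vecMul u (pencil D) b + w b * p + z b * q := by
    rw [add_assoc, hwz]; ring
  have h2 := congrArg (part (k + n + 1)) h1
  rw [map_add, map_add, part_vecMul_pencil, part_eq_self hv, show k + n + 1 = k + 1 + n by ring,
    part_mul hp, part_mul hq] at h2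
  rw [h2]
  simp only [Pi.add_apply, Pi.smul_apply, smul_eq_mul]
  ring

/-- The case `k = 0` matters: in degree `n - 1` the vector `w` is zero, and only row relations
remain. -/
theorem exists_of_mem_relMod_span_singleton {p : Poly} {n : ℕ} (hp : p.IsHomogeneous n)
    (hn : 1 ≤ n) {k : ℕ} {v : Fin m → Poly} (hv : v ∈ vecPart m (k + n))
    (h : v ∈ relMod D (Ideal.span {p})) :
    ∃ w ∈ vecPart m k, v - p • w ∈ relMod D ⊥ := by
  obtain ⟨u, hu⟩ := h
  choose w hw using fun b => Ideal.mem_span_singleton'.1 (hu b)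
  refine ⟨_, part_mem_vecPart k w, mem_relMod_bot.2
    ⟨fun a => part (k + n - 1) (u a), funext fun b => ?_⟩⟩
  · have h1 : v b = Matrix.vecMul u (pencil D) b + w b * p := by rw [hw]; ring
    have h2 := congrArg (part (k + n)) h1
    have h3 := part_vecMul_pencil D (k + n - 1) u b
    rw [show k + n - 1 + 1 = k + n by omega] at h3
    rw [map_add, h3, part_eq_self hv, part_mul hp] at h2
    simp only [Pi.sub_apply, Pi.smul_apply, smul_eq_mul]
    rw [h2]; ring

/-- The pencil is injective and raises degrees by one, so the row relations are a copy of the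
vectors of forms one degree lower. -/
theorem finrank_inf_relSpace_bot (h0 : disc D ≠ 0) (k : ℕ) :
    Module.finrank ℂ (vecPart m (k + 1) ⊓ relSpace D ⊥ : Submodule ℂ (Fin m → Poly))
      = Fintype.card (Expo k) * m := by
  rw [← finrank_vecPart]
  set f : (Fin m → Poly) →ₗ[ℂ] (Fin m → Poly) :=
    (Matrix.vecMulLinear (pencil D)).restrictScalars ℂ
  have hf : Function.Injective f := fun u u' h => vecMul_pencil_injective h0 h
  rw [(Submodule.equivMapOfInjective f hf (vecPart m k)).finrank_eq]
  have : vecPart m (k + 1) ⊓ relSpace D ⊥ = (vecPart m k).map f := ?_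
  · rw [this]
  ext v
  constructor
  · rintro ⟨hv, hv'⟩
    obtain ⟨u, hu⟩ := mem_relMod_bot.1 hv'
    refine ⟨_, part_mem_vecPart k u, funext fun b => ?_⟩
    have h1 := congrArg (part (k + 1)) (congrFun hu b)
    rw [part_vecMul_pencil, part_eq_self hv] at h1
    exact h1
  · rintro ⟨u, hu, rfl⟩
    exact ⟨vecMul_mem_vecPart D hu, vecMul_mem_relMod ⊥ u⟩

theorem vecPart_zero : vecPart m 0 = ⊥ := by
  refine eq_bot_iff.2 fun v hv => ?_
  refine (Submodule.mem_bot ℂ).2 (funext fun b => ?_)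
  ext i
  simpa using hv b i (Nat.succ_ne_zero _)

/-- This is the Hilbert function of the cokernel, equal to `k * m` in degree `k - 1`, written
additively to avoid subtraction. -/
theorem finrank_inf_relSpace_bot_add (h0 : disc D ≠ 0) (k : ℕ) :
    Module.finrank ℂ (vecPart m k ⊓ relSpace D ⊥ : Submodule ℂ (Fin m → Poly)) + k * m
      = Fintype.card (Expo k) * m := by
  cases k with
  | zero => rw [vecPart_zero, bot_inf_eq, card_expo_zero]; simp
  | succ k => rw [finrank_inf_relSpace_bot h0, card_expo_add_one]; ring

/-- Multiplication by `p` is injective on the cokernel, so its quotient modulo `p` has dimension `(k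
+ n) * m - k * m = n * m` in degree `k + n - 1`. This is constant from degree `n - 1` on. -/
theorem finrank_inf_relSpace_singleton (hirr : Irreducible (disc D)) {p : Poly} {n : ℕ}
    (hp : p.IsHomogeneous n) (hn : 1 ≤ n) (hpD : ¬ disc D ∣ p) (k : ℕ) :
    Module.finrank ℂ
        (vecPart m (k + n) ⊓ relSpace D (Ideal.span {p}) : Submodule ℂ (Fin m → Poly)) + n * m
      = Fintype.card (Expo (k + n)) * m := by
  have hp0 : p ≠ 0 := by rintro rfl; exact hpD (dvd_zero _)
  have h1 := finrank_map_sup_add_finrank_inf (X := vecPart m k) (Y := vecPart m (k + n))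
    (B := relSpace D ⊥) (mulBy m p) (mulBy_injective hp0)
    (Submodule.map_le_iff_le_comap.2 fun v hv => smul_mem_vecPart hp hv)
    (fun v hv => mem_relMod_bot_of_smul_mem hirr hpD hv)
    (fun v hv => (relMod D ⊥).smul_mem p hv)
  have h2 : (vecPart m k).map (mulBy m p) ⊔ vecPart m (k + n) ⊓ relSpace D ⊥
      = vecPart m (k + n) ⊓ relSpace D (Ideal.span {p}) := by
    refine le_antisymm (sup_le ?_ (inf_le_inf_left _ (relMod_mono bot_le))) ?_
    · rintro _ ⟨v, hv, rfl⟩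
      exact ⟨smul_mem_vecPart hp hv, smul_mem_relMod (Ideal.mem_span_singleton_self p) v⟩
    · rintro v ⟨hv, hv'⟩
      obtain ⟨w, hw, h⟩ := exists_of_mem_relMod_span_singleton hp hn hv hv'
      refine Submodule.mem_sup.2 ⟨p • w, ⟨w, hw, rfl⟩, v - p • w, ⟨?_, h⟩, by simp⟩
      exact Submodule.sub_mem _ hv (smul_mem_vecPart hp hw)
  rw [h2, finrank_vecPart] at h1
  have h3 := finrank_inf_relSpace_bot_add hirr.ne_zero k
  have h4 := finrank_inf_relSpace_bot_add hirr.ne_zero (k + n)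
  have h5 : (k + n) * m = k * m + n * m := by ring
  omega

/-- Multiplication by a linear form that does not vanish at the common zeros of `Δ` and `p`. -/
theorem exists_sub_smul_mem_relMod (hirr : Irreducible (disc D)) {p : Poly} {n : ℕ}
    (hp : p.IsHomogeneous n) (hn : 1 ≤ n) (hpD : ¬ disc D ∣ p) {c : Fin 3 → ℂ} (hc0 : c ≠ 0)
    (hc : ∀ b : Fin 3 → ℂ, b ≠ 0 → eval b (disc D) = 0 → eval b p = 0 → c ⬝ᵥ b ≠ 0) (k : ℕ)
    {v : Fin m → Poly} (hv : v ∈ vecPart m (k + n + 1)) :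
    ∃ w ∈ vecPart m (k + n), v - linForm c • w ∈ relMod D (Ideal.span {p}) := by
  have hℓ0 : linForm c ≠ 0 := linForm_ne_zero hc0
  have h1 := finrank_map_sup_add_finrank_inf (X := vecPart m (k + n)) (Y := vecPart m (k + n + 1))
    (B := relSpace D (Ideal.span {p})) (mulBy m (linForm c)) (mulBy_injective hℓ0)
    (Submodule.map_le_iff_le_comap.2 fun v hv => smul_mem_vecPart (linForm_isHomogeneous c) hv)
    (fun v hv => mem_relMod_of_linForm_smul_mem hirr hp (by omega) hc0 hc hv)
    (fun v hv => (relMod D _).smul_mem _ hv)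
  have h3 := finrank_inf_relSpace_singleton hirr hp hn hpD k
  have h4 := finrank_inf_relSpace_singleton hirr hp hn hpD (k + 1)
  rw [show k + 1 + n = k + n + 1 by ring] at h4
  rw [finrank_vecPart] at h1
  -- Modulo `p` both graded parts of the cokernel have dimension `n * m`, so the injective
  -- multiplication by `ℓ` is onto.
  have h2 : (vecPart m (k + n)).map (mulBy m (linForm c))
      ⊔ vecPart m (k + n + 1) ⊓ relSpace D (Ideal.span {p}) = vecPart m (k + n + 1) := by
    refine Submodule.eq_of_le_of_finrank_le (sup_le ?_ inf_le_left) ?_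
    · rintro _ ⟨v, hv, rfl⟩
      exact smul_mem_vecPart (linForm_isHomogeneous c) hv
    · rw [finrank_vecPart]; omega
  rw [← h2] at hv
  obtain ⟨_, ⟨w, hw, rfl⟩, y, hy, rfl⟩ := Submodule.mem_sup.1 hv
  exact ⟨w, hw, by simpa using hy.2⟩

theorem exists_sub_pow_smul_mem_relMod (hirr : Irreducible (disc D)) {p : Poly} {n : ℕ}
    (hp : p.IsHomogeneous n) (hn : 1 ≤ n) (hpD : ¬ disc D ∣ p) {c : Fin 3 → ℂ} (hc0 : c ≠ 0)
    (hc : ∀ b : Fin 3 → ℂ, b ≠ 0 → eval b (disc D) = 0 → eval b p = 0 → c ⬝ᵥ b ≠ 0) (k j : ℕ)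
    {v : Fin m → Poly} (hv : v ∈ vecPart m (k + n + j)) :
    ∃ w ∈ vecPart m (k + n), v - linForm c ^ j • w ∈ relMod D (Ideal.span {p}) := by
  induction j generalizing v with
  | zero => exact ⟨v, hv, by simp⟩
  | succ j ih =>
    obtain ⟨w, hw, h⟩ := exists_sub_smul_mem_relMod hirr hp hn hpD hc0 hc (k + j) (v := v)
      (by rwa [show k + j + n + 1 = k + n + (j + 1) by ring])
    rw [show k + j + n = k + n + j by ring] at hw
    obtain ⟨z, hz, h'⟩ := ih hw
    refine ⟨z, hz, ?_⟩
    have h2 := Submodule.add_mem _ h (Submodule.smul_mem _ (linForm c) h')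
    convert h2 using 1
    rw [smul_sub, smul_smul, ← pow_succ']; abel

theorem mem_relMod_of_pow_smul_mem (hirr : Irreducible (disc D)) {p : Poly} {n : ℕ}
    (hp : p.IsHomogeneous n) (hn : n ≠ 0) {c : Fin 3 → ℂ} (hc0 : c ≠ 0)
    (hc : ∀ b : Fin 3 → ℂ, b ≠ 0 → eval b (disc D) = 0 → eval b p = 0 → c ⬝ᵥ b ≠ 0) (j : ℕ)
    {v : Fin m → Poly} (h : linForm c ^ j • v ∈ relMod D (Ideal.span {p})) :
    v ∈ relMod D (Ideal.span {p}) := by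
  induction j with
  | zero => simpa using h
  | succ j ih =>
    rw [pow_succ', mul_smul] at h
    exact ih (mem_relMod_of_linForm_smul_mem hirr hp hn hc0 hc h)

/-! ### The principal subspace as an annihilator -/

/-- The functional on vectors of polynomials with the coordinates `w`. -/
def pairing {k : ℕ} (w : Blown m k) : (Fin m → Poly) →ₗ[ℂ] ℂ where
  toFun v := ∑ x : Expo k × Fin m, coeff x.1.1 (v x.2) * w x
  map_add' v v' := by simp [add_mul, Finset.sum_add_distrib]
  map_smul' a v := by simp [Finset.mul_sum, mul_assoc]

theorem pairing_apply {k : ℕ} (w : Blown m k) (v : Fin m → Poly) :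
    pairing w v = ∑ x : Expo k × Fin m, coeff x.1.1 (v x.2) * w x := rfl

/-- The coordinate vectors of functionals that vanish on the part of degree `k - 1` of `B`. -/
def annihilator (k : ℕ) (B : Submodule ℂ (Fin m → Poly)) : Submodule ℂ (Blown m k) where
  carrier := {w | ∀ v ∈ vecPart m k ⊓ B, pairing w v = 0}
  zero_mem' := by simp [pairing_apply]
  add_mem' := by
    intro w w' hw hw' v hv
    have h1 := hw v hv
    have h2 := hw' v hv
    rw [pairing_apply] at h1 h2 ⊢
    simp only [Pi.add_apply, mul_add, Finset.sum_add_distrib, h1, h2, add_zero]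
  smul_mem' := by
    intro a w hw v hv
    have h1 := hw v hv
    rw [pairing_apply] at h1 ⊢
    simp only [Pi.smul_apply, smul_eq_mul, mul_left_comm _ a, ← Finset.mul_sum, h1, mul_zero]

theorem finrank_annihilator (k : ℕ) (B : Submodule ℂ (Fin m → Poly)) :
    Module.finrank ℂ (annihilator k B)
        + Module.finrank ℂ (vecPart m k ⊓ B : Submodule ℂ (Fin m → Poly))
      = Fintype.card (Expo k) * m := by
  set R : Submodule ℂ (Blown m k) :=
    (B.comap (vecPart m k).subtype).map (coeffEquiv m k).toLinearMap
  have h1 : Module.finrank ℂ R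
      = Module.finrank ℂ (vecPart m k ⊓ B : Submodule ℂ (Fin m → Poly)) := by
    rw [LinearEquiv.finrank_map_eq,
      ← (Submodule.comap_equiv_self_of_inj_of_le (f := (vecPart m k).subtype)
        (p := vecPart m k ⊓ B) (Submodule.injective_subtype _) (by simp)).finrank_eq]
    refine (LinearEquiv.ofEq _ _ ?_).finrank_eq
    ext v
    simp
  have h2 : annihilator k B
      = R.dualAnnihilator.comap (dotProductEquiv ℂ (Expo k × Fin m)).toLinearMap := by
    ext w
    simp only [Submodule.mem_comap, Submodule.mem_dualAnnihilator]
    constructor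
    · rintro hw _ ⟨v, hv, rfl⟩
      have h := hw v.1 ⟨v.2, hv⟩
      rw [pairing_apply] at h
      simpa [dotProduct, coeffEquiv, mul_comm] using h
    · rintro hw v ⟨hv, hv'⟩
      have h := hw _ ⟨⟨v, hv⟩, hv', rfl⟩
      rw [pairing_apply]
      simpa [dotProduct, coeffEquiv, mul_comm] using h
  have h3 := Subspace.finrank_add_finrank_dualAnnihilator_eq R
  rw [h2, (Submodule.comap_equiv_self_of_inj_of_le (f :=
    (dotProductEquiv ℂ (Expo k × Fin m)).toLinearMap) (p := R.dualAnnihilator)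
    (dotProductEquiv ℂ (Expo k × Fin m)).injective (by simp)).finrank_eq, ← h1, add_comm, h3]
  simp

/-- A subspace that contains the monomial vectors of degree `k - 1` contains all vectors of forms of
this degree. -/
theorem vecPart_le {k : ℕ} {N : Submodule ℂ (Fin m → Poly)}
    (h : ∀ (i : Expo k) (b : Fin m), Pi.single b (monomial i.1 1) ∈ N) : vecPart m k ≤ N := by
  intro v hv
  have h1 : v = ∑ x : Expo k × Fin m, coeff x.1.1 (v x.2) • Pi.single x.2 (monomial x.1.1 1) := by
    have h2 := congrArg Subtype.val ((coeffEquiv m k).symm_apply_apply ⟨v, hv⟩)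
    refine h2.symm.trans (funext fun b => ?_)
    rw [Finset.sum_apply, Fintype.sum_prod_type]
    refine Finset.sum_congr rfl fun i _ => ?_
    rw [Finset.sum_eq_single b]
    · simp [coeffEquiv, smul_monomial]
    · intro b' _ hb
      simp [hb.symm]
    · simp
  rw [h1]
  exact N.sum_mem fun x _ => N.smul_mem _ (h x.1 x.2)

/-- The equations with index `j` say that the functional of `w` kills `x^j` times each row of the
pencil (`key`), and these vectors span the row relations of degree `k`. -/
theorem principal_succ (D : Fin 3 → Matrix (Fin m) (Fin m) ℂ) (k : ℕ) :
    principal D (k + 1) = annihilator (k + 1) (relSpace D ⊥) := by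
  have key : ∀ (w : Blown m (k + 1)) (j : Expo k) (a : Fin m),
      pairing w (Matrix.vecMul (Pi.single a (monomial j.1 1)) (pencil D))
        = (∑ l, (D l).mulVec (fun b => w (Expo.succ j.1 (n := k + 1) (by have := j.2; omega) l, b)))
          a := by
    intro w j a
    rw [pairing_apply, Fintype.sum_prod_type_right, Finset.sum_apply]
    simp only [Matrix.mulVec, dotProduct]
    conv_rhs => rw [Finset.sum_comm]
    refine Finset.sum_congr rfl fun b _ => ?_
    have h1 : Matrix.vecMul (Pi.single a (monomial j.1 1)) (pencil D) b
        = ∑ l, monomial (Expo.succ j.1 (n := k + 1) (by have := j.2; omega) l).1 (D l a b) := by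
      rw [Matrix.single_vecMul]
      simp only [pencil, Pi.smul_apply, smul_eq_mul, Matrix.row, Finset.mul_sum, Expo.succ]
      refine Finset.sum_congr rfl fun l _ => ?_
      rw [X, C_apply, monomial_mul, monomial_mul]; simp
    simp only [h1, coeff_sum, coeff_monomial, Finset.sum_mul]
    rw [Finset.sum_comm]
    refine Finset.sum_congr rfl fun l _ => ?_
    rw [Finset.sum_eq_single (Expo.succ j.1 (by have := j.2; omega) l)]
    · simp
    · intro i _ hi
      rw [if_neg fun h => hi (Subtype.ext h.symm), zero_mul]
    · simp
  ext w
  constructor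
  · rintro hw v ⟨hv, hv'⟩
    obtain ⟨u, hu⟩ := mem_relMod_bot.1 hv'
    set f : (Fin m → Poly) →ₗ[ℂ] ℂ :=
      pairing w ∘ₗ (Matrix.vecMulLinear (pencil D)).restrictScalars ℂ with hf
    have h1 : vecPart m k ≤ LinearMap.ker f := vecPart_le fun j a => by
      rw [LinearMap.mem_ker]
      exact (key w j a).trans (congrFun (hw j.1 (by have := j.2; omega)) a)
    have h2 := h1 (part_mem_vecPart k u)
    have h3 : v = Matrix.vecMul (fun a => part k (u a)) (pencil D) := by
      funext b
      rw [← part_vecMul_pencil, hu, part_eq_self hv]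
    rw [h3]
    exact h2
  · intro hw j hj
    funext a
    rw [Pi.zero_apply, ← key w ⟨j, Nat.succ_injective hj⟩ a]
    refine hw _ ⟨vecMul_mem_vecPart D ?_, vecMul_mem_relMod _ _⟩
    intro b i hi
    by_cases hb : b = a
    · subst hb
      rw [Pi.single_eq_same, coeff_monomial, if_neg]
      intro h
      exact hi (by rw [← h]; exact Nat.succ_injective hj)
    · simp [hb]

theorem finrank_principal_succ (h0 : disc D ≠ 0) (k : ℕ) :
    Module.finrank ℂ (principal D (k + 1)) = (k + 1) * m := by
  have h1 := finrank_annihilator (k + 1) (relSpace D ⊥)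
  have h2 := finrank_inf_relSpace_bot_add h0 (k + 1)
  rw [principal_succ]
  omega

/-- Under the pairing, `T(p) ⊗ I` is the transpose of multiplication by `p`. -/
theorem blownShift_mulVec_eq_pairing (n : ℕ) (p : Poly) (w : Blown m (2 * n)) (i : Expo n)
    (b : Fin m) : (blownShift m n p).mulVec w (i, b)
      = pairing w (p • Pi.single b (monomial i.1 1)) := by
  rw [blownShift_mulVec, pairing_apply, Fintype.sum_prod_type_right, Finset.sum_eq_single b]
  · simp [mul_comm]
  · intro b' _ hb
    simp [hb]
  · simp

theorem blownShift_mulVec_eq_zero_iff {n : ℕ} {p : Poly} {w : Blown m (2 * n)} :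
    (blownShift m n p).mulVec w = 0 ↔ ∀ v ∈ vecPart m n, pairing w (p • v) = 0 := by
  constructor
  · intro h
    have h1 : vecPart m n ≤ LinearMap.ker (pairing w ∘ₗ mulBy m p) := vecPart_le fun i b => by
      rw [LinearMap.mem_ker]
      exact (blownShift_mulVec_eq_pairing n p w i b).symm.trans (congrFun h (i, b))
    exact fun v hv => h1 hv
  · intro h
    ext ⟨i, b⟩
    rw [blownShift_mulVec_eq_pairing]
    refine h _ fun b' j hj => ?_
    by_cases hb : b' = b
    · subst hb
      rw [Pi.single_eq_same, coeff_monomial, if_neg]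
      rintro rfl
      exact hj i.2
    · simp [hb]

/-- The relations of degree `2n - 1` are spanned by row relations and by multiples of `p` and of `q`
by vectors of forms of degree `n - 1`. The three conditions on the right correspond to these three
kinds. -/
theorem annihilator_relMod_span_pair {n : ℕ} (hn : 1 ≤ n) {p q : Poly}
    (hp : p.IsHomogeneous n) (hq : q.IsHomogeneous n) (w : Blown m (2 * n)) :
    w ∈ annihilator (2 * n) (relSpace D (Ideal.span {p, q})) ↔
      w ∈ principal D (2 * n) ∧ (blownShift m n p).mulVec w = 0 ∧
        (blownShift m n q).mulVec w = 0 := by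
  obtain ⟨k, rfl⟩ : ∃ k, n = k + 1 := ⟨n - 1, by omega⟩
  have e : 2 * (k + 1) = k + (k + 1) + 1 := by ring
  have hpr : principal D (2 * (k + 1)) = annihilator (2 * (k + 1)) (relSpace D ⊥) := by
    rw [e]; exact principal_succ D _
  have e' : 2 * (k + 1) = k + 1 + (k + 1) := by ring
  rw [hpr, blownShift_mulVec_eq_zero_iff, blownShift_mulVec_eq_zero_iff]
  constructor
  · intro hw
    refine ⟨fun v hv => hw v ⟨hv.1, relMod_mono bot_le hv.2⟩, fun v hv => hw _ ⟨?_, ?_⟩,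
      fun v hv => hw _ ⟨?_, ?_⟩⟩
    · rw [e']; exact smul_mem_vecPart hp hv
    · exact smul_mem_relMod (Ideal.subset_span (by simp)) v
    · rw [e']; exact smul_mem_vecPart hq hv
    · exact smul_mem_relMod (Ideal.subset_span (by simp)) v
  · rintro ⟨h1, h2, h3⟩ v ⟨hv, hv'⟩
    rw [e] at hv
    obtain ⟨u, hu, y, hy, z, hz, rfl⟩ := exists_of_mem_relMod_span_pair hp hq hv hv'
    rw [map_add, map_add, h2 y hy, h3 z hz, add_zero, add_zero]
    refine h1 _ ⟨?_, vecMul_mem_relMod _ _⟩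
    rw [e]
    exact vecMul_mem_vecPart D hu

/-- No condition is put on the zeros of `p` and `q`. This allows the use when both vanish on the
curve, and makes the symmetry in `p` and `q` visible. -/
theorem finrank_ker_sylvester {n : ℕ} (hn : 1 ≤ n) {p q : Poly}
    (hp : p.IsHomogeneous n) (hq : q.IsHomogeneous n)
    (b : Module.Basis (Fin (n * m) ⊕ Fin (n * m)) ℂ (principal D (2 * n)))
    (c : Module.Basis (Fin (n * m)) ℂ (principal D n)) :
    Module.finrank ℂ (LinearMap.ker (sylvester D b c p q).mulVecLin)
        + Module.finrank ℂ
          (vecPart m (2 * n) ⊓ relSpace D (Ideal.span {p, q}) : Submodule ℂ (Fin m → Poly))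
      = Fintype.card (Expo (2 * n)) * m := by
  rw [← finrank_annihilator (2 * n) (relSpace D (Ideal.span {p, q}))]
  congr 1
  have h1 : ∀ x, (sylvester D b c p q).mulVec x = 0 ↔
      (b.equivFun.symm x).1 ∈ annihilator (2 * n) (relSpace D (Ideal.span {p, q})) := by
    intro x
    rw [annihilator_relMod_span_pair hn hp hq, sylvester, Matrix.fromRows_mulVec]
    have h2 : ∀ f, (LinearMap.toMatrix b c (shiftMap D n f)).mulVec x = 0 ↔
        (blownShift m n f).mulVec (b.equivFun.symm x).1 = 0 := by
      intro f
      have h3 := LinearMap.toMatrix_mulVec_repr b c (shiftMap D n f) (b.equivFun.symm x)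
      have h4 : (b.repr (b.equivFun.symm x) : _ → ℂ) = x := by
        rw [← Module.Basis.equivFun_apply, LinearEquiv.apply_symm_apply]
      rw [h4] at h3
      rw [h3, ← Module.Basis.equivFun_apply, LinearEquiv.map_eq_zero_iff, Subtype.ext_iff]
      rfl
    rw [← h2, ← h2]
    constructor
    · intro h
      refine ⟨(b.equivFun.symm x).2, funext fun i => ?_, funext fun i => ?_⟩
      · exact congrFun h (Sum.inl i)
      · exact congrFun h (Sum.inr i)
    · rintro ⟨-, h, h'⟩
      rw [h, h']
      funext i
      cases i <;> rfl
  have h5 : annihilator (2 * n) (relSpace D (Ideal.span {p, q})) ≤ principal D (2 * n) :=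
    fun w hw => ((annihilator_relMod_span_pair hn hp hq w).1 hw).1
  rw [← (Submodule.comapSubtypeEquivOfLe h5).finrank_eq,
    ← LinearEquiv.finrank_map_eq b.equivFun]
  refine (LinearEquiv.ofEq _ _ ?_).finrank_eq
  ext x
  rw [LinearMap.mem_ker, Matrix.mulVecLin_apply, h1]
  constructor
  · intro h
    exact ⟨b.equivFun.symm x, h, b.equivFun.apply_symm_apply x⟩
  · rintro ⟨y, hy, rfl⟩
    have h6 : b.equivFun.symm (b.equivFun y) = y := b.equivFun.symm_apply_apply y
    show ((b.equivFun.symm (b.equivFun y)).1) ∈ _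
    rw [h6]; exact hy

/-! ### Common zeros -/

section Points

open scoped LinearAlgebra.Projectivization

/-- The projective plane. -/
abbrev Plane : Type := ℙ ℂ (Fin 3 → ℂ)

theorem exists_smul_rep {b : Fin 3 → ℂ} (hb : b ≠ 0) :
    ∃ t : ℂ, t ≠ 0 ∧ b = t • (Projectivization.mk ℂ b hb).rep := by
  obtain ⟨t, ht⟩ := Projectivization.exists_smul_eq_mk_rep ℂ b hb
  refine ⟨(t⁻¹ : ℂˣ), Units.ne_zero _, ?_⟩
  rw [← ht, ← Units.smul_def, inv_smul_smul]

/-- For distinct points, some 2 × 2 minor of the coordinates that involves a nonzero coordinate of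
`y` does not vanish; as a function of `x` it is the required form. -/
theorem exists_linForm_separating {x y : Plane} (h : x ≠ y) :
    ∃ c : Fin 3 → ℂ, c ⬝ᵥ y.rep = 0 ∧ c ⬝ᵥ x.rep ≠ 0 := by
  obtain ⟨k, hk⟩ := Function.ne_iff.1 y.rep_nonzero
  by_contra! hc
  have h1 : ∀ j, y.rep k * x.rep j = y.rep j * x.rep k := by
    intro j
    have h2 := hc (y.rep k • Pi.single j 1 - y.rep j • Pi.single k 1)
      (by simp [sub_dotProduct]; ring)
    simpa [sub_dotProduct, sub_eq_zero] using h2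
  apply h
  rw [← x.mk_rep, ← y.mk_rep, Projectivization.mk_eq_mk_iff']
  refine ⟨x.rep k / y.rep k, funext fun j => ?_⟩
  have hk' : y.rep k ≠ 0 := hk
  rw [Pi.smul_apply, smul_eq_mul, div_mul_eq_mul_div, div_eq_iff hk']
  linear_combination - h1 j

/-- A linear form that does not vanish on a finite set of points. -/
theorem exists_linForm_ne_zero {Z : Set Plane} (hZ : Z.Finite) :
    ∃ c : Fin 3 → ℂ, c ≠ 0 ∧ ∀ x ∈ Z, c ⬝ᵥ x.rep ≠ 0 := by
  -- The factor `X 0` forces `c ≠ 0` even if `Z` is empty.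
  set F : Poly := X 0 * ∏ x ∈ hZ.toFinset, linForm x.rep
  have hF : F ≠ 0 := mul_ne_zero (X_ne_zero 0)
    (Finset.prod_ne_zero_iff.2 fun x _ => linForm_ne_zero x.rep_nonzero)
  obtain ⟨c, hc⟩ : ∃ c, eval c F ≠ 0 := by
    by_contra! h
    exact hF (MvPolynomial.funext fun c => by rw [h c, map_zero])
  rw [map_mul, map_prod] at hc
  refine ⟨c, ?_, fun x hx => ?_⟩
  · rintro rfl
    simp at hc
  · have := Finset.prod_ne_zero_iff.1 (right_ne_zero_of_mul hc) x (hZ.mem_toFinset.2 hx)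
    rwa [eval_linForm, dotProduct_comm] at this

variable {m : ℕ} {D : Fin 3 → Matrix (Fin m) (Fin m) ℂ}

theorem det_map_eval (D : Fin 3 → Matrix (Fin m) (Fin m) ℂ) (a : Fin 3 → ℂ) :
    ((pencil D).map (eval a)).det = eval a (disc D) := by
  rw [disc, RingHom.map_det]; rfl

theorem exists_kernel_vector {a : Fin 3 → ℂ} (h : eval a (disc D) = 0) :
    ∃ κ : Fin m → ℂ, κ ≠ 0 ∧ ((pencil D).map (eval a)).mulVec κ = 0 := by
  rw [← det_map_eval] at h
  exact Matrix.exists_mulVec_eq_zero_iff.2 h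

/-- Evaluation of a vector at the point `a`, followed by the functional `κ`. -/
def evalAt (a : Fin 3 → ℂ) (κ : Fin m → ℂ) : (Fin m → Poly) →ₗ[ℂ] ℂ where
  toFun v := ∑ b, eval a (v b) * κ b
  map_add' v w := by simp [add_mul, Finset.sum_add_distrib]
  map_smul' t v := by simp [Finset.mul_sum, mul_assoc, smul_eval]

theorem evalAt_apply (a : Fin 3 → ℂ) (κ : Fin m → ℂ) (v : Fin m → Poly) :
    evalAt a κ v = ∑ b, eval a (v b) * κ b := rfl

/-- Since `κ` is in the right kernel of the pencil at `a`, this evaluation is a functional on the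
cokernel modulo `I`. -/
theorem evalAt_eq_zero {I : Ideal Poly} {a : Fin 3 → ℂ} {κ : Fin m → ℂ}
    (hκ : ((pencil D).map (eval a)).mulVec κ = 0) (hI : ∀ f ∈ I, eval a f = 0)
    {v : Fin m → Poly} (hv : v ∈ relMod D I) : evalAt a κ v = 0 := by
  obtain ⟨u, hu⟩ := hv
  have h1 : ∀ b, eval a (v b) = Matrix.vecMul (fun i => eval a (u i)) ((pencil D).map (eval a)) b := by
    intro b
    have := hI _ (hu b)
    rw [map_sub, sub_eq_zero] at this
    rw [this]
    simp [Matrix.vecMul, dotProduct]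
  rw [evalAt_apply]
  simp only [h1]
  show Matrix.vecMul _ _ ⬝ᵥ κ = 0
  rw [← Matrix.dotProduct_mulVec, hκ, dotProduct_zero]

theorem eval_eq_zero_of_mem_span {s : Set Poly} {a : Fin 3 → ℂ} (h : ∀ f ∈ s, eval a f = 0) :
    ∀ f ∈ Ideal.span s, eval a f = 0 := by
  have : Ideal.span s ≤ RingHom.ker (eval a) := Ideal.span_le.2 h
  exact this

/-- A form of Bézout's bound. Evaluations at distinct points, paired with kernel vectors, are
independent functionals on the cokernel modulo `p` in a large degree, where its dimension is `n *
m`. -/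
theorem card_zeros_le (hirr : Irreducible (disc D)) {p : Poly} {n : ℕ}
    (hp : p.IsHomogeneous n) (hn : 1 ≤ n) (hpD : ¬ disc D ∣ p) (T : Finset Plane)
    (hT : ∀ x ∈ T, eval x.rep (disc D) = 0 ∧ eval x.rep p = 0) : T.card ≤ n * m := by
  classical
  choose κ hκ0 hκ using fun x : T => exists_kernel_vector (hT x x.2).1
  set k := T.card
  set g : vecPart m (k + n) →ₗ[ℂ] (T → ℂ) :=
    (LinearMap.pi fun x : T => evalAt x.1.rep (κ x)) ∘ₗ (vecPart m (k + n)).subtype with hg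
  have hsurj : LinearMap.range g = ⊤ := by
    rw [eq_top_iff, ← (Pi.basisFun ℂ T).span_eq, Submodule.span_le]
    rintro _ ⟨x, rfl⟩
    obtain ⟨b, hb⟩ := Function.ne_iff.1 (hκ0 x)
    obtain ⟨j, hj⟩ := Function.ne_iff.1 x.1.rep_nonzero
    have hsep : ∀ y : Plane, ∃ c : Fin 3 → ℂ,
        y ≠ x.1 → c ⬝ᵥ y.rep = 0 ∧ c ⬝ᵥ x.1.rep ≠ 0 := by
      intro y
      by_cases hy : y = x.1
      · exact ⟨0, fun h => absurd hy h⟩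
      · obtain ⟨c, hc⟩ := exists_linForm_separating (Ne.symm hy)
        exact ⟨c, fun _ => hc⟩
    choose c hc using hsep
    -- A product of `k - 1` linear forms vanishing at the other points but not at `x`, brought to
    -- degree `k - 1 + n` by a power of a coordinate nonzero at `x`.
    set f : Poly := (∏ y ∈ T.erase x.1, linForm (c y)) * X j ^ n with hf
    have hfh : f.IsHomogeneous (k - 1 + n) := by
      refine IsHomogeneous.mul ?_ (isHomogeneous_X_pow j n)
      have := IsHomogeneous.prod (T.erase x.1) (fun y => linForm (c y)) (fun _ => 1)
        (fun y _ => linForm_isHomogeneous _)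
      simpa [Finset.card_erase_of_mem x.2] using this
    have hk : 1 ≤ k := Finset.card_pos.2 ⟨x.1, x.2⟩
    have hv : Pi.single b f ∈ vecPart m (k + n) := by
      rw [show k + n = (k - 1 + n) + 1 by omega, mem_vecPart_succ]
      intro b'
      by_cases hb' : b' = b
      · subst hb'; rwa [Pi.single_eq_same]
      · simp [hb', isHomogeneous_zero]
    have hfx : eval x.1.rep f ≠ 0 := by
      rw [hf, map_mul, map_prod, map_pow, eval_X]
      refine mul_ne_zero (Finset.prod_ne_zero_iff.2 fun y hy => ?_) (pow_ne_zero _ hj)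
      rw [eval_linForm]
      exact (hc y (Finset.ne_of_mem_erase hy)).2
    have hfy : ∀ y : T, y ≠ x → eval y.1.rep f = 0 := by
      intro y hy
      have hy' : y.1 ≠ x.1 := fun h => hy (Subtype.ext h)
      rw [hf, map_mul, map_prod, Finset.prod_eq_zero (Finset.mem_erase.2 ⟨hy', y.2⟩), zero_mul]
      rw [eval_linForm]
      exact (hc y.1 hy').1
    have hgv : ∀ y, g ⟨_, hv⟩ y = eval y.1.rep f * κ y b := by
      intro y
      show evalAt y.1.rep (κ y) (Pi.single b f) = _
      rw [evalAt_apply, Finset.sum_eq_single b]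
      · simp
      · intro b' _ hb'
        simp [hb']
      · simp
    refine ⟨(eval x.1.rep f * κ x b)⁻¹ • ⟨_, hv⟩, funext fun y => ?_⟩
    rw [map_smul, Pi.smul_apply, hgv, Pi.basisFun_apply]
    by_cases hy : y = x
    · subst hy
      rw [Pi.single_eq_same, smul_eq_mul, inv_mul_cancel₀ (mul_ne_zero hfx hb)]
    · rw [hfy y hy, Pi.single_eq_of_ne hy, zero_mul, smul_zero]
  have h1 := g.finrank_range_add_finrank_ker
  rw [hsurj, finrank_top, finrank_vecPart] at h1
  have h2 := finrank_inf_relSpace_singleton hirr hp hn hpD k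
  have h3 : (relSpace D (Ideal.span {p})).comap (vecPart m (k + n)).subtype
      ≤ LinearMap.ker g := by
    intro v hv
    refine LinearMap.mem_ker.2 (funext fun x => ?_)
    exact evalAt_eq_zero (hκ x) (eval_eq_zero_of_mem_span (by simpa using (hT x x.2).2)) hv
  have h4 := Submodule.finrank_mono h3
  have h5 : (vecPart m (k + n) ⊓ relSpace D (Ideal.span {p})).comap (vecPart m (k + n)).subtype
      = (relSpace D (Ideal.span {p})).comap (vecPart m (k + n)).subtype := by ext; simp
  rw [← h5, (Submodule.comapSubtypeEquivOfLe inf_le_left).finrank_eq] at h4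
  simp only [Module.finrank_fintype_fun_eq_card, Fintype.card_coe] at h1
  change k + _ = _ at h1
  omega

/-- The curve and a curve that does not contain it have finitely many common points. -/
theorem finite_zeros (hirr : Irreducible (disc D)) {p : Poly} {n : ℕ}
    (hp : p.IsHomogeneous n) (hn : 1 ≤ n) (hpD : ¬ disc D ∣ p) :
    {x : Plane | eval x.rep (disc D) = 0 ∧ eval x.rep p = 0}.Finite := by
  by_contra h
  obtain ⟨T, hT, hT'⟩ := Set.Infinite.exists_subset_card_eq h (n * m + 1)
  have := card_zeros_le hirr hp hn hpD T fun x hx => hT hx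
  omega

theorem exists_linForm_avoiding (hirr : Irreducible (disc D)) {p : Poly} {n : ℕ}
    (hp : p.IsHomogeneous n) (hn : 1 ≤ n) (hpD : ¬ disc D ∣ p) :
    ∃ c : Fin 3 → ℂ, c ≠ 0 ∧
      ∀ b : Fin 3 → ℂ, b ≠ 0 → eval b (disc D) = 0 → eval b p = 0 → c ⬝ᵥ b ≠ 0 := by
  obtain ⟨c, hc0, hc⟩ := exists_linForm_ne_zero (finite_zeros hirr hp hn hpD)
  refine ⟨c, hc0, fun b hb h1 h2 => ?_⟩
  obtain ⟨t, ht, hbt⟩ := exists_smul_rep hb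
  rw [hbt, eval_smul_of_isHomogeneous disc_isHomogeneous] at h1
  rw [hbt, eval_smul_of_isHomogeneous hp] at h2
  rw [hbt, dotProduct_smul]
  exact smul_ne_zero ht (hc _ ⟨(mul_eq_zero.1 h1).resolve_left (pow_ne_zero _ ht),
    (mul_eq_zero.1 h2).resolve_left (pow_ne_zero _ ht)⟩)

end Points

/-! ### Dehomogenization -/

/-- Modulo `ℓ - 1`, every polynomial is a form of any sufficiently large degree. -/
theorem exists_homogenization (c : Fin 3 → ℂ) (f : Poly) :
    ∃ N, ∀ d, N ≤ d → ∃ F : Poly, F.IsHomogeneous d ∧ linForm c - C 1 ∣ f - F := by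
  refine ⟨f.totalDegree, fun d hd => ?_⟩
  refine ⟨∑ i ∈ Finset.range (f.totalDegree + 1), homogeneousComponent i f * linForm c ^ (d - i),
    IsHomogeneous.sum _ _ _ fun i hi => ?_, ?_⟩
  · have h := (homogeneousComponent_isHomogeneous i f).mul ((linForm_isHomogeneous c).pow (d - i))
    have hi' := Finset.mem_range.1 hi
    rwa [show i + 1 * (d - i) = d by omega] at h
  · conv_rhs => arg 1; rw [← sum_homogeneousComponent f]
    rw [← Finset.sum_sub_distrib]
    refine Finset.dvd_sum fun i _ => ?_
    have h : linForm c - 1 ∣ linForm c ^ (d - i) - 1 := sub_one_dvd_pow_sub_one _ _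
    obtain ⟨g, hg⟩ := h
    refine ⟨- (homogeneousComponent i f * g), ?_⟩
    rw [map_one]
    linear_combination - homogeneousComponent i f * hg

theorem exists_homogenization_vec {m : ℕ} (c : Fin 3 → ℂ) (v : Fin m → Poly) :
    ∃ N, ∀ d, N ≤ d → ∃ w ∈ vecPart m d, ∀ b, linForm c - C 1 ∣ v b - w b := by
  choose N hN using fun b => exists_homogenization c (v b)
  refine ⟨∑ b, N b + 1, fun d hd => ?_⟩
  have h : ∀ b, ∃ F : Poly, F.IsHomogeneous (d - 1) ∧ linForm c - C 1 ∣ v b - F := fun b =>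
    hN b _ (by
      have := Finset.single_le_sum (f := N) (fun i _ => Nat.zero_le _) (Finset.mem_univ b)
      omega)
  choose w hw hw' using h
  refine ⟨w, ?_, hw'⟩
  rw [show d = d - 1 + 1 by omega, mem_vecPart_succ]
  exact hw

/-- A form that vanishes on the plane `ℓ = 1` vanishes by scaling wherever `ℓ` is nonzero, so its
product with `ℓ` is zero. -/
theorem eq_zero_of_linForm_sub_one_dvd {c : Fin 3 → ℂ} (hc : c ≠ 0) {f : Poly} {d : ℕ}
    (hf : f.IsHomogeneous d) (h : linForm c - C 1 ∣ f) : f = 0 := by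
  have h1 : linForm c * f = 0 := by
    refine MvPolynomial.funext fun b => ?_
    rw [map_mul, map_zero, eval_linForm]
    by_cases hb : c ⬝ᵥ b = 0
    · rw [hb, zero_mul]
    · obtain ⟨g, rfl⟩ := h
      have h2 : b = (c ⬝ᵥ b) • ((c ⬝ᵥ b)⁻¹ • b) := by rw [smul_smul, mul_inv_cancel₀ hb, one_smul]
      have h3 : c ⬝ᵥ ((c ⬝ᵥ b)⁻¹ • b) = 1 := by
        rw [dotProduct_smul, smul_eq_mul, inv_mul_cancel₀ hb]
      conv_lhs => arg 2; rw [h2]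
      rw [eval_smul_of_isHomogeneous hf, map_mul, map_sub, eval_linForm, h3, eval_C]
      ring
  exact (mul_eq_zero.1 h1).resolve_left (linForm_ne_zero hc)

/-! ### The cokernel on the affine plane `ℓ = 1`. -/

section Affine

variable {m : ℕ} (D : Fin 3 → Matrix (Fin m) (Fin m) ℂ)

/-- The ideal `(p, q, ℓ - 1)`. -/
def affIdeal (p q : Poly) (c : Fin 3 → ℂ) : Ideal Poly := Ideal.span {p, q, linForm c - C 1}

/-- The cokernel of the pencil modulo `p` and `q`, on the affine plane `ℓ = 1`. -/
abbrev AffCoker (p q : Poly) (c : Fin 3 → ℂ) : Type :=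
  (Fin m → Poly) ⧸ relMod D (affIdeal p q c)

variable {D}

theorem mem_affIdeal {p q : Poly} {c : Fin 3 → ℂ} {f : Poly} :
    f ∈ affIdeal p q c ↔ ∃ x y, linForm c - C 1 ∣ f - x * p - y * q := by
  simp only [affIdeal, Ideal.mem_span_insert, Ideal.mem_span_singleton]
  constructor
  · rintro ⟨x, _, ⟨y, z, hz, rfl⟩, rfl⟩
    exact ⟨x, y, by convert hz using 1; ring⟩
  · rintro ⟨x, y, h⟩
    exact ⟨x, f - x * p, ⟨y, _, h, by ring⟩, by ring⟩

theorem mem_affIdeal_of_dvd (p q : Poly) {c : Fin 3 → ℂ} {f : Poly} (h : linForm c - C 1 ∣ f) :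
    f ∈ affIdeal p q c := mem_affIdeal.2 ⟨0, 0, by simpa using h⟩

/-- Homogenize in a large degree, divide by a power of `ℓ` modulo `p` to come down to degree `2n -
1`, and use that `ℓ = 1` in the affine cokernel. -/
theorem exists_vecPart_sub_mem (hirr : Irreducible (disc D)) {p q : Poly} {n : ℕ}
    (hp : p.IsHomogeneous n) (hn : 1 ≤ n) (hpD : ¬ disc D ∣ p)
    {c : Fin 3 → ℂ} (hc0 : c ≠ 0)
    (hc : ∀ b : Fin 3 → ℂ, b ≠ 0 → eval b (disc D) = 0 → eval b p = 0 → c ⬝ᵥ b ≠ 0)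
    (v : Fin m → Poly) :
    ∃ w ∈ vecPart m (2 * n), v - w ∈ relMod D (affIdeal p q c) := by
  obtain ⟨N, hN⟩ := exists_homogenization_vec c v
  obtain ⟨y, hy, hvy⟩ := hN (n + n + N) (by omega)
  obtain ⟨w, hw, hyw⟩ := exists_sub_pow_smul_mem_relMod hirr hp hn hpD hc0 hc n N hy
  refine ⟨w, by rwa [two_mul], ?_⟩
  have h1 : v - y ∈ relMod D (affIdeal p q c) :=
    mem_relMod_of_forall_mem fun b => mem_affIdeal_of_dvd p q (hvy b)
  have h2 : y - linForm c ^ N • w ∈ relMod D (affIdeal p q c) :=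
    relMod_mono (Ideal.span_mono (by simp)) hyw
  have h3 : (linForm c ^ N - 1) • w ∈ relMod D (affIdeal p q c) :=
    smul_mem_relMod (mem_affIdeal_of_dvd p q (by rw [map_one]; exact sub_one_dvd_pow_sub_one _ _)) w
  convert Submodule.add_mem _ (Submodule.add_mem _ h1 h2) h3 using 1
  rw [sub_smul, one_smul]; abel

/-- An affine relation homogenizes to a relation for `ℓ^j v`. The power of `ℓ` is then removed
modulo `p`, after its coefficient at `q` has been divided by `ℓ^j`. -/
theorem mem_relMod_of_mem_affIdeal (hirr : Irreducible (disc D)) {p q : Poly} {n : ℕ}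
    (hp : p.IsHomogeneous n) (hq : q.IsHomogeneous n) (hn : 1 ≤ n) (hpD : ¬ disc D ∣ p)
    {c : Fin 3 → ℂ} (hc0 : c ≠ 0)
    (hc : ∀ b : Fin 3 → ℂ, b ≠ 0 → eval b (disc D) = 0 → eval b p = 0 → c ⬝ᵥ b ≠ 0)
    {v : Fin m → Poly} (hv : v ∈ vecPart m (2 * n)) (h : v ∈ relMod D (affIdeal p q c)) :
    v ∈ relMod D (Ideal.span {p, q}) := by
  obtain ⟨u, hu⟩ := h
  choose x y hxy using fun b => mem_affIdeal.1 (hu b)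
  obtain ⟨N₁, h₁⟩ := exists_homogenization_vec c u
  obtain ⟨N₂, h₂⟩ := exists_homogenization_vec c x
  obtain ⟨N₃, h₃⟩ := exists_homogenization_vec c y
  set j := N₁ + N₂ + N₃
  obtain ⟨U, hU, hU'⟩ := h₁ (2 * n + j - 1) (by omega)
  obtain ⟨A, hA, hA'⟩ := h₂ (n + j) (by omega)
  obtain ⟨B, hB, hB'⟩ := h₃ (n + j) (by omega)
  set z : Fin m → Poly := linForm c ^ j • v - Matrix.vecMul U (pencil D) - p • A - q • B with hz
  have hzh : z ∈ vecPart m (2 * n + j) := by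
    refine Submodule.sub_mem _ (Submodule.sub_mem _ (Submodule.sub_mem _ ?_ ?_) ?_) ?_
    · have := smul_mem_vecPart ((linForm_isHomogeneous c).pow j) hv
      rwa [one_mul] at this
    · have := vecMul_mem_vecPart D hU
      rwa [show 2 * n + j - 1 + 1 = 2 * n + j by omega] at this
    · have := smul_mem_vecPart hp hA
      rwa [show n + j + n = 2 * n + j by ring] at this
    · have := smul_mem_vecPart hq hB
      rwa [show n + j + n = 2 * n + j by ring] at this
  have hz0 : z = 0 := by
    funext b
    refine eq_zero_of_linForm_sub_one_dvd hc0 (d := 2 * n + j - 1) ?_ ?_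
    · rw [show 2 * n + j = 2 * n + j - 1 + 1 by omega, mem_vecPart_succ] at hzh
      exact hzh b
    · have e1 : linForm c - C 1 ∣ (linForm c ^ j - 1) * v b :=
        Dvd.dvd.mul_right (by rw [map_one]; exact sub_one_dvd_pow_sub_one _ _) _
      have e2 : linForm c - C 1 ∣ Matrix.vecMul (u - U) (pencil D) b := by
        simp only [Matrix.vecMul, dotProduct]
        exact Finset.dvd_sum fun a _ => (hU' a).mul_right _
      have e3 := (hA' b).mul_left p
      have e4 := (hB' b).mul_left q
      have e := dvd_add (dvd_add (dvd_add (dvd_add e1 e2) e3) e4) (hxy b)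
      convert e using 1
      rw [Matrix.sub_vecMul]
      simp only [hz, Pi.sub_apply, Pi.smul_apply, smul_eq_mul]
      ring
  have hv' : linForm c ^ j • v = Matrix.vecMul U (pencil D) + p • A + q • B := by
    rw [hz, sub_sub, sub_sub, sub_eq_zero] at hz0
    rw [hz0]; abel
  -- Here `B` has degree `n + j - 1` and `B'` has degree `n - 1`, the first degree from which `ℓ` is
  -- bijective modulo `p`. Then `q B'` has degree `2n - 1`, like `v`.
  obtain ⟨B', hB1, hB2⟩ := exists_sub_pow_smul_mem_relMod hirr hp hn hpD hc0 hc 0 j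
    (by rwa [Nat.zero_add])
  have h1 : linForm c ^ j • (v - q • B') ∈ relMod D (Ideal.span {p}) := by
    have := Submodule.add_mem _ (Submodule.add_mem _ (vecMul_mem_relMod (D := D) _ U)
      (smul_mem_relMod (Ideal.mem_span_singleton_self p) A)) (Submodule.smul_mem _ q hB2)
    convert this using 1
    rw [smul_sub, hv', smul_sub, smul_comm q]; abel
  have h2 := mem_relMod_of_pow_smul_mem hirr hp (by omega) hc0 hc j h1
  have h3 := Submodule.add_mem _ (relMod_mono (Ideal.span_mono (t := {p, q}) (by simp)) h2)
    (smul_mem_relMod (D := D) (Ideal.subset_span (s := {p, q}) (by simp : q ∈ _)) B')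
  simpa using h3

/-- The restriction of the projection to the affine cokernel to vectors of forms. -/
def vecPartToAff (D : Fin 3 → Matrix (Fin m) (Fin m) ℂ) (p q : Poly) (c : Fin 3 → ℂ) (k : ℕ) :
    vecPart m k →ₗ[ℂ] AffCoker D p q c :=
  (relMod D (affIdeal p q c)).mkQ.restrictScalars ℂ ∘ₗ (vecPart m k).subtype

theorem finite_affCoker_and_finrank (hirr : Irreducible (disc D)) {p q : Poly} {n : ℕ}
    (hp : p.IsHomogeneous n) (hq : q.IsHomogeneous n) (hn : 1 ≤ n) (hpD : ¬ disc D ∣ p)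
    {c : Fin 3 → ℂ} (hc0 : c ≠ 0)
    (hc : ∀ b : Fin 3 → ℂ, b ≠ 0 → eval b (disc D) = 0 → eval b p = 0 → c ⬝ᵥ b ≠ 0) :
    Module.Finite ℂ (AffCoker D p q c) ∧
    Module.finrank ℂ (AffCoker D p q c) + Module.finrank ℂ
          (vecPart m (2 * n) ⊓ relSpace D (Ideal.span {p, q}) : Submodule ℂ (Fin m → Poly))
      = Fintype.card (Expo (2 * n)) * m := by
  set g := vecPartToAff D p q c (2 * n)
  have hsurj : Function.Surjective g := by
    intro x
    obtain ⟨v, rfl⟩ := Submodule.Quotient.mk_surjective _ x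
    obtain ⟨w, hw, h⟩ := exists_vecPart_sub_mem (q := q) hirr hp hn hpD hc0 hc v
    exact ⟨⟨w, hw⟩, ((Submodule.Quotient.eq _).2 h).symm⟩
  refine ⟨Module.Finite.of_surjective g hsurj, ?_⟩
  have h1 := g.finrank_range_add_finrank_ker
  rw [LinearMap.range_eq_top.2 hsurj, finrank_top, finrank_vecPart] at h1
  rw [← h1]
  congr 1
  rw [← (Submodule.comapSubtypeEquivOfLe (p := vecPart m (2 * n) ⊓ relSpace D (Ideal.span {p, q}))
    inf_le_left).finrank_eq]
  refine (LinearEquiv.ofEq _ _ ?_).finrank_eq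
  ext ⟨v, hv⟩
  simp only [Submodule.mem_comap, Submodule.mem_inf, Submodule.coe_subtype, LinearMap.mem_ker]
  have h2 : g ⟨v, hv⟩ = 0 ↔ v ∈ relMod D (affIdeal p q c) := Submodule.Quotient.mk_eq_zero _
  rw [h2]
  constructor
  · rintro ⟨-, h⟩
    exact relMod_mono (Ideal.span_mono (by simp [Set.insert_subset_iff])) h
  · exact fun h => ⟨hv, mem_relMod_of_mem_affIdeal hirr hp hq hn hpD hc0 hc hv h⟩

theorem finrank_ker_sylvester_eq_affCoker (hirr : Irreducible (disc D)) {p q : Poly} {n : ℕ}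
    (hp : p.IsHomogeneous n) (hq : q.IsHomogeneous n) (hn : 1 ≤ n) (hpD : ¬ disc D ∣ p)
    {c : Fin 3 → ℂ} (hc0 : c ≠ 0)
    (hc : ∀ b : Fin 3 → ℂ, b ≠ 0 → eval b (disc D) = 0 → eval b p = 0 → c ⬝ᵥ b ≠ 0)
    (b : Module.Basis (Fin (n * m) ⊕ Fin (n * m)) ℂ (principal D (2 * n)))
    (b' : Module.Basis (Fin (n * m)) ℂ (principal D n)) :
    Module.finrank ℂ (LinearMap.ker (sylvester D b b' p q).mulVecLin)
      = Module.finrank ℂ (AffCoker D p q c) := by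
  have h1 := (finite_affCoker_and_finrank hirr hp hq hn hpD hc0 hc).2
  have h2 := finrank_ker_sylvester hn hp hq b b'
  omega

end Affine

/-! ### Lengths -/

/-- If the residue fields of `R` are quotients of `A`, lengths over `A` and over `R` agree. -/
theorem length_eq_of_surjective_residue (A : Type*) {R M : Type*} [CommRing A] [CommRing R]
    [Algebra A R] [AddCommGroup M] [Module A M] [Module R M] [IsScalarTower A R M]
    (h : ∀ P : Ideal R, P.IsMaximal → Function.Surjective (algebraMap A (R ⧸ P))) :
    Module.length A M = Module.length R M := by
  -- The factors `R ⧸ P` of a composition series over `R` have length one over `A`, as `A` maps onto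
  -- them. Finite length over `A` implies finite length over `R`, so infinite lengths agree as well.
  by_cases hfin : IsFiniteLength R M
  · obtain ⟨s, hs₁, hs₂⟩ := isFiniteLength_iff_exists_compositionSeries.mp hfin
    rw [← Module.length_compositionSeries s hs₁ hs₂]
    suffices ∀ k, Module.length A (s k) = k by
      rw [← Module.length_top, ← Submodule.restrictScalars_top A R M,
        ← hs₂, RelSeries.last]
      exact (this (Fin.last _)).trans (by simp)
    intro k
    induction k using Fin.induction with
    | zero =>
      have : s 0 = ⊥ := hs₁
      rw [this]; simp
    | succ i hi =>
      have hc := s.step i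
      set f : s i.castSucc →ₗ[R] s i.succ := Submodule.inclusion hc.le
      have key : IsSimpleModule R (s i.succ ⧸ LinearMap.range f) := by
        rw [Submodule.range_inclusion]
        exact (covBy_iff_quot_is_simple hc.le).1 hc
      obtain ⟨P, hP, ⟨e⟩⟩ := isSimpleModule_iff_quot_maximal.mp key
      let g : s i.succ →ₗ[R] R ⧸ P := e.toLinearMap ∘ₗ (LinearMap.range f).mkQ
      have hf : Function.Injective f := Submodule.inclusion_injective _
      have hg : Function.Surjective g := e.surjective.comp (LinearMap.range f).mkQ_surjective
      have hfg : Function.Exact f g :=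
        LinearMap.exact_iff.mpr ((e.ker_comp (LinearMap.range f).mkQ).trans
          (LinearMap.range f).ker_mkQ)
      have h1 : Module.length A (R ⧸ P) = 1 := by
        rw [Module.length_eq_of_surjective (M := R ⧸ P) (h P hP)]
        let := Ideal.Quotient.field P
        exact Module.length_eq_one_iff.2 (instIsSimpleModule _)
      rw [Module.length_eq_add_of_exact (f.restrictScalars A) (g.restrictScalars A)
        (by simpa) (by simpa) (by simpa), hi, h1]
      simp
  · have : ¬ IsFiniteLength A M := by
      contrapose! hfin
      rw [isFiniteLength_iff_isNoetherian_isArtinian] at hfin ⊢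
      exact hfin.imp (isNoetherian_of_tower A) (isArtinian_of_tower A)
    rw [← Module.length_ne_top_iff, not_ne_iff] at hfin this
    rw [hfin, this]

/-! ### Finite-dimensional modules over the polynomial ring -/

/-- A monic polynomial that annihilates the action of `s` is split as `X ^ r * χ` with `χ` prime to
`X`. -/
theorem exists_smul_eq_zero (G : Type*) [AddCommGroup G] [Module Poly G] [Module ℂ G]
    [IsScalarTower ℂ Poly G] [Module.Finite ℂ G] (s : Poly) :
    ∃ (r : ℕ) (χ : Polynomial ℂ), χ.eval 0 ≠ 0 ∧
      ∀ g : G, s ^ r • Polynomial.aeval s χ • g = 0 := by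
  obtain ⟨P, hP, hP0⟩ := Algebra.IsIntegral.isIntegral (R := ℂ) (Algebra.lsmul ℂ ℂ G s)
  obtain ⟨χ, hχ, hχ0⟩ := P.exists_eq_pow_rootMultiplicity_mul_and_not_dvd hP.ne_zero 0
  rw [map_zero, sub_zero] at hχ hχ0
  refine ⟨P.rootMultiplicity 0, χ, ?_, fun g => ?_⟩
  · rwa [Polynomial.X_dvd_iff, Polynomial.coeff_zero_eq_eval_zero] at hχ0
  · have h1 : Polynomial.aeval (Algebra.lsmul ℂ ℂ G s) P = 0 := hP0
    rw [Polynomial.aeval_algHom_apply, hχ, map_mul, map_pow, Polynomial.aeval_X] at h1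
    have h2 := LinearMap.congr_fun h1 g
    rw [← smul_assoc]
    exact h2

/-- A finite-dimensional module over the polynomial ring is the product of its localizations. -/
theorem bijective_of_localizations {G : Type*} [AddCommGroup G] [Module Poly G] [Module ℂ G]
    [IsScalarTower ℂ Poly G] [Module.Finite ℂ G] {ι : Type*} [Fintype ι]
    {H : ι → Type*} [∀ i, AddCommGroup (H i)] [∀ i, Module Poly (H i)]
    (Ψ : ∀ i, G →ₗ[Poly] H i) (a : ι → Fin 3 → ℂ) (ha : Function.Injective a)
    (hunit : ∀ i s, eval (a i) s ≠ 0 → Function.Bijective fun h : H i => s • h)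
    (hker : ∀ i g, Ψ i g = 0 → ∃ s, eval (a i) s ≠ 0 ∧ s • g = 0)
    (hsurj : ∀ i h, ∃ s g, eval (a i) s ≠ 0 ∧ s • h = Ψ i g)
    (hsupp : ∀ b, b ∉ Set.range a → ∃ f, eval b f ≠ 0 ∧ ∀ g : G, f • g = 0) :
    Function.Bijective (LinearMap.pi Ψ) := by
  classical
  -- On `H i` the power `s ^ r` is invertible and can be cancelled, so `χ(s)` kills the image of
  -- `G`.
  have hkill : ∀ i s, eval (a i) s ≠ 0 → ∃ χ : Polynomial ℂ, χ.eval 0 ≠ 0 ∧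
      ∀ g, Polynomial.aeval s χ • Ψ i g = 0 := by
    intro i s hs
    obtain ⟨r, χ, hχ, h⟩ := exists_smul_eq_zero G s
    refine ⟨χ, hχ, fun g => ?_⟩
    refine (hunit i (s ^ r) (by rw [map_pow]; exact pow_ne_zero _ hs)).1 ?_
    show s ^ r • _ = s ^ r • (0 : H i)
    rw [← map_smul, ← map_smul, h g, map_zero, smul_zero]
  -- As `χ(s) = s χ₁(s) + χ(0)` kills `h`, the inverse of `s` acts on `h` as a polynomial in `s`,
  -- and the denominator disappears.
  have hsurj' : ∀ i, Function.Surjective (Ψ i) := by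
    intro i h
    obtain ⟨s, g, hs, hg⟩ := hsurj i h
    obtain ⟨χ, hχ, hχ'⟩ := hkill i s hs
    have h1 : Polynomial.aeval s χ • h = 0 := by
      refine (hunit i s hs).1 ?_
      show s • _ = s • (0 : H i)
      rw [smul_comm, hg, hχ', smul_zero]
    have h2 : Polynomial.aeval s χ = s * Polynomial.aeval s χ.divX + C (χ.eval 0) := by
      conv_lhs => rw [← χ.X_mul_divX_add]
      rw [map_add, map_mul, Polynomial.aeval_X, Polynomial.aeval_C,
        Polynomial.coeff_zero_eq_eval_zero]
      rfl
    rw [h2, add_smul, mul_comm, mul_smul, hg, ← map_smul] at h1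
    refine ⟨(C (- (χ.eval 0)⁻¹) : Poly) • Polynomial.aeval s χ.divX • g, ?_⟩
    rw [map_smul, eq_neg_of_add_eq_zero_left h1, smul_neg, smul_smul, ← map_mul, neg_mul,
      inv_mul_cancel₀ hχ, map_neg, map_one, neg_smul, one_smul, neg_neg]
  constructor
  · rw [← LinearMap.ker_eq_bot, LinearMap.ker_eq_bot']
    intro g hg
    by_contra hg0
    -- The annihilator of a nonzero `g` lies in a maximal ideal, which is a point `b` by the
    -- Nullstellensatz. Either `hker` or `hsupp` produces an annihilating polynomial that is nonzero
    -- at `b`.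
    have h1 : Ideal.span {f : Poly | f • g = 0} ≠ ⊤ := by
      have h2 : Ideal.span {f : Poly | f • g = 0} ≤ LinearMap.ker (LinearMap.toSpanSingleton Poly G g) :=
        Ideal.span_le.2 fun f hf => hf
      intro h3
      rw [h3, top_le_iff] at h2
      have h4 : (1 : Poly) ∈ LinearMap.ker (LinearMap.toSpanSingleton Poly G g) := h2 ▸ trivial
      exact hg0 (by simpa using h4)
    obtain ⟨P, hP, hle⟩ := Ideal.exists_le_maximal _ h1
    obtain ⟨b, rfl⟩ := isMaximal_iff_eq_vanishingIdeal_singleton.1 hP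
    have hb : ∀ f : Poly, f • g = 0 → eval b f = 0 := by
      intro f hf
      have := (mem_vanishingIdeal_singleton_iff b f).1 (hle (Ideal.subset_span hf))
      rwa [← coe_aeval_eq_eval]
    by_cases hr : b ∈ Set.range a
    · obtain ⟨i, rfl⟩ := hr
      obtain ⟨s, hs, hsg⟩ := hker i g (congrFun hg i)
      exact hs (hb s hsg)
    · obtain ⟨f, hf, hfg⟩ := hsupp b hr
      exact hf (hb f (hfg g))
  -- A difference `X k - a j k` that is nonzero at `a i` has a polynomial `χ` killing `H i`. At `a
  -- j` the difference is zero, so the value there is `χ(0) ≠ 0`.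
  · have hsep : ∀ i j, ∃ t : Poly, i ≠ j → eval (a j) t ≠ 0 ∧ ∀ h : H i, t • h = 0 := by
      intro i j
      by_cases hij : i = j
      · exact ⟨0, fun h => absurd hij h⟩
      obtain ⟨k, hk⟩ := Function.ne_iff.1 (fun h => hij (ha h))
      obtain ⟨χ, hχ, hχ'⟩ := hkill i (X k - C (a j k)) (by simpa [sub_eq_zero] using hk)
      refine ⟨Polynomial.aeval (X k - C (a j k)) χ, fun _ => ⟨?_, fun h => ?_⟩⟩
      · rw [← coe_aeval_eq_eval, RingHom.coe_coe, ← Polynomial.aeval_algHom_apply]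
        simpa [Polynomial.coe_aeval_eq_eval] using hχ
      · obtain ⟨g, rfl⟩ := hsurj' i h
        exact hχ' g
    choose t ht using hsep
    intro η
    have hsingle : ∀ j, ∃ g, LinearMap.pi Ψ g = Pi.single j (η j) := by
      intro j
      obtain ⟨e, he, hek⟩ : ∃ e : Poly, eval (a j) e ≠ 0 ∧
          ∀ i, i ≠ j → ∀ h : H i, e • h = 0 := by
        refine ⟨∏ i ∈ Finset.univ.erase j, t i j, ?_, fun i hij h => ?_⟩
        · rw [map_prod]
          exact Finset.prod_ne_zero_iff.2 fun i hi => (ht i j (Finset.ne_of_mem_erase hi)).1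
        · rw [← Finset.prod_erase_mul _ _ (Finset.mem_erase.2 ⟨hij, Finset.mem_univ i⟩), mul_smul,
            (ht i j hij).2, smul_zero]
      obtain ⟨η', hη'⟩ := (hunit j e he).2 (η j)
      obtain ⟨g, rfl⟩ := hsurj' j η'
      refine ⟨e • g, funext fun i => ?_⟩
      rw [LinearMap.pi_apply, map_smul]
      by_cases hij : i = j
      · subst hij; rw [Pi.single_eq_same]; exact hη'
      · rw [Pi.single_eq_of_ne hij, hek i hij]
    choose g hg using hsingle
    refine ⟨∑ j, g j, ?_⟩
    rw [map_sum]
    simp only [hg]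
    exact Finset.univ_sum_single η

/-! ### The local rings -/

section LocalRing

variable {m : ℕ} (D : Fin 3 → Matrix (Fin m) (Fin m) ℂ)

instance [h : Fact (Irreducible (disc D))] : IsDomain (Poly ⧸ Ideal.span {disc D}) :=
  (Ideal.Quotient.isDomain_iff_prime _).2
    ((Ideal.span_singleton_prime h.out.ne_zero).2 h.out.prime)

theorem toFrac_eq_zero [Fact (Irreducible (disc D))] {f : Poly} :
    toFrac D f = 0 ↔ disc D ∣ f := by
  rw [toFrac, RingHom.comp_apply, IsFractionRing.to_map_eq_zero_iff, Ideal.Quotient.eq_zero_iff_mem,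
    Ideal.mem_span_singleton]

/-- The dehomogenization `x_k ↦ x_k / ℓ`. -/
def theta [Fact (Irreducible (disc D))] (c : Fin 3 → ℂ) : Poly →+* HomFrac D :=
  eval₂Hom ((toFrac D).comp C) fun k => toFrac D (X k) / toFrac D (linForm c)

variable {D} [Fact (Irreducible (disc D))] {c : Fin 3 → ℂ}

theorem theta_C (r : ℂ) : theta D c (C r) = toFrac D (C r) := by simp [theta]

theorem toFrac_linForm_ne_zero {a : Fin 3 → ℂ} (ha : eval a (disc D) = 0) (hca : c ⬝ᵥ a ≠ 0) :
    toFrac D (linForm c) ≠ 0 := by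
  rw [Ne, toFrac_eq_zero]
  rintro ⟨g, hg⟩
  apply hca
  rw [← eval_linForm, hg, map_mul, ha, zero_mul]

theorem toFrac_eq_mul_theta (hc : toFrac D (linForm c) ≠ 0) {F : Poly} {d : ℕ}
    (hF : F.IsHomogeneous d) : toFrac D F = toFrac D (linForm c) ^ d * theta D c F := by
  have h1 := eval₂_mul_of_isHomogeneous ((toFrac D).comp C) hF (toFrac D (linForm c))
    (fun k => toFrac D (X k) / toFrac D (linForm c))
  simp only [mul_div_cancel₀ _ hc] at h1
  have h2 : toFrac D F = eval₂ ((toFrac D).comp C) (fun k => toFrac D (X k)) F := by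
    have : toFrac D = eval₂Hom ((toFrac D).comp C) (fun k => toFrac D (X k)) := by
      ext <;> simp
    exact congrArg (fun φ => φ F) this
  rw [h2, h1]; rfl

theorem theta_linForm (hc : toFrac D (linForm c) ≠ 0) : theta D c (linForm c) = 1 := by
  have := toFrac_eq_mul_theta hc (linForm_isHomogeneous c)
  rw [pow_one] at this
  exact (mul_eq_left₀ hc).1 this.symm

theorem theta_eq_of_dvd (hc : toFrac D (linForm c) ≠ 0) {f F : Poly}
    (h : linForm c - C 1 ∣ f - F) : theta D c f = theta D c F := by
  obtain ⟨g, hg⟩ := h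
  have := congrArg (theta D c) hg
  rw [map_sub, map_mul, map_sub, theta_linForm hc, map_one, map_one, sub_self, zero_mul,
    sub_eq_zero] at this
  exact this

theorem theta_disc (hc : toFrac D (linForm c) ≠ 0) : theta D c (disc D) = 0 := by
  have h := toFrac_eq_mul_theta hc (disc_isHomogeneous (D := D))
  rw [(toFrac_eq_zero D).2 dvd_rfl] at h
  exact (mul_eq_zero.1 h.symm).resolve_left (pow_ne_zero _ hc)

/-- The kernel is `(Δ, ℓ - 1)`: modulo `ℓ - 1` replace `f` by a form, whose image differs from its
class in the coordinate ring by a power of the unit `ℓ`. -/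
theorem theta_eq_zero_iff (hc : toFrac D (linForm c) ≠ 0) {f : Poly} :
    theta D c f = 0 ↔ ∃ g, linForm c - C 1 ∣ f - disc D * g := by
  constructor
  · intro h
    obtain ⟨N, hN⟩ := exists_homogenization c f
    obtain ⟨F, hF, hfF⟩ := hN N le_rfl
    have h1 := toFrac_eq_mul_theta hc hF
    rw [← theta_eq_of_dvd hc hfF, h, mul_zero, toFrac_eq_zero] at h1
    obtain ⟨g, rfl⟩ := h1
    exact ⟨g, hfF⟩
  · rintro ⟨g, hg⟩
    rw [theta_eq_of_dvd hc hg, map_mul, theta_disc hc, zero_mul]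

/-- The affine representative of a point. -/
def affRep (c a : Fin 3 → ℂ) : Fin 3 → ℂ := (c ⬝ᵥ a)⁻¹ • a

theorem dotProduct_affRep {a : Fin 3 → ℂ} (hca : c ⬝ᵥ a ≠ 0) : c ⬝ᵥ affRep c a = 1 := by
  rw [affRep, dotProduct_smul, smul_eq_mul, inv_mul_cancel₀ hca]

theorem eval_affRep {a : Fin 3 → ℂ} {F : Poly} {d : ℕ} (hF : F.IsHomogeneous d) :
    eval (affRep c a) F = (c ⬝ᵥ a)⁻¹ ^ d * eval a F := eval_smul_of_isHomogeneous hF _ _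

theorem eval_affRep_eq_zero_iff {a : Fin 3 → ℂ} (hca : c ⬝ᵥ a ≠ 0) {F : Poly} {d : ℕ}
    (hF : F.IsHomogeneous d) : eval (affRep c a) F = 0 ↔ eval a F = 0 := by
  rw [eval_affRep hF, mul_eq_zero, or_iff_right (pow_ne_zero _ (inv_ne_zero hca))]

theorem eval_eq_of_dvd {b : Fin 3 → ℂ} (hb : c ⬝ᵥ b = 1) {f F : Poly}
    (h : linForm c - C 1 ∣ f - F) : eval b f = eval b F := by
  obtain ⟨g, hg⟩ := h
  have := congrArg (eval b) hg
  rw [map_sub, map_mul, map_sub, eval_linForm, hb, map_one, map_one, sub_self, zero_mul,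
    sub_eq_zero] at this
  exact this

variable {a : Fin 3 → ℂ}

theorem theta_mem_localRing (ha : eval a (disc D) = 0) (hca : c ⬝ᵥ a ≠ 0) (f : Poly) :
    theta D c f ∈ localRing D a := by
  have hc := toFrac_linForm_ne_zero ha hca
  obtain ⟨N, hN⟩ := exists_homogenization c f
  obtain ⟨F, hF, hfF⟩ := hN N le_rfl
  refine ⟨N, F, linForm c ^ N, hF, ?_, ?_, ?_⟩
  · simpa using (linForm_isHomogeneous c).pow N
  · rw [map_pow, eval_linForm]; exact pow_ne_zero _ hca
  · rw [theta_eq_of_dvd hc hfF, toFrac_eq_mul_theta hc hF, map_pow, mul_comm]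

theorem eval_affRep_eq_zero_of_theta (ha : eval a (disc D) = 0) (hca : c ⬝ᵥ a ≠ 0) {f : Poly}
    (h : theta D c f = 0) : eval (affRep c a) f = 0 := by
  obtain ⟨g, hg⟩ := (theta_eq_zero_iff (toFrac_linForm_ne_zero ha hca)).1 h
  rw [eval_eq_of_dvd (dotProduct_affRep hca) hg, map_mul,
    (eval_affRep_eq_zero_iff hca disc_isHomogeneous).2 ha, zero_mul]

/-- With `exists_theta_mul_eq_one`, this presents the local ring as the localization of the image of
`theta` at the affine point `affRep c a`. -/
theorem exists_mul_theta_eq (ha : eval a (disc D) = 0) (hca : c ⬝ᵥ a ≠ 0) {z : HomFrac D}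
    (hz : z ∈ localRing D a) :
    ∃ f s, eval (affRep c a) s ≠ 0 ∧ z * theta D c s = theta D c f := by
  have hc := toFrac_linForm_ne_zero ha hca
  obtain ⟨d, f, g, hf, hg, hga, h⟩ := hz
  refine ⟨f, g, (eval_affRep_eq_zero_iff hca hg).not.2 hga, ?_⟩
  rw [toFrac_eq_mul_theta hc hf, toFrac_eq_mul_theta hc hg] at h
  exact mul_left_cancel₀ (pow_ne_zero d hc) (by rw [← h]; ring)

theorem exists_theta_mul_eq_one (ha : eval a (disc D) = 0) (hca : c ⬝ᵥ a ≠ 0) {s : Poly}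
    (hs : eval (affRep c a) s ≠ 0) : ∃ z ∈ localRing D a, theta D c s * z = 1 := by
  have hc := toFrac_linForm_ne_zero ha hca
  have hs0 : theta D c s ≠ 0 := fun h => hs (eval_affRep_eq_zero_of_theta ha hca h)
  obtain ⟨N, hN⟩ := exists_homogenization c s
  obtain ⟨S, hS, hsS⟩ := hN N le_rfl
  refine ⟨(theta D c s)⁻¹, ⟨N, linForm c ^ N, S, ?_, hS, ?_, ?_⟩, mul_inv_cancel₀ hs0⟩
  · simpa using (linForm_isHomogeneous c).pow N
  · rw [eval_eq_of_dvd (dotProduct_affRep hca) hsS] at hs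
    exact (eval_affRep_eq_zero_iff hca hS).not.1 hs
  · rw [toFrac_eq_mul_theta hc hS, ← theta_eq_of_dvd hc hsS, map_pow, mul_left_comm,
      inv_mul_cancel₀ hs0, mul_one]

variable (D c a)

/-- The dehomogenization, as a map to the local ring at `a`. -/
def thetaLoc (ha : eval a (disc D) = 0) (hca : c ⬝ᵥ a ≠ 0) : Poly →+* localRing D a :=
  (theta D c).codRestrict (localRing D a) (theta_mem_localRing ha hca)

variable {D c a} (ha : eval a (disc D) = 0) (hca : c ⬝ᵥ a ≠ 0)

@[simp] theorem coe_thetaLoc (f : Poly) : (thetaLoc D c a ha hca f : HomFrac D) = theta D c f := rfl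

theorem isUnit_thetaLoc {s : Poly} (hs : eval (affRep c a) s ≠ 0) :
    IsUnit (thetaLoc D c a ha hca s) := by
  obtain ⟨z, hz, h⟩ := exists_theta_mul_eq_one ha hca hs
  exact IsUnit.of_mul_eq_one ⟨z, hz⟩ (Subtype.ext h)

theorem isUnit_thetaLoc_iff {s : Poly} :
    IsUnit (thetaLoc D c a ha hca s) ↔ eval (affRep c a) s ≠ 0 := by
  refine ⟨fun h h0 => ?_, isUnit_thetaLoc ha hca⟩
  obtain ⟨z, hz⟩ := h.exists_right_inv
  obtain ⟨f, t, ht, hft⟩ := exists_mul_theta_eq ha hca z.2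
  have h1 : theta D c (s * f - t) = 0 := by
    have h2 : theta D c s * z = 1 := congrArg Subtype.val hz
    rw [map_sub, map_mul, ← hft]
    linear_combination theta D c t * h2
  have h3 := eval_affRep_eq_zero_of_theta ha hca h1
  rw [map_sub, map_mul, h0, zero_mul, zero_sub, neg_eq_zero] at h3
  exact ht h3

theorem exists_mul_thetaLoc_eq (z : localRing D a) :
    ∃ f s, eval (affRep c a) s ≠ 0 ∧ z * thetaLoc D c a ha hca s = thetaLoc D c a ha hca f := by
  obtain ⟨f, s, hs, h⟩ := exists_mul_theta_eq ha hca z.2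
  exact ⟨f, s, hs, Subtype.ext h⟩

theorem exists_common_denominator {ι : Type*} [Fintype ι] (z : ι → localRing D a) :
    ∃ (f : ι → Poly) (s : Poly), eval (affRep c a) s ≠ 0 ∧
      ∀ i, thetaLoc D c a ha hca s * z i = thetaLoc D c a ha hca (f i) := by
  classical
  choose f s hs h using fun i => exists_mul_thetaLoc_eq ha hca (z i)
  refine ⟨fun i => f i * ∏ j ∈ Finset.univ.erase i, s j, ∏ i, s i, ?_, fun i => ?_⟩
  · rw [map_prod]
    exact Finset.prod_ne_zero_iff.2 fun i _ => hs i
  · rw [← Finset.mul_prod_erase _ _ (Finset.mem_univ i), map_mul, map_mul, ← h]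
    ring

/-- Constants, in the local ring. -/
instance algebraLocalRing (a : Fin 3 → ℂ) : Algebra ℂ (localRing D a) :=
  RingHom.toAlgebra (((toFrac D).comp C).codRestrict (localRing D a) fun r =>
    ⟨0, C r, 1, isHomogeneous_C _ r, isHomogeneous_one _ _, by simp, by simp⟩)

theorem algebraMap_localRing (r : ℂ) :
    algebraMap ℂ (localRing D a) r = thetaLoc D c a ha hca (C r) :=
  Subtype.ext (theta_C r).symm

include ha hca

/-- Being a quotient of a localization of `Poly` at a prime is enough to be Noetherian and local. -/
theorem exists_localization_surjective :
    ∃ (P : Ideal Poly) (_ : P.IsPrime) (φ : Localization.AtPrime P →+* localRing D a),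
      Function.Surjective φ := by
  have hP : (RingHom.ker (eval (affRep c a))).IsPrime := RingHom.ker_isPrime _
  refine ⟨RingHom.ker (eval (affRep c a)), hP, IsLocalization.lift
    (M := (RingHom.ker (eval (affRep c a))).primeCompl) (g := thetaLoc D c a ha hca)
    fun s => isUnit_thetaLoc ha hca s.2, ?_⟩
  rw [IsLocalization.lift_surjective_iff]
  intro z
  obtain ⟨f, s, hs, h⟩ := exists_mul_thetaLoc_eq ha hca z
  exact ⟨(f, ⟨s, hs⟩), h⟩

theorem isNoetherianRing_localRing : IsNoetherianRing (localRing D a) := by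
  obtain ⟨P, _, φ, hφ⟩ := exists_localization_surjective ha hca
  have := IsLocalization.isNoetherianRing P.primeCompl (Localization.AtPrime P) inferInstance
  exact isNoetherianRing_of_surjective _ _ φ hφ

theorem isLocalRing_localRing : IsLocalRing (localRing D a) := by
  obtain ⟨P, _, φ, hφ⟩ := exists_localization_surjective ha hca
  exact IsLocalRing.of_surjective' φ hφ

theorem residue_localRing (P : Ideal (localRing D a)) (hP : P.IsMaximal) :
    Function.Surjective (algebraMap ℂ (localRing D a ⧸ P)) := by
  have := isLocalRing_localRing ha hca
  intro y
  obtain ⟨z, rfl⟩ := Ideal.Quotient.mk_surjective y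
  obtain ⟨f, s, hs, h⟩ := exists_mul_thetaLoc_eq ha hca z
  -- The value of `z` at the point; the numerator of `z - r` vanishes there.
  set r := eval (affRep c a) f / eval (affRep c a) s with hr
  refine ⟨r, ?_⟩
  rw [IsScalarTower.algebraMap_apply ℂ (localRing D a), algebraMap_localRing ha hca]
  refine Ideal.Quotient.eq.2 ?_
  rw [IsLocalRing.eq_maximalIdeal hP, IsLocalRing.mem_maximalIdeal, mem_nonunits_iff]
  intro hu
  have h1 : IsUnit (thetaLoc D c a ha hca (C r * s - f)) := by
    have := hu.mul (isUnit_thetaLoc ha hca hs)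
    convert this using 1
    rw [map_sub, map_mul, ← h]; ring
  rw [isUnit_thetaLoc_iff] at h1
  apply h1
  rw [map_sub, map_mul, eval_C, hr, div_mul_cancel₀ _ hs, sub_self]

end LocalRing

/-! ### The local cokernels -/

section LocCoker

variable {m : ℕ} {D : Fin 3 → Matrix (Fin m) (Fin m) ℂ} [Fact (Irreducible (disc D))]
  {c a : Fin 3 → ℂ} (ha : eval a (disc D) = 0) (hca : c ⬝ᵥ a ≠ 0) {n : ℕ} {p q : Poly}

include ha hca in
theorem isGerm_theta {d : ℕ} {f : Poly} (hf : f.IsHomogeneous d) :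
    IsGerm D a d f (theta D c f) := by
  have hc := toFrac_linForm_ne_zero ha hca
  refine ⟨linForm c ^ d, ?_, ?_, ?_⟩
  · simpa using (linForm_isHomogeneous c).pow d
  · rw [map_pow, eval_linForm]; exact pow_ne_zero _ hca
  · rw [toFrac_eq_mul_theta hc hf, map_pow, mul_comm]

/-- `v` is a relation of the local cokernel, up to the denominator `s`. -/
theorem exists_of_mem_localRelations (hp : p.IsHomogeneous n) (hq : q.IsHomogeneous n)
    {v : Fin m → localRing D a} (hv : v ∈ localRelations D n p q a) :
    ∃ s, eval (affRep c a) s ≠ 0 ∧ ∃ w ∈ relMod D (affIdeal p q c),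
      ∀ b, thetaLoc D c a ha hca s * v b = thetaLoc D c a ha hca (w b) := by
  have hc := toFrac_linForm_ne_zero ha hca
  induction hv using Submodule.span_induction with
  | mem v hv =>
    rcases hv with ⟨i, h, hh, hha, hv⟩ | ⟨j, u, hu, rfl⟩
    · refine ⟨h, (eval_affRep_eq_zero_iff hca hh).not.2 hha, pencil D i, ?_, fun b => ?_⟩
      · convert vecMul_mem_relMod (D := D) (affIdeal p q c) (Pi.single i 1) using 1
        rw [Matrix.single_one_vecMul]; rfl
      · refine Subtype.ext ?_
        have h1 := hv b
        rw [toFrac_eq_mul_theta hc hh, toFrac_eq_mul_theta hc (pencil_isHomogeneous i b)] at h1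
        refine mul_left_cancel₀ (pow_ne_zero 1 hc) ?_
        rw [Subring.coe_mul, coe_thetaLoc, coe_thetaLoc, ← h1]; ring
    · obtain ⟨f, hf, hfI, h, hh, hha, hu⟩ : ∃ f, f.IsHomogeneous n ∧ f ∈ affIdeal p q c ∧
          IsGerm D a n f u := by
        rcases hu with hu | hu
        · exact ⟨p, hp, Ideal.subset_span (by simp), hu⟩
        · exact ⟨q, hq, Ideal.subset_span (by simp), hu⟩
      refine ⟨h, (eval_affRep_eq_zero_iff hca hh).not.2 hha, f • Pi.single j 1,
        smul_mem_relMod hfI _, fun b => ?_⟩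
      by_cases hb : b = j
      · subst hb
        refine Subtype.ext ?_
        rw [toFrac_eq_mul_theta hc hh, toFrac_eq_mul_theta hc hf] at hu
        refine mul_left_cancel₀ (pow_ne_zero n hc) ?_
        simp only [Pi.single_eq_same, Subring.coe_mul, coe_thetaLoc, Pi.smul_apply, smul_eq_mul,
          mul_one]
        rw [← hu]; ring
      · simp [hb]
  | zero => exact ⟨1, by simp, 0, Submodule.zero_mem _, by simp⟩
  | add v v' _ _ h h' =>
    obtain ⟨s, hs, w, hw, h⟩ := h
    obtain ⟨s', hs', w', hw', h'⟩ := h'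
    refine ⟨s * s', by rw [map_mul]; exact mul_ne_zero hs hs', s' • w + s • w',
      Submodule.add_mem _ (Submodule.smul_mem _ _ hw) (Submodule.smul_mem _ _ hw'), fun b => ?_⟩
    simp only [Pi.add_apply, Pi.smul_apply, smul_eq_mul, map_add, map_mul, ← h, ← h']
    ring
  | smul z v _ h =>
    obtain ⟨s, hs, w, hw, h⟩ := h
    obtain ⟨f, t, ht, hz⟩ := exists_mul_thetaLoc_eq ha hca z
    refine ⟨s * t, by rw [map_mul]; exact mul_ne_zero hs ht, f • w, Submodule.smul_mem _ _ hw,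
      fun b => ?_⟩
    simp only [Pi.smul_apply, smul_eq_mul, map_mul, ← h, ← hz]
    ring

theorem thetaLoc_row_mem (i : Fin m) :
    (fun b => thetaLoc D c a ha hca (pencil D i b)) ∈ localRelations D n p q a := by
  have hc := toFrac_linForm_ne_zero ha hca
  refine Submodule.subset_span (Or.inl ⟨i, linForm c, linForm_isHomogeneous c, ?_, fun j => ?_⟩)
  · rwa [eval_linForm]
  · rw [coe_thetaLoc, toFrac_eq_mul_theta hc (pencil_isHomogeneous i j), pow_one, mul_comm]

theorem single_thetaLoc_mem {f : Poly} (hf : f.IsHomogeneous n) (h : f = p ∨ f = q) (j : Fin m) :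
    Pi.single j (thetaLoc D c a ha hca f) ∈ localRelations D n p q a := by
  refine Submodule.subset_span (Or.inr ⟨j, _, ?_, rfl⟩)
  rcases h with rfl | rfl
  · exact Or.inl (isGerm_theta ha hca hf)
  · exact Or.inr (isGerm_theta ha hca hf)

theorem thetaLoc_mem_localRelations (hp : p.IsHomogeneous n) (hq : q.IsHomogeneous n)
    {v : Fin m → Poly} (hv : v ∈ relMod D (affIdeal p q c)) :
    (fun b => thetaLoc D c a ha hca (v b)) ∈ localRelations D n p q a := by
  obtain ⟨u, hu⟩ := hv
  choose x y hxy using fun b => mem_affIdeal.1 (hu b)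
  have h1 : (fun b => thetaLoc D c a ha hca (v b))
      = ∑ i, thetaLoc D c a ha hca (u i) • (fun b => thetaLoc D c a ha hca (pencil D i b))
        + ∑ b, thetaLoc D c a ha hca (x b) • Pi.single b (thetaLoc D c a ha hca p)
        + ∑ b, thetaLoc D c a ha hca (y b) • Pi.single b (thetaLoc D c a ha hca q) := by
    funext b
    have h2 : thetaLoc D c a ha hca (v b) = thetaLoc D c a ha hca
        (Matrix.vecMul u (pencil D) b + x b * p + y b * q) := by
      refine Subtype.ext (theta_eq_of_dvd (toFrac_linForm_ne_zero ha hca) ?_)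
      convert hxy b using 1; ring
    rw [h2]
    simp [Matrix.vecMul, dotProduct, Finset.sum_apply, Pi.single_apply]
  rw [h1]
  refine Submodule.add_mem _ (Submodule.add_mem _ ?_ ?_) ?_
  · exact Submodule.sum_mem _ fun i _ => Submodule.smul_mem _ _ (thetaLoc_row_mem ha hca i)
  · exact Submodule.sum_mem _ fun b _ => Submodule.smul_mem _ _
      (single_thetaLoc_mem ha hca hp (Or.inl rfl) b)
  · exact Submodule.sum_mem _ fun b _ => Submodule.smul_mem _ _
      (single_thetaLoc_mem ha hca hq (Or.inr rfl) b)

variable (n p q) in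
/-- The cokernel of the pencil at `a`, modulo `p` and `q`, as a module over the polynomial ring. -/
@[nolint unusedArguments]
def LocCoker (_ : eval a (disc D) = 0) (_ : c ⬝ᵥ a ≠ 0) : Type :=
  (Fin m → localRing D a) ⧸ localRelations D n p q a

instance : AddCommGroup (LocCoker n p q ha hca) :=
  inferInstanceAs (AddCommGroup ((Fin m → localRing D a) ⧸ localRelations D n p q a))

instance : Module (localRing D a) (LocCoker n p q ha hca) :=
  inferInstanceAs (Module (localRing D a) ((Fin m → localRing D a) ⧸ localRelations D n p q a))

instance : Module ℂ (LocCoker n p q ha hca) := Module.compHom _ (algebraMap ℂ (localRing D a))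

instance : IsScalarTower ℂ (localRing D a) (LocCoker n p q ha hca) :=
  IsScalarTower.of_algebraMap_smul fun _ _ => rfl

/-- This action depends on the chart `c`, which the type `LocCoker` records through its two proof
arguments. -/
instance : Module Poly (LocCoker n p q ha hca) := Module.compHom _ (thetaLoc D c a ha hca)

theorem poly_smul_locCoker (f : Poly) (h : LocCoker n p q ha hca) :
    f • h = thetaLoc D c a ha hca f • h := rfl

theorem complex_smul_locCoker (r : ℂ) (h : LocCoker n p q ha hca) :
    r • h = (C r : Poly) • h := by
  rw [poly_smul_locCoker, ← algebraMap_localRing ha hca]; rfl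

variable (n p q) in
/-- The projection to the local cokernel. -/
def locMk : (Fin m → localRing D a) →ₗ[localRing D a] LocCoker n p q ha hca where
  toFun v := (Submodule.Quotient.mk v : (Fin m → localRing D a) ⧸ localRelations D n p q a)
  map_add' _ _ := rfl
  map_smul' _ _ := rfl

omit [Fact (Irreducible (disc D))] in
theorem locMk_surjective : Function.Surjective (locMk ha hca n p q) :=
  (localRelations D n p q a).mkQ_surjective

omit [Fact (Irreducible (disc D))] in
theorem locMk_eq_zero {v : Fin m → localRing D a} :
    locMk ha hca n p q v = 0 ↔ v ∈ localRelations D n p q a := Submodule.Quotient.mk_eq_zero _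

/-- The map from the affine cokernel to the local cokernel. -/
def affToLoc (hp : p.IsHomogeneous n) (hq : q.IsHomogeneous n) :
    AffCoker D p q c →ₗ[Poly] LocCoker n p q ha hca :=
  (relMod D (affIdeal p q c)).liftQ
    { toFun := fun v => locMk ha hca n p q fun b => thetaLoc D c a ha hca (v b)
      map_add' := fun v w => by
        rw [← map_add]; congr 1; funext b; simp
      map_smul' := fun f v => by
        rw [RingHom.id_apply, poly_smul_locCoker, ← map_smul]
        congr 1; funext b; simp }
    fun v hv => (locMk_eq_zero ha hca).2 (thetaLoc_mem_localRelations ha hca hp hq hv)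

theorem affToLoc_mk (hp : p.IsHomogeneous n) (hq : q.IsHomogeneous n) (v : Fin m → Poly) :
    affToLoc ha hca hp hq (Submodule.Quotient.mk v)
      = locMk ha hca n p q fun b => thetaLoc D c a ha hca (v b) := rfl

theorem bijective_smul_locCoker {s : Poly} (hs : eval (affRep c a) s ≠ 0) :
    Function.Bijective fun h : LocCoker n p q ha hca => s • h := by
  obtain ⟨u, hu⟩ := isUnit_thetaLoc ha hca hs
  have : (fun h : LocCoker n p q ha hca => s • h) = fun h => u • h := by
    funext h
    rw [poly_smul_locCoker, ← hu]; rfl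
  rw [this]
  exact MulAction.bijective u

theorem exists_smul_eq_zero_of_affToLoc (hp : p.IsHomogeneous n) (hq : q.IsHomogeneous n)
    {g : AffCoker D p q c} (hg : affToLoc ha hca hp hq g = 0) :
    ∃ s, eval (affRep c a) s ≠ 0 ∧ s • g = 0 := by
  obtain ⟨v, rfl⟩ := Submodule.Quotient.mk_surjective _ g
  rw [affToLoc_mk] at hg
  obtain ⟨s, hs, w, hw, h⟩ := exists_of_mem_localRelations ha hca hp hq
    ((locMk_eq_zero ha hca).1 hg)
  refine ⟨s, hs, ?_⟩
  rw [← Submodule.Quotient.mk_smul, Submodule.Quotient.mk_eq_zero]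
  -- An equality in the local ring lifts to polynomials only modulo `ℓ - 1` and Δ. Both are
  -- relations of the affine cokernel.
  have h1 : ∀ b, ∃ y, linForm c - C 1 ∣ s * v b - w b - disc D * y := by
    intro b
    refine (theta_eq_zero_iff (toFrac_linForm_ne_zero ha hca)).1 ?_
    have h2 := congrArg Subtype.val (h b)
    rw [Subring.coe_mul, coe_thetaLoc, coe_thetaLoc, coe_thetaLoc] at h2
    rw [map_sub, map_mul, h2, sub_self]
  choose y hy using h1
  have h3 : s • v - w - disc D • y ∈ relMod D (affIdeal p q c) :=
    mem_relMod_of_forall_mem fun b => mem_affIdeal_of_dvd p q (hy b)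
  have h4 := Submodule.add_mem _ (Submodule.add_mem _ h3 hw) (disc_smul_mem (affIdeal p q c) y)
  convert h4 using 1
  abel

theorem exists_smul_eq_affToLoc (hp : p.IsHomogeneous n) (hq : q.IsHomogeneous n)
    (h : LocCoker n p q ha hca) :
    ∃ s g, eval (affRep c a) s ≠ 0 ∧ s • h = affToLoc ha hca hp hq g := by
  obtain ⟨z, rfl⟩ := locMk_surjective ha hca h
  obtain ⟨f, s, hs, hf⟩ := exists_common_denominator ha hca z
  refine ⟨s, Submodule.Quotient.mk f, hs, ?_⟩
  rw [affToLoc_mk, poly_smul_locCoker, ← map_smul]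
  congr 1
  funext b
  exact hf b

include hca in
theorem zeroMult_eq_length : zeroMult D n p q a = Module.length ℂ (LocCoker n p q ha hca) :=
  (length_eq_of_surjective_residue (R := localRing D a) (M := LocCoker n p q ha hca) ℂ
    (residue_localRing ha hca)).symm

end LocCoker

/-! ### The affine cokernel as a sum over the common zeros. -/

section Sum

variable {m : ℕ} {D : Fin 3 → Matrix (Fin m) (Fin m) ℂ} [Fact (Irreducible (disc D))]
  {c : Fin 3 → ℂ} {n : ℕ} {p q : Poly}

theorem affRep_injective {x y : Plane} (hx : c ⬝ᵥ x.rep ≠ 0)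
    (h : affRep c x.rep = affRep c y.rep) : x = y := by
  rw [← x.mk_rep, ← y.mk_rep, Projectivization.mk_eq_mk_iff']
  refine ⟨(c ⬝ᵥ x.rep) * (c ⬝ᵥ y.rep)⁻¹, ?_⟩
  rw [mul_smul]
  change _ • affRep c y.rep = _
  rw [← h, affRep, smul_smul, mul_inv_cancel₀ hx, one_smul]

theorem finrank_affCoker_eq_sum (hp : p.IsHomogeneous n) (hq : q.IsHomogeneous n)
    (hc : ∀ x ∈ commonZeros D p q, c ⬝ᵥ x.rep ≠ 0) (hfin : (commonZeros D p q).Finite)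
    [Module.Finite ℂ (AffCoker D p q c)] :
    (Module.finrank ℂ (AffCoker D p q c) : ℕ∞)
      = ∑ᶠ x ∈ commonZeros D p q, zeroMult D n p q x.rep := by
  have := hfin.fintype
  set Ψ := fun x : commonZeros D p q =>
    affToLoc (a := x.1.rep) x.2.1 (hc x x.2) hp hq
  have hbij : Function.Bijective (LinearMap.pi Ψ) := by
    refine bijective_of_localizations Ψ (fun x => affRep c x.1.rep) ?_
      (fun x s hs => bijective_smul_locCoker _ _ hs)
      (fun x g hg => exists_smul_eq_zero_of_affToLoc _ _ hp hq hg)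
      (fun x h => exists_smul_eq_affToLoc _ _ hp hq h) ?_
    · exact fun x y h => Subtype.ext (affRep_injective (hc x x.2) h)
    · intro b hb
      -- `Δ`, `p`, `q` and `ℓ - 1` annihilate the affine cokernel. If none of its annihilators is
      -- nonzero at `b`, all four vanish at `b`, and `b` represents a common zero.
      by_contra! hcon
      have hkill : ∀ f ∈ affIdeal p q c, eval b f = 0 := by
        intro f hf
        by_contra h0
        obtain ⟨g, hg⟩ := hcon f h0
        obtain ⟨v, rfl⟩ := Submodule.Quotient.mk_surjective _ g
        exact hg ((Submodule.Quotient.mk_eq_zero _).2 (smul_mem_relMod hf v))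
      have hΔ : eval b (disc D) = 0 := by
        by_contra h0
        obtain ⟨g, hg⟩ := hcon _ h0
        obtain ⟨v, rfl⟩ := Submodule.Quotient.mk_surjective _ g
        exact hg ((Submodule.Quotient.mk_eq_zero _).2 (disc_smul_mem _ v))
      have h1 := hkill p (Ideal.subset_span (by simp))
      have h2 := hkill q (Ideal.subset_span (by simp))
      have h3 := hkill (linForm c - C 1) (Ideal.subset_span (by simp))
      rw [map_sub, eval_linForm, eval_C, sub_eq_zero] at h3
      have hb0 : b ≠ 0 := by
        rintro rfl
        simp at h3
      obtain ⟨t, ht, hbt⟩ := exists_smul_rep hb0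
      set x := Projectivization.mk ℂ b hb0
      have hz : ∀ {f : Poly} {d : ℕ}, f.IsHomogeneous d → eval b f = 0 → eval x.rep f = 0 := by
        intro f d hf h
        rw [hbt, eval_smul_of_isHomogeneous hf] at h
        exact (mul_eq_zero.1 h).resolve_left (pow_ne_zero _ ht)
      refine hb ⟨⟨x, hz disc_isHomogeneous hΔ, hz hp h1, hz hq h2⟩, ?_⟩
      rw [hbt, dotProduct_smul, smul_eq_mul] at h3
      show affRep c x.rep = b
      rw [affRep, inv_eq_of_mul_eq_one_left h3]
      exact hbt.symm
  have e : AffCoker D p q c ≃ₗ[ℂ] ∀ x : commonZeros D p q,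
      LocCoker n p q (a := x.1.rep) x.2.1 (hc x x.2) :=
    { Equiv.ofBijective _ hbij with
      map_add' := fun g h => map_add (LinearMap.pi Ψ) g h
      map_smul' := fun r g => by
        funext x
        have h1 : r • g = (C r : Poly) • g := by
          rw [← algebraMap_smul Poly r g]; rfl
        show LinearMap.pi Ψ (r • g) x = r • LinearMap.pi Ψ g x
        rw [h1, map_smul, Pi.smul_apply, complex_smul_locCoker] }
  rw [← Module.length_eq_finrank, e.length_eq, Module.length_pi_of_fintype,
    ← finsum_set_coe_eq_finsum_mem, finsum_eq_sum_of_fintype]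
  exact Finset.sum_congr rfl fun x _ => (zeroMult_eq_length x.2.1 (hc x x.2)).symm

end Sum

/-! ### Lengths over semilocal principal ideal domains -/

section SemilocalPID

/-- In a Dedekind domain divisibility is containment, and a power of `P` contains `(u, v)` exactly
when it contains `u` and `v`. -/
theorem min_emultiplicity_span {N : Type*} [CommRing N] [IsDedekindDomain N] (P : Ideal N)
    (u v : N) : min (emultiplicity P (Ideal.span {u})) (emultiplicity P (Ideal.span {v}))
      = emultiplicity P (Ideal.span {u, v}) := by
  refine ENat.eq_of_forall_natCast_le_iff fun k => ?_
  rw [le_min_iff, ← pow_dvd_iff_le_emultiplicity, ← pow_dvd_iff_le_emultiplicity,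
    ← pow_dvd_iff_le_emultiplicity, Ideal.dvd_iff_le, Ideal.dvd_iff_le, Ideal.dvd_iff_le,
    ← sup_le_iff, Ideal.span_insert]

theorem emultiplicity_of_isMaximal {N : Type*} [CommRing N] [IsDedekindDomain N]
    {P Q : Ideal N} (hP : P.IsMaximal) (hQ : Q.IsMaximal) (hQ0 : Q ≠ ⊥) :
    emultiplicity P Q = if P = Q then 1 else 0 := by
  split_ifs with h
  · subst h
    have : FiniteMultiplicity P P :=
      FiniteMultiplicity.of_prime_left (Ideal.prime_of_isPrime hQ0 hQ.isPrime) hQ0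
    simpa using this.emultiplicity_self
  · refine emultiplicity_eq_zero.2 fun hd => h ?_
    exact (hQ.eq_of_le hP.ne_top (Ideal.dvd_iff_le.1 hd)).symm

/-- Induction on the irreducible factors: each generates a maximal ideal and adds one to the length
and one to a single term of the sum. -/
theorem ord_eq_finsum {N : Type*} [CommRing N] [IsDomain N] [IsPrincipalIdealRing N]
    [Finite (MaximalSpectrum N)] {d : N} (hd : d ≠ 0) :
    Ring.ord N d = ∑ᶠ P : MaximalSpectrum N, emultiplicity P.asIdeal (Ideal.span {d}) := by
  classical
  have := Fintype.ofFinite (MaximalSpectrum N)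
  rw [finsum_eq_sum_of_fintype]
  induction d using WfDvdMonoid.induction_on_irreducible with
  | zero => exact absurd rfl hd
  | unit u hu =>
    rw [Ring.ord_of_isUnit hu, Ideal.span_singleton_eq_top.2 hu]
    refine (Finset.sum_eq_zero fun P _ => emultiplicity_eq_zero.2 fun h => ?_).symm
    exact P.isMaximal.ne_top (top_le_iff.1 (Ideal.dvd_iff_le.1 h))
  | mul a i ha hi ih =>
    have hmax : (Ideal.span {i}).IsMaximal := PrincipalIdealRing.isMaximal_of_irreducible hi
    have hi0 : Ideal.span {i} ≠ ⊥ := by simpa using hi.ne_zero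
    have hmul : ∀ P : MaximalSpectrum N, emultiplicity P.asIdeal (Ideal.span {i * a})
        = (if P = ⟨_, hmax⟩ then 1 else 0) + emultiplicity P.asIdeal (Ideal.span {a}) := by
      intro P
      have hP0 : P.asIdeal ≠ ⊥ := by
        intro h
        have := P.isMaximal.eq_of_le hmax.ne_top (h ▸ bot_le)
        exact hi0 (this.symm.trans h)
      rw [← Ideal.span_singleton_mul_span_singleton,
        emultiplicity_mul (Ideal.prime_of_isPrime hP0 P.isMaximal.isPrime),
        emultiplicity_of_isMaximal P.isMaximal hmax hi0]
      simp only [MaximalSpectrum.ext_iff]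
    rw [Ring.ord_mul' N (mem_nonZeroDivisors_of_ne_zero hi.ne_zero), Ring.ord_of_irreducible hi,
      ih ha, Finset.sum_congr rfl fun P _ => hmul P, Finset.sum_add_distrib]
    simp

theorem length_quotient_span_pair {N : Type*} [CommRing N] [IsDomain N] [IsPrincipalIdealRing N]
    [Finite (MaximalSpectrum N)] {u v : N} (h : u ≠ 0 ∨ v ≠ 0) :
    Module.length N (N ⧸ Ideal.span {u, v}) = ∑ᶠ P : MaximalSpectrum N,
      min (emultiplicity P.asIdeal (Ideal.span {u})) (emultiplicity P.asIdeal (Ideal.span {v})) := by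
  obtain ⟨d, hd⟩ := IsPrincipalIdealRing.principal (Ideal.span {u, v})
  have hd' : Ideal.span {u, v} = Ideal.span {d} := hd
  have hd0 : d ≠ 0 := by
    rintro rfl
    rw [Ideal.span_singleton_eq_bot.2 rfl, Ideal.span_eq_bot] at hd'
    rcases h with h | h
    · exact h (hd' u (by simp))
    · exact h (hd' v (by simp))
  have key : ∀ I : Ideal N, I = Ideal.span {d} → Module.length N (N ⧸ I)
      = ∑ᶠ P : MaximalSpectrum N, emultiplicity P.asIdeal I := by
    rintro _ rfl
    exact ord_eq_finsum hd0
  rw [key _ hd']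
  exact finsum_congr fun P => (min_emultiplicity_span P.asIdeal u v).symm

end SemilocalPID

/-! ### Finite normal extensions of one-dimensional local rings -/

section Normalization

variable (O N : Type*) [CommRing O] [CommRing N] [Algebra O N] [Module.Finite O N]

theorem isDedekindDomain_of_finite [IsNoetherianRing O] [IsDomain N]
    (hdim : ∀ P : Ideal O, P ≠ ⊥ → P.IsPrime → P.IsMaximal)
    [IsIntegrallyClosed N] : IsDedekindDomain N := by
  have : Nontrivial O := (algebraMap O N).domain_nontrivial
  have : IsNoetherianRing N := isNoetherian_of_tower O inferInstance
  have : Ring.DimensionLEOne N := ⟨fun {P} hP0 hP => by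
    obtain ⟨x, hx, hx0⟩ := Submodule.exists_mem_ne_zero_of_ne_bot hP0
    have h1 : P.comap (algebraMap O N) ≠ ⊥ :=
      Ideal.comap_ne_bot_of_integral_mem hx0 hx (Algebra.IsIntegral.isIntegral x)
    have h2 := hdim _ h1 (hP.comap _)
    exact Ideal.isMaximal_of_isIntegral_of_isMaximal_comap P h2⟩
  exact { }

/-- By integrality all maximal ideals of `N` lie over the one of `O`, so they divide its extension,
and a nonzero ideal has finitely many divisors. -/
theorem finite_maximalSpectrum_of_finite [IsLocalRing O] [FaithfulSMul O N] [IsDedekindDomain N] :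
    Finite (MaximalSpectrum N) := by
  have : Nontrivial O := (algebraMap O N).domain_nontrivial
  have hover : ∀ P : MaximalSpectrum N,
      P.asIdeal.comap (algebraMap O N) = IsLocalRing.maximalIdeal O := fun P =>
    IsLocalRing.eq_maximalIdeal (Ideal.isMaximal_comap_of_isIntegral_of_isMaximal P.asIdeal)
  set J := (IsLocalRing.maximalIdeal O).map (algebraMap O N)
  -- If the extension is zero, so is the maximal ideal of `O`. A nonzero maximal ideal of `N` would
  -- contract to a nonzero ideal, so zero is the only one.
  by_cases hJ : J = ⊥
  · have : Subsingleton (MaximalSpectrum N) := by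
      have hbot : ∀ P : MaximalSpectrum N, P.asIdeal = ⊥ := by
        intro P
        by_contra hP0
        obtain ⟨x, hx, hx0⟩ := Submodule.exists_mem_ne_zero_of_ne_bot hP0
        have h1 : P.asIdeal.comap (algebraMap O N) ≠ ⊥ :=
          Ideal.comap_ne_bot_of_integral_mem hx0 hx (Algebra.IsIntegral.isIntegral x)
        rw [hover] at h1
        exact h1 ((Ideal.map_eq_bot_iff_of_injective (FaithfulSMul.algebraMap_injective O N)).1 hJ)
      exact ⟨fun P Q => MaximalSpectrum.ext ((hbot P).trans (hbot Q).symm)⟩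
    exact Finite.of_subsingleton
  · have := UniqueFactorizationMonoid.fintypeSubtypeDvd J hJ
    refine Finite.of_injective (β := {I : Ideal N // I ∣ J})
      (fun P => ⟨P.asIdeal, Ideal.dvd_iff_le.2 ?_⟩) ?_
    · rw [Ideal.map_le_iff_le_comap, hover]
    · exact fun P Q h => MaximalSpectrum.ext (congrArg Subtype.val h)

theorem isPrincipalIdealRing_of_finite_maximalSpectrum [IsDedekindDomain N]
    [Finite (MaximalSpectrum N)] : IsPrincipalIdealRing N := by
  refine IsPrincipalIdealRing.of_finite_maximals ?_
  have : {I : Ideal N | I.IsMaximal} = Set.range (MaximalSpectrum.asIdeal (R := N)) := by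
    ext I
    exact ⟨fun h => ⟨⟨I, h⟩, rfl⟩, by rintro ⟨P, rfl⟩; exact P.isMaximal⟩
  rw [this]
  exact Set.finite_range _

/-- A residue field of `N` is integral over one of `O`, which is an image of ℂ, and ℂ is
algebraically closed. -/
theorem residue_of_finite [Algebra ℂ O] [Algebra ℂ N] [IsScalarTower ℂ O N]
    (h : ∀ P : Ideal O, P.IsMaximal → Function.Surjective (algebraMap ℂ (O ⧸ P)))
    (P : Ideal N) (hP : P.IsMaximal) : Function.Surjective (algebraMap ℂ (N ⧸ P)) := by
  have h1 := h _ (Ideal.isMaximal_comap_of_isIntegral_of_isMaximal (R := O) P)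
  have : Algebra.IsIntegral ℂ (O ⧸ P.under O) :=
    ⟨fun x => by obtain ⟨r, rfl⟩ := h1 x; exact isIntegral_algebraMap⟩
  have : Algebra.IsIntegral (O ⧸ P.under O) (N ⧸ P) := inferInstance
  have : Algebra.IsIntegral ℂ (N ⧸ P) := Algebra.IsIntegral.trans (O ⧸ P.under O)
  have := Ideal.Quotient.isDomain P
  exact (IsAlgClosed.algebraMap_bijective_of_isIntegral (k := ℂ) (K := N ⧸ P)).2

end Normalization

/-- `K` need not be the fraction field of `O`: `HomFrac D` also contains fractions of nonzero
degree. The equation `h` puts `z` in the copy of the fraction field of `O` inside `K`. -/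
theorem exists_algebraMap_eq_of_isIntegral {O K : Type*} [CommRing O] [IsDomain O]
    [IsIntegrallyClosed O] [Field K] [Algebra O K] [FaithfulSMul O K] {z : K} {x y : O}
    (hy : y ≠ 0) (h : z * algebraMap O K y = algebraMap O K x) (hz : IsIntegral O z) :
    ∃ w, algebraMap O K w = z := by
  have hinj := FaithfulSMul.algebraMap_injective O K
  set φ : FractionRing O →ₐ[O] K := IsFractionRing.liftAlgHom (g := Algebra.ofId O K) hinj
  have hφ : Function.Injective φ := φ.toRingHom.injective
  set t : FractionRing O := algebraMap O _ x / algebraMap O _ y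
  have ht : φ t = z := by
    have hy' : algebraMap O K y ≠ 0 := by simpa using hy
    rw [map_div₀, AlgHom.commutes, AlgHom.commutes, ← h, mul_div_cancel_right₀ _ hy']
  have h1 : IsIntegral O t := by
    rw [← isIntegral_algHom_iff φ hφ, ht]; exact hz
  obtain ⟨w, hw⟩ := IsIntegrallyClosed.isIntegral_iff.1 h1
  exact ⟨w, by rw [← ht, ← hw, AlgHom.commutes]⟩

/-- A vector that is annihilated by a matrix of corank one vanishes if a suitable coordinate
does. -/
theorem eq_zero_of_vecMul_eq_zero_of_adjugate {K : Type*} [CommRing K] [IsDomain K] {m : ℕ}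
    {A : Matrix (Fin m) (Fin m) K} {k s : Fin m} (hA : A.adjugate k s ≠ 0) {w : Fin m → K}
    (hw : Matrix.vecMul w A = 0) (hs : w s = 0) : w = 0 := by
  -- The adjugate entry is the determinant after row `s` is replaced by a unit vector. Since `w s =
  -- 0`, this replacement does not change `w A`.
  have hdet : (A.updateRow s (Pi.single k 1)).det ≠ 0 := by
    rwa [← Matrix.adjugate_apply]
  refine Matrix.eq_zero_of_vecMul_eq_zero hdet ?_
  rw [← hw]
  funext j
  simp only [Matrix.vecMul, dotProduct]
  refine Finset.sum_congr rfl fun i _ => ?_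
  by_cases h : i = s
  · rw [h, hs, zero_mul, zero_mul]
  · rw [Matrix.updateRow_ne h]

/-! ### The normalization of the local ring -/

section NormalRing

variable {m : ℕ} {D : Fin 3 → Matrix (Fin m) (Fin m) ℂ} [hΔ : Fact (Irreducible (disc D))]
  {c a : Fin 3 → ℂ}

theorem toFrac_ne_zero_of_eval_ne_zero (ha : eval a (disc D) = 0) {g : Poly}
    (hg : eval a g ≠ 0) : toFrac D g ≠ 0 := by
  rw [Ne, toFrac_eq_zero]
  rintro ⟨h, rfl⟩
  exact hg (by rw [map_mul, ha, zero_mul])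

theorem localRing_le_functionField (ha : eval a (disc D) = 0) :
    localRing D a ≤ functionField D := by
  rintro z ⟨d, f, g, hf, hg, hga, h⟩
  exact ⟨d, f, g, hf, hg, (toFrac_ne_zero_of_eval_ne_zero ha hga).isUnit, h⟩

theorem localRing_le_normalRing (ha : eval a (disc D) = 0) :
    localRing D a ≤ normalRing D a := fun z hz =>
  ⟨localRing_le_functionField ha hz,
    isIntegral_algebraMap (R := localRing D a) (A := HomFrac D) (x := ⟨z, hz⟩)⟩

theorem div_mem_functionField {z w : HomFrac D} (hz : z ∈ functionField D)
    (hw : w ∈ functionField D) (hw0 : w ≠ 0) : z / w ∈ functionField D := by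
  rw [div_eq_mul_inv]
  refine Subring.mul_mem _ hz ?_
  obtain ⟨d, f, g, hf, hg, hu, h⟩ := hw
  have hg0 := hu.ne_zero
  have hf0 : toFrac D f ≠ 0 := by rw [← h]; exact mul_ne_zero hw0 hg0
  refine ⟨d, g, f, hg, hf, hf0.isUnit, ?_⟩
  rw [← h, inv_mul_cancel_left₀ hw0]

theorem exists_theta_mul_eq_of_mem_functionField (hc : toFrac D (linForm c) ≠ 0) {z : HomFrac D}
    (hz : z ∈ functionField D) : ∃ f g, theta D c g ≠ 0 ∧ z * theta D c g = theta D c f := by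
  obtain ⟨d, f, g, hf, hg, hu, h⟩ := hz
  have hg0 := hu.ne_zero
  rw [toFrac_eq_mul_theta hc hg] at hg0
  refine ⟨f, g, right_ne_zero_of_mul hg0, ?_⟩
  rw [toFrac_eq_mul_theta hc hf, toFrac_eq_mul_theta hc hg] at h
  refine mul_left_cancel₀ (pow_ne_zero d hc) ?_
  rw [← h]; ring

instance (R : Subring (HomFrac D)) : Module R (HomFrac D) := Algebra.toModule

instance (R : Subring (HomFrac D)) : SMul R (HomFrac D) := Algebra.toSMul

instance (R : Subring (HomFrac D)) : MulAction R (HomFrac D) :=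
  Module.toDistribMulAction.toMulAction

variable [ha : Fact (eval a (disc D) = 0)]

instance algebraNormalRing : Algebra (localRing D a) (normalRing D a) :=
  (Subring.inclusion (localRing_le_normalRing ha.out)).toAlgebra

instance : IsScalarTower (localRing D a) (normalRing D a) (HomFrac D) :=
  IsScalarTower.of_algebraMap_eq fun _ => rfl

instance : FaithfulSMul (localRing D a) (normalRing D a) :=
  (faithfulSMul_iff_algebraMap_injective _ _).2 (Subring.inclusion_injective _)

instance : Algebra ℂ (normalRing D a) :=
  ((algebraMap (localRing D a) (normalRing D a)).comp (algebraMap ℂ (localRing D a))).toAlgebra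

instance : IsScalarTower ℂ (localRing D a) (normalRing D a) :=
  IsScalarTower.of_algebraMap_eq fun _ => rfl

instance : Algebra.IsIntegral (localRing D a) (normalRing D a) :=
  ⟨fun z => (isIntegral_algHom_iff (IsScalarTower.toAlgHom (localRing D a) (normalRing D a)
    (HomFrac D)) Subtype.val_injective).1 z.2.2⟩

/-- The fraction field embeds in the function field because the latter is closed under division.
There, integrality over `normalRing` implies integrality over the local ring. -/
instance : IsIntegrallyClosed (normalRing D a) := by
  rw [isIntegrallyClosed_iff (FractionRing (normalRing D a))]
  intro x hx
  have hinj : Function.Injective (algebraMap (normalRing D a) (HomFrac D)) :=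
    Subtype.val_injective
  set φ : FractionRing (normalRing D a) →ₐ[normalRing D a] HomFrac D :=
    IsFractionRing.liftAlgHom (g := Algebra.ofId _ _) hinj
  have hmem : φ x ∈ normalRing D a := by
    refine ⟨?_, isIntegral_trans (R := localRing D a) (A := normalRing D a) _ (hx.map φ)⟩
    obtain ⟨y, z, hz, rfl⟩ := IsFractionRing.div_surjective (normalRing D a) x
    rw [map_div₀, AlgHom.commutes, AlgHom.commutes]
    refine div_mem_functionField y.2.1 z.2.1 ?_
    exact fun h => nonZeroDivisors.ne_zero hz (Subtype.ext h)
  refine ⟨⟨_, hmem⟩, φ.toRingHom.injective ?_⟩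
  exact (AlgHom.commutes φ _)

end NormalRing

/-! ### The dimension of the local ring -/

section Dimension

theorem isPrime_span_linForm_sub {c e : Fin 3 → ℂ} (h : c ⬝ᵥ e = 1) :
    (Ideal.span {linForm c - C 1}).IsPrime := by
  have : Ideal.span {linForm c - C 1} = RingHom.ker (shear e (linForm c - C 1)) := by
    ext f
    rw [Ideal.mem_span_singleton, dvd_iff_shear_eq_zero h]
    rfl
  rw [this]
  exact RingHom.ker_isPrime _

theorem eval_zero_linForm_sub (c : Fin 3 → ℂ) : eval 0 (linForm c - C 1) = -1 := by
  rw [map_sub, eval_linForm, eval_C, dotProduct_zero, zero_sub]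

theorem not_exists_chain_of_primes (P : Fin 5 → PrimeSpectrum Poly) : ¬ StrictMono P := by
  intro h
  have h1 : (((⟨4, P, Fin.strictMono_iff_lt_succ.1 h⟩ : LTSeries (PrimeSpectrum Poly)).length : ℕ) :
      WithBot ℕ∞) ≤ ringKrullDim Poly := Order.LTSeries.length_le_krullDim _
  rw [MvPolynomial.ringKrullDim_of_isNoetherianRing, ringKrullDim_eq_zero_of_field] at h1
  simp only [Nat.card_eq_fintype_card, Fintype.card_fin, zero_add] at h1
  exact absurd (by exact_mod_cast h1 : 4 ≤ 3) (by norm_num)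

variable {m : ℕ} {D : Fin 3 → Matrix (Fin m) (Fin m) ℂ} [hΔ : Fact (Irreducible (disc D))]
  {c a : Fin 3 → ℂ}

theorem theta_eq_zero_iff_of_isHomogeneous (hc : toFrac D (linForm c) ≠ 0) {F : Poly} {d : ℕ}
    (hF : F.IsHomogeneous d) : theta D c F = 0 ↔ disc D ∣ F := by
  rw [← toFrac_eq_zero, toFrac_eq_mul_theta hc hF, mul_eq_zero,
    or_iff_right (pow_ne_zero d hc)]

/-- A nonzero nonmaximal prime `P` would give the chain `0`, `(ℓ - 1)`, `θ⁻¹(0)`, `θ⁻¹(P)`, `θ⁻¹` of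
the maximal ideal, of length four in a ring of dimension three. -/
theorem isMaximal_of_isPrime_localRing (ha : eval a (disc D) = 0) (hca : c ⬝ᵥ a ≠ 0)
    (P : Ideal (localRing D a)) (hP0 : P ≠ ⊥) (hP : P.IsPrime) : P.IsMaximal := by
  have hloc := isLocalRing_localRing ha hca
  have hc := toFrac_linForm_ne_zero ha hca
  by_contra hmax
  have hlt : P < IsLocalRing.maximalIdeal (localRing D a) := by
    refine lt_of_le_of_ne (IsLocalRing.le_maximalIdeal hP.ne_top) ?_
    rintro rfl
    exact hmax inferInstance
  set θ := thetaLoc D c a ha hca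
  -- Every element becomes a numerator `θ f` after multiplication by a unit, so strict inclusions
  -- pull back to strict ones.
  have hcomap : ∀ {I J : Ideal (localRing D a)}, I < J → I.comap θ < J.comap θ := by
    intro I J hIJ
    refine lt_of_le_not_ge (Ideal.comap_mono hIJ.le) fun hJI => hIJ.not_ge fun z hz => ?_
    obtain ⟨f, s, hs, h⟩ := exists_mul_thetaLoc_eq ha hca z
    have h1 : f ∈ J.comap θ := by
      rw [Ideal.mem_comap, ← h]; exact J.mul_mem_right _ hz
    have h2 : θ f ∈ I := hJI h1
    rw [← h] at h2
    exact (I.mul_unit_mem_iff_mem (isUnit_thetaLoc ha hca hs)).1 h2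
  have hprime := isPrime_span_linForm_sub (dotProduct_affRep hca)
  have hL : (linForm c - C 1 : Poly) ≠ 0 := by
    intro h
    have := eval_zero_linForm_sub c
    rw [h, map_zero] at this
    norm_num at this
  have h01 : (⊥ : Ideal Poly) < Ideal.span {linForm c - C 1} :=
    bot_lt_iff_ne_bot.2 (by rwa [Ne, Ideal.span_singleton_eq_bot])
  have h12 : Ideal.span {linForm c - C 1} < (⊥ : Ideal (localRing D a)).comap θ := by
    refine lt_of_le_not_ge ?_ fun hle => ?_
    · rw [Ideal.span_singleton_le_iff_mem, Ideal.mem_comap, Ideal.mem_bot]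
      refine Subtype.ext ?_
      rw [coe_thetaLoc, map_sub, theta_linForm hc, map_one, map_one, sub_self]; rfl
    -- If `ℓ - 1` divided the form Δ, it would be a form. It is `0` at the affine point and `-1` at
    -- the origin, so it is neither constant nor a form of positive degree.
    · have h1 : disc D ∈ (⊥ : Ideal (localRing D a)).comap θ := by
        rw [Ideal.mem_comap, Ideal.mem_bot]
        exact Subtype.ext (theta_disc hc)
      obtain ⟨g, hg⟩ := Ideal.mem_span_singleton.1 (hle h1)
      have h2 := isHomogeneous_of_mul (hg ▸ disc_isHomogeneous (D := D))
        (hg ▸ hΔ.out.ne_zero)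
      obtain h3 | h3 := Nat.eq_zero_or_pos (linForm c - C 1 : Poly).totalDegree
      · rw [h3] at h2
        have h4 : eval (affRep c a) (linForm c - C 1) = eval 0 (linForm c - C 1) := by
          obtain ⟨r, hr⟩ : ∃ r : ℂ, (linForm c - C 1 : Poly) = C r :=
            ⟨_, totalDegree_eq_zero_iff_eq_C.1 h3⟩
          rw [hr, eval_C, eval_C]
        rw [eval_zero_linForm_sub, map_sub, eval_linForm, dotProduct_affRep hca, eval_C, sub_self]
          at h4
        norm_num at h4
      · have h4 := eval_smul_of_isHomogeneous h2 0 0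
        rw [zero_pow h3.ne', zero_mul, zero_smul, eval_zero_linForm_sub] at h4
        norm_num at h4
  have h23 := hcomap (bot_lt_iff_ne_bot.2 hP0)
  have h34 := hcomap hlt
  refine not_exists_chain_of_primes ![⟨⊥, Ideal.isPrime_bot⟩, ⟨_, hprime⟩,
    ⟨(⊥ : Ideal (localRing D a)).comap θ, Ideal.isPrime_bot.comap θ⟩, ⟨P.comap θ, hP.comap θ⟩,
    ⟨(IsLocalRing.maximalIdeal (localRing D a)).comap θ,
      (IsLocalRing.maximalIdeal.isMaximal _).isPrime.comap θ⟩]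
    (Fin.strictMono_iff_lt_succ.2 fun i => ?_)
  fin_cases i
  · exact h01
  · exact h12
  · exact h23
  · exact h34

end Dimension

/-! ### The rank of the pencil along the curve -/

section Rank

variable {m : ℕ} {D : Fin 3 → Matrix (Fin m) (Fin m) ℂ} [hΔ : Fact (Irreducible (disc D))]
  {c a : Fin 3 → ℂ}

/-- If Δ divided all entries of the adjugate, the pencil would be invertible and Δ a unit. Hence the
pencil has corank one along the curve. -/
theorem exists_theta_adjugate_ne_zero (hc : toFrac D (linForm c) ≠ 0) :
    ∃ i j, theta D c ((pencil D).adjugate i j) ≠ 0 := by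
  by_contra! h
  have h1 : ∀ i j, disc D ∣ (pencil D).adjugate i j := fun i j =>
    (theta_eq_zero_iff_of_isHomogeneous hc (adjugate_isHomogeneous i j)).1 (h i j)
  choose B hB using h1
  have h2 : (pencil D).adjugate = disc D • Matrix.of B := by
    ext1 i j
    exact hB i j
  have h3 := Matrix.mul_adjugate (pencil D)
  rw [h2, Matrix.mul_smul] at h3
  have h4 : pencil D * Matrix.of B = 1 := by
    refine smul_right_injective _ hΔ.out.ne_zero (h3.trans ?_)
    rfl
  have h5 := congrArg Matrix.det h4
  rw [Matrix.det_mul, Matrix.det_one] at h5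
  exact hΔ.out.not_isUnit (IsUnit.of_mul_eq_one _ h5)

variable (ha : eval a (disc D) = 0) (hca : c ⬝ᵥ a ≠ 0)

/-- Over the local ring, the cokernels of the pencil and of its adjugate are resolved by
each other. -/
theorem exists_vecMul_eq_of_vecMul_eq_zero {A B : Matrix (Fin m) (Fin m) Poly} {d : ℕ}
    (hA : ∀ i j, (A i j).IsHomogeneous d) (hAB : A * B = disc D • 1) {v : Fin m → localRing D a}
    (hv : Matrix.vecMul v (A.map (thetaLoc D c a ha hca)) = 0) :
    ∃ u, v = Matrix.vecMul u (B.map (thetaLoc D c a ha hca)) := by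
  have hc := toFrac_linForm_ne_zero ha hca
  set θ := thetaLoc D c a ha hca
  -- After denominators are cleared and the vector is homogenized, vanishing in the local ring is
  -- divisibility by Δ among forms. Then `F A = Δ g`, and multiplying by `B` gives `F = g B`.
  obtain ⟨f, s, hs, hf⟩ := exists_common_denominator ha hca v
  obtain ⟨N, hN⟩ := exists_homogenization_vec c f
  obtain ⟨F, hF, hfF⟩ := hN (N + 1) (Nat.le_succ N)
  rw [mem_vecPart_succ] at hF
  have hF' : θ s • v = θ ∘ F := by
    funext i
    rw [Pi.smul_apply, smul_eq_mul, hf]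
    exact Subtype.ext (theta_eq_of_dvd hc (hfF i))
  have h1 : ∀ j, disc D ∣ Matrix.vecMul F A j := by
    intro j
    refine (theta_eq_zero_iff_of_isHomogeneous hc (d := N + d) ?_).1 ?_
    · exact IsHomogeneous.sum _ _ _ fun i _ => (hF i).mul (hA i j)
    · have h2 := RingHom.map_vecMul θ A F j
      rw [← hF', Matrix.smul_vecMul, hv, smul_zero] at h2
      exact congrArg Subtype.val h2
  choose g hg using h1
  have h2 : F = Matrix.vecMul g B := by
    have h3 : Matrix.vecMul F A = disc D • g := funext hg
    have h4 := congrArg (fun w => Matrix.vecMul w B) h3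
    simp only [Matrix.vecMul_vecMul, hAB, Matrix.vecMul_smul, Matrix.vecMul_one,
      Matrix.smul_vecMul] at h4
    exact smul_right_injective _ hΔ.out.ne_zero h4
  obtain ⟨u, hu⟩ := isUnit_thetaLoc ha hca hs
  refine ⟨(↑u⁻¹ : localRing D a) • (θ ∘ g), ?_⟩
  rw [Matrix.smul_vecMul]
  have h5 : Matrix.vecMul (θ ∘ g) (B.map θ) = θ ∘ F := by
    funext j
    rw [h2]
    exact (RingHom.map_vecMul θ B g j).symm
  rw [h5, ← hF', smul_smul]
  change _ = ((↑u⁻¹ : localRing D a) * thetaLoc D c a ha hca s) • v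
  rw [← hu, Units.inv_mul, one_smul]

theorem map_mul_map_eq_zero {A B : Matrix (Fin m) (Fin m) Poly} (h : A * B = disc D • 1) :
    A.map (thetaLoc D c a ha hca) * B.map (thetaLoc D c a ha hca) = 0 := by
  rw [← Matrix.map_mul, h]
  ext1 k l
  rw [Matrix.map_apply, Matrix.smul_apply, smul_eq_mul, map_mul]
  have : thetaLoc D c a ha hca (disc D) = 0 :=
    Subtype.ext (theta_disc (toFrac_linForm_ne_zero ha hca))
  rw [this, zero_mul]
  rfl

theorem vecMul_vecMul_adjugate_map (u : Fin m → localRing D a) :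
    Matrix.vecMul (Matrix.vecMul u ((pencil D).map (thetaLoc D c a ha hca)))
      ((pencil D).adjugate.map (thetaLoc D c a ha hca)) = 0 := by
  rw [Matrix.vecMul_vecMul, map_mul_map_eq_zero ha hca (Matrix.mul_adjugate _), Matrix.vecMul_zero]

/-- The vector `v adj` is killed by the pencil, which has corank one, so it vanishes once its
coordinate `j` does. Thus one column of the adjugate already detects the row relations. -/
theorem exists_vecMul_pencil_eq {i j : Fin m}
    (hij : theta D c ((pencil D).adjugate i j) ≠ 0) {v : Fin m → localRing D a}
    (hv : ∑ k, v k * thetaLoc D c a ha hca ((pencil D).adjugate k j) = 0) :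
    ∃ u, v = Matrix.vecMul u ((pencil D).map (thetaLoc D c a ha hca)) := by
  set θ := thetaLoc D c a ha hca
  refine exists_vecMul_eq_of_vecMul_eq_zero ha hca (fun i j => adjugate_isHomogeneous i j)
    (Matrix.adjugate_mul _) ?_
  have hadj : ((pencil D).map θ).adjugate = (pencil D).adjugate.map θ :=
    (RingHom.map_adjugate θ (pencil D)).symm
  refine eq_zero_of_vecMul_eq_zero_of_adjugate (A := (pencil D).map θ) (k := i) (s := j) ?_ ?_ ?_
  · rw [hadj, Matrix.map_apply]
    exact fun h => hij (congrArg Subtype.val h)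
  · rw [Matrix.vecMul_vecMul, map_mul_map_eq_zero ha hca (Matrix.adjugate_mul _),
      Matrix.vecMul_zero]
  · exact hv

end Rank

/-! ### Ideals generated by finitely many elements of an extension -/

section Extension

variable {O N : Type*} [CommRing O] [CommRing N] [Algebra O N] {ι : Type*} [Fintype ι]
  [DecidableEq ι]

/-- By `h` the image of the linear combinations is an ideal of `N`. It is generated by some `g ≠ 0`,
and dividing by `g` makes the map onto. -/
theorem exists_surjective_of_mul_mem_range [IsDomain N] [IsPrincipalIdealRing N] {α : ι → N}
    {i : ι} (hi : α i ≠ 0)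
    (h : ∀ (z : N) (v : ι → O), ∃ u : ι → O,
      Fintype.linearCombination O α u = z * Fintype.linearCombination O α v) :
    ∃ Φ : (ι → O) →ₗ[O] N, Function.Surjective Φ ∧
      ∀ v, Φ v = 0 ↔ Fintype.linearCombination O α v = 0 := by
  let J : Ideal N :=
    { carrier := Set.range (Fintype.linearCombination O α)
      add_mem' := by rintro _ _ ⟨v, rfl⟩ ⟨w, rfl⟩; exact ⟨v + w, map_add _ _ _⟩
      zero_mem' := ⟨0, map_zero _⟩
      smul_mem' := by rintro z _ ⟨v, rfl⟩; exact h z v }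
  obtain ⟨g, hg⟩ := IsPrincipalIdealRing.principal J
  have hgJ : ∀ z, (∃ v, Fintype.linearCombination O α v = z) ↔ ∃ y, y * g = z := fun z => by
    rw [← Ideal.mem_span_singleton']
    change z ∈ J ↔ z ∈ Submodule.span _ {g}
    rw [hg]
  have hsingle : ∀ k, Fintype.linearCombination O α (Pi.single k 1) = α k := fun k => by
    rw [Fintype.linearCombination_apply_single, one_smul]
  choose y hy using fun k => (hgJ _).1 ⟨Pi.single k 1, hsingle k⟩
  have hg0 : g ≠ 0 := by
    rintro rfl
    exact hi (by rw [← hy i, mul_zero])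
  have hΦ : ∀ v, Fintype.linearCombination O y v * g = Fintype.linearCombination O α v := by
    intro v
    rw [Fintype.linearCombination_apply, Fintype.linearCombination_apply, Finset.sum_mul]
    exact Finset.sum_congr rfl fun k _ => by rw [smul_mul_assoc, hy]
  refine ⟨Fintype.linearCombination O y, fun z => ?_, fun v => ?_⟩
  · obtain ⟨v, hv⟩ := (hgJ (z * g)).2 ⟨z, rfl⟩
    exact ⟨v, mul_right_cancel₀ hg0 ((hΦ v).trans hv)⟩
  · rw [← hΦ, mul_eq_zero_iff_right hg0]

omit [DecidableEq ι] in
theorem exists_vecMul_add_of_unit_smul {T : Matrix ι ι O} {s P Q : O} (hs : IsUnit s)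
    {v u x y : ι → O} (h : s • v = Matrix.vecMul u T + P • x + Q • y) :
    ∃ u x y, v = Matrix.vecMul u T + P • x + Q • y := by
  obtain ⟨t, rfl⟩ := hs
  refine ⟨(↑t⁻¹ : O) • u, (↑t⁻¹ : O) • x, (↑t⁻¹ : O) • y, ?_⟩
  rw [Matrix.smul_vecMul, smul_comm P, smul_comm Q, ← smul_add, ← smul_add, ← h, smul_smul,
    Units.inv_mul, one_smul]

theorem vecMul_add_mem {L : Submodule O (ι → O)} {T : Matrix ι ι O} {P Q : O}
    (hT : ∀ i, T i ∈ L) (hP : ∀ b, Pi.single b P ∈ L) (hQ : ∀ b, Pi.single b Q ∈ L)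
    (u x y : ι → O) : Matrix.vecMul u T + P • x + Q • y ∈ L := by
  have h : ∀ (R : O) (x : ι → O), R • x = ∑ b, x b • Pi.single b R := by
    intro R x
    funext b
    simp [Finset.sum_apply, Pi.single_apply, mul_comm]
  rw [h P, h Q, Matrix.vecMul_eq_sum]
  exact Submodule.add_mem _ (Submodule.add_mem _
    (Submodule.sum_mem _ fun i _ => Submodule.smul_mem _ _ (hT i))
    (Submodule.sum_mem _ fun b _ => Submodule.smul_mem _ _ (hP b)))
    (Submodule.sum_mem _ fun b _ => Submodule.smul_mem _ _ (hQ b))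

/-- Surjectivity of `Φ` lifts coefficients in `N` to `M`, so `L` is exactly the preimage of the
ideal generated by `x` and `y`. -/
theorem length_quotient_eq_of_surjective {M : Type*} [AddCommGroup M] [Module O M]
    {Φ : M →ₗ[O] N} (hΦ : Function.Surjective Φ) (x y : O)
    {L : Submodule O M} (hL : ∀ v, v ∈ L ↔ ∃ k w z, Φ k = 0 ∧ v = k + x • w + y • z) :
    Module.length O (M ⧸ L)
      = Module.length O (N ⧸ Ideal.span {algebraMap O N x, algebraMap O N y}) := by
  set I := Ideal.span {algebraMap O N x, algebraMap O N y}
  set π : M →ₗ[O] N ⧸ I := ((Ideal.Quotient.mkₐ O I).toLinearMap).comp Φ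
  have hπ : Function.Surjective π := (Ideal.Quotient.mkₐ_surjective O I).comp hΦ
  have hmem : ∀ v, π v = 0 ↔ Φ v ∈ I := fun v => Ideal.Quotient.eq_zero_iff_mem
  have hker : LinearMap.ker π = L := by
    ext v
    rw [LinearMap.mem_ker, hmem, hL, Ideal.mem_span_pair]
    constructor
    · rintro ⟨w, z, h⟩
      obtain ⟨w, rfl⟩ := hΦ w
      obtain ⟨z, rfl⟩ := hΦ z
      refine ⟨v - x • w - y • z, w, z, ?_, by abel⟩
      rw [map_sub, map_sub, map_smul, map_smul, ← h, Algebra.smul_def, Algebra.smul_def]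
      ring
    · rintro ⟨k, w, z, hk, rfl⟩
      refine ⟨Φ w, Φ z, ?_⟩
      rw [map_add, map_add, hk, map_smul, map_smul, Algebra.smul_def, Algebra.smul_def]
      ring
  rw [← hker]
  exact (π.quotKerEquivOfSurjective hπ).length_eq

end Extension

/-! ### Multiplicities at saturated points -/

section Saturated

variable {m : ℕ} {D : Fin 3 → Matrix (Fin m) (Fin m) ℂ} [hΔ : Fact (Irreducible (disc D))]
  {c a : Fin 3 → ℂ} [ha : Fact (eval a (disc D) = 0)] (hca : c ⬝ᵥ a ≠ 0)

variable (D) in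
/-- The dehomogenization, as a map to the normalization of the local ring. -/
abbrev thetaNormal : Poly →+* normalRing D a :=
  (algebraMap (localRing D a) (normalRing D a)).comp (thetaLoc D c a ha.out hca)

theorem span_isGerm {d : ℕ} {f : Poly} (hf : f.IsHomogeneous d) :
    Ideal.span {u : normalRing D a | IsGerm D a d f u} = Ideal.span {thetaNormal D hca f} := by
  have hc := toFrac_linForm_ne_zero ha.out hca
  refine le_antisymm (Ideal.span_le.2 ?_) (Ideal.span_mono ?_)
  · rintro u ⟨h, hh, hha, hu⟩
    have h1 : u * thetaNormal D hca h = thetaNormal D hca f := by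
      refine Subtype.ext (mul_left_cancel₀ (pow_ne_zero d hc) ?_)
      rw [toFrac_eq_mul_theta hc hh, toFrac_eq_mul_theta hc hf] at hu
      change _ * (u * theta D c h) = _ * theta D c f
      rw [← hu]; ring
    have h2 : IsUnit (thetaNormal D hca h) :=
      (isUnit_thetaLoc ha.out hca ((eval_affRep_eq_zero_iff hca hh).not.2 hha)).map (algebraMap (localRing D a) (normalRing D a))
    rw [SetLike.mem_coe, ← Ideal.mul_unit_mem_iff_mem _ h2, h1]
    exact Ideal.mem_span_singleton_self _
  · rw [Set.singleton_subset_iff]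
    exact isGerm_theta ha.out hca hf

/-- A column of the adjugate, as a map from `O^m` to the normalization. -/
def adjugateColumn (j : Fin m) : (Fin m → localRing D a) →ₗ[localRing D a] normalRing D a :=
  Fintype.linearCombination (localRing D a) fun i => thetaNormal D hca ((pencil D).adjugate i j)

theorem adjugateColumn_apply (j : Fin m) (v : Fin m → localRing D a) :
    adjugateColumn hca j v = algebraMap (localRing D a) (normalRing D a)
      (∑ i, v i * thetaLoc D c a ha.out hca ((pencil D).adjugate i j)) := by
  simp only [adjugateColumn, Fintype.linearCombination_apply, Algebra.smul_def, map_sum, map_mul]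
  rfl

/-- By saturation, `z` times a row of the adjugate has entries in the local ring. The pencil kills
it, so it is a combination of rows of the adjugate, and comparing entries `j` gives `u`. -/
theorem exists_adjugateColumn_eq_mul (hsat : IsSaturatedAt D a) (j : Fin m) (z : normalRing D a)
    (v : Fin m → localRing D a) : ∃ u, adjugateColumn hca j u = z * adjugateColumn hca j v := by
  have hc := toFrac_linForm_ne_zero ha.out hca
  have hrow : ∀ i, ∃ u, adjugateColumn hca j u
      = z * thetaNormal D hca ((pencil D).adjugate i j) := by
    intro i
    set w : Fin m → localRing D a := fun k => ⟨z * theta D c ((pencil D).adjugate i k),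
      hsat i k _ (isGerm_theta ha.out hca (adjugate_isHomogeneous i k)) z z.2⟩
    obtain ⟨u, hu⟩ : ∃ u, w = Matrix.vecMul u
        ((pencil D).adjugate.map (thetaLoc D c a ha.out hca)) := by
      refine exists_vecMul_eq_of_vecMul_eq_zero ha.out hca (A := pencil D) (fun i j => pencil_isHomogeneous i j)
        (Matrix.mul_adjugate _) ?_
      funext l
      refine Subtype.ext ?_
      have h1 : ∑ k, theta D c ((pencil D).adjugate i k) * theta D c (pencil D k l) = 0 := by
        have h2 := congrArg (theta D c) (congrFun (congrFun (Matrix.adjugate_mul (pencil D)) i) l)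
        rw [Matrix.mul_apply, map_sum, Matrix.smul_apply, smul_eq_mul, map_mul] at h2
        simp only [map_mul] at h2
        rw [h2]
        change theta D c (disc D) * _ = 0
        rw [theta_disc hc, zero_mul]
      simp only [Matrix.vecMul, dotProduct, Matrix.map_apply, AddSubmonoidClass.coe_finsetSum,
        Subring.coe_mul, coe_thetaLoc, w, mul_assoc]
      rw [← Finset.mul_sum, h1, mul_zero]
      rfl
    refine ⟨u, ?_⟩
    rw [adjugateColumn_apply]
    have h3 := congrFun hu j
    have h4 : (∑ k, u k * thetaLoc D c a ha.out hca ((pencil D).adjugate k j)) = w j := h3.symm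
    rw [h4]
    exact Subtype.ext rfl
  choose u hu using hrow
  refine ⟨∑ i, v i • u i, ?_⟩
  rw [map_sum]
  simp only [map_smul, hu]
  rw [adjugateColumn, Fintype.linearCombination_apply, Finset.mul_sum]
  exact Finset.sum_congr rfl fun i _ => (mul_smul_comm _ _ _).symm

include hca in
-- Multiplication by a nonzero entry of the adjugate embeds the normalization in the image of one
-- column, a finite module over a Noetherian ring.
theorem finite_normalRing (hsat : IsSaturatedAt D a) :
    Module.Finite (localRing D a) (normalRing D a) := by
  have hc := toFrac_linForm_ne_zero ha.out hca
  have := isNoetherianRing_localRing ha.out hca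
  obtain ⟨i, j, hij⟩ := exists_theta_adjugate_ne_zero hc
  set α := thetaNormal D hca ((pencil D).adjugate i j)
  have hα : α ≠ 0 := fun h => hij (congrArg Subtype.val h)
  have hαr : α = adjugateColumn hca j (Pi.single i 1) := by
    rw [adjugateColumn, Fintype.linearCombination_apply_single, one_smul]
  set f : normalRing D a →ₗ[localRing D a] LinearMap.range (adjugateColumn hca j) :=
    (LinearMap.mulRight (localRing D a) α).codRestrict _ fun z => by
      obtain ⟨u, hu⟩ := exists_adjugateColumn_eq_mul hca hsat j z (Pi.single i 1)
      exact ⟨u, by rw [hu, ← hαr]; rfl⟩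
  have hf : Function.Injective f := by
    intro z w h
    exact mul_right_cancel₀ hα (congrArg Subtype.val h)
  have := isNoetherian_of_injective f hf
  infer_instance

/-- At a saturated point the cokernel of the pencil is isomorphic to the normalization. -/
theorem exists_surjective_of_isSaturatedAt (hsat : IsSaturatedAt D a)
    [IsPrincipalIdealRing (normalRing D a)] :
    ∃ Φ : (Fin m → localRing D a) →ₗ[localRing D a] normalRing D a, Function.Surjective Φ ∧
      ∀ v, Φ v = 0 ↔ ∃ u, v = Matrix.vecMul u ((pencil D).map (thetaLoc D c a ha.out hca)) := by
  have hc := toFrac_linForm_ne_zero ha.out hca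
  obtain ⟨i, j, hij⟩ := exists_theta_adjugate_ne_zero hc
  obtain ⟨Φ, hsurj, hΦ⟩ := exists_surjective_of_mul_mem_range (O := localRing D a)
    (α := fun i => thetaNormal D hca ((pencil D).adjugate i j)) (i := i)
    (fun h => hij (congrArg Subtype.val h)) (exists_adjugateColumn_eq_mul hca hsat j)
  refine ⟨Φ, hsurj, fun v => (hΦ v).trans ?_⟩
  change adjugateColumn hca j v = 0 ↔ _
  rw [adjugateColumn_apply, FaithfulSMul.algebraMap_eq_zero_iff]
  refine ⟨exists_vecMul_pencil_eq ha.out hca hij, ?_⟩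
  rintro ⟨u, rfl⟩
  exact congrFun (vecMul_vecMul_adjugate_map ha.out hca u) j

theorem mem_localRelations_iff {n : ℕ} {p q : Poly} (hp : p.IsHomogeneous n)
    (hq : q.IsHomogeneous n) {v : Fin m → localRing D a} : v ∈ localRelations D n p q a ↔
      ∃ u x y, v = Matrix.vecMul u ((pencil D).map (thetaLoc D c a ha.out hca))
        + thetaLoc D c a ha.out hca p • x + thetaLoc D c a ha.out hca q • y := by
  constructor
  · intro h
    obtain ⟨s, hs, w, ⟨u, hu⟩, hw⟩ := exists_of_mem_localRelations ha.out hca hp hq h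
    choose x y hxy using fun b => mem_affIdeal.1 (hu b)
    set θ := thetaLoc D c a ha.out hca
    have h1 : θ s • v = Matrix.vecMul (θ ∘ u) ((pencil D).map θ) + θ p • (θ ∘ x)
        + θ q • (θ ∘ y) := by
      funext b
      have h2 : θ (w b) = θ (Matrix.vecMul u (pencil D) b + x b * p + y b * q) := by
        refine Subtype.ext (theta_eq_of_dvd (toFrac_linForm_ne_zero ha.out hca) ?_)
        convert hxy b using 1; ring
      rw [Pi.smul_apply, smul_eq_mul, hw, h2, map_add, map_add, RingHom.map_vecMul, map_mul,
        map_mul]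
      simp only [Pi.add_apply, Pi.smul_apply, smul_eq_mul, Function.comp_apply, mul_comm]
    exact exists_vecMul_add_of_unit_smul (isUnit_thetaLoc ha.out hca hs) h1
  · rintro ⟨u, x, y, rfl⟩
    exact vecMul_add_mem (fun i => thetaLoc_row_mem ha.out hca i)
      (fun b => single_thetaLoc_mem ha.out hca hp (Or.inl rfl) b)
      (fun b => single_thetaLoc_mem ha.out hca hq (Or.inr rfl) b) u x y

variable {n : ℕ} {p q : Poly}

theorem zeroMult_eq_length_quotient (hp : p.IsHomogeneous n) (hq : q.IsHomogeneous n)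
    (hsat : IsSaturatedAt D a) [IsPrincipalIdealRing (normalRing D a)] :
    zeroMult D n p q a = Module.length (localRing D a)
      (normalRing D a ⧸ Ideal.span {thetaNormal D hca p, thetaNormal D hca q}) := by
  obtain ⟨Φ, hsurj, hker⟩ := exists_surjective_of_isSaturatedAt (D := D) hca hsat
  refine length_quotient_eq_of_surjective hsurj _ _ fun v => ?_
  rw [mem_localRelations_iff hca hp hq]
  constructor
  · rintro ⟨u, x, y, rfl⟩
    exact ⟨_, x, y, (hker _).2 ⟨u, rfl⟩, rfl⟩
  · rintro ⟨k, x, y, hk, rfl⟩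
    obtain ⟨u, rfl⟩ := (hker _).1 hk
    exact ⟨u, x, y, rfl⟩

include hca in
theorem zeroMult_eq_branchMult_of_isSaturatedAt (hp : p.IsHomogeneous n) (hq : q.IsHomogeneous n)
    (hpq : ¬ (disc D ∣ p ∧ disc D ∣ q)) (hsat : IsSaturatedAt D a) :
    zeroMult D n p q a = branchMult D n p q a := by
  have hc := toFrac_linForm_ne_zero ha.out hca
  have := finite_normalRing hca hsat
  have := isNoetherianRing_localRing ha.out hca
  have := isLocalRing_localRing ha.out hca
  have := isDedekindDomain_of_finite (localRing D a) (normalRing D a)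
    (isMaximal_of_isPrime_localRing ha.out hca)
  have := finite_maximalSpectrum_of_finite (localRing D a) (normalRing D a)
  have := isPrincipalIdealRing_of_finite_maximalSpectrum (N := normalRing D a)
  have hres := residue_localRing ha.out hca
  -- All residue fields of the local ring and of its normalization are ℂ, so the length over either
  -- ring is the length over ℂ.
  rw [zeroMult_eq_length_quotient hca hp hq hsat,
    ← length_eq_of_surjective_residue (R := localRing D a) ℂ hres,
    length_eq_of_surjective_residue (R := normalRing D a) ℂ
      (residue_of_finite (localRing D a) (normalRing D a) hres),
    length_quotient_span_pair]
  · refine finsum_congr fun P => ?_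
    rw [orderAt, orderAt, span_isGerm hca hp, span_isGerm hca hq]
  · by_contra! h
    exact hpq ⟨(theta_eq_zero_iff_of_isHomogeneous hc hp).1 (congrArg Subtype.val h.1),
      (theta_eq_zero_iff_of_isHomogeneous hc hq).1 (congrArg Subtype.val h.2)⟩

end Saturated

/-! ### Regular points are saturated -/

section Regular

/-- The ideal of the point `b`. -/
def pointIdeal (b : Fin 3 → ℂ) : Ideal Poly := Ideal.span (Set.range fun k => X k - C (b k))

theorem X_sub_C_mem (b : Fin 3 → ℂ) (k : Fin 3) : (X k - C (b k) : Poly) ∈ pointIdeal b :=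
  Ideal.subset_span ⟨k, rfl⟩

/-- Taylor's formula to first order, by the Leibniz rule. -/
theorem sub_differential_mem (b : Fin 3 → ℂ) (f : Poly) :
    f - C (eval b f) - ∑ k, C (eval b (pderiv k f)) * (X k - C (b k)) ∈ pointIdeal b ^ 2 := by
  induction f using MvPolynomial.induction_on with
  | C r => simp
  | add f g hf hg =>
    convert Ideal.add_mem _ hf hg using 1
    simp only [map_add, add_mul, Finset.sum_add_distrib]
    ring
  | mul_X f j h =>
    have hd : (∑ k, C (eval b (pderiv k f)) * (X k - C (b k)) : Poly) ∈ pointIdeal b :=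
      Ideal.sum_mem _ fun k _ => Ideal.mul_mem_left _ _ (X_sub_C_mem b k)
    have h2 := Ideal.mul_mem_mul hd (X_sub_C_mem b j)
    rw [← pow_two] at h2
    convert Ideal.add_mem _ (Ideal.mul_mem_right (X j) _ h) h2 using 1
    have h3 : ∀ k, (C (eval b (pderiv k (f * X j))) * (X k - C (b k)) : Poly)
        = C (b j) * (C (eval b (pderiv k f)) * (X k - C (b k)))
          + C (eval b f) * (if k = j then X j - C (b j) else 0) := by
      intro k
      rw [Derivation.leibniz, pderiv_X]
      by_cases hk : k = j
      · subst hk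
        simp
        ring
      · simp [hk, Ne.symm hk]
        ring
    simp only [h3, Finset.sum_add_distrib, ← Finset.mul_sum, Finset.sum_ite_eq', Finset.mem_univ,
      if_true, map_mul, eval_X]
    ring

/-- The cross product of two vectors of `ℂ³`. -/
def cross (c γ : Fin 3 → ℂ) : Fin 3 → ℂ :=
  ![γ 1 * c 2 - γ 2 * c 1, γ 2 * c 0 - γ 0 * c 2, γ 0 * c 1 - γ 1 * c 0]

/-- `c` and `γ` are independent: `γ` is nonzero and vanishes on `b`, while `c` takes the value one
there. -/
theorem exists_cross_ne_zero {c γ b : Fin 3 → ℂ} (hc : c ⬝ᵥ b = 1) (hb : ∑ k, γ k * b k = 0)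
    (hγ : ∃ k, γ k ≠ 0) : ∃ l, cross c γ l ≠ 0 := by
  by_contra! h
  obtain ⟨k, hk⟩ := hγ
  have h0 := h 0
  have h1 := h 1
  have h2 := h 2
  simp only [cross, Matrix.cons_val] at h0 h1 h2
  simp only [dotProduct, Fin.sum_univ_three] at hc hb
  apply hk
  fin_cases k
  · change γ 0 = 0
    linear_combination (-γ 0) * hc + c 0 * hb - b 1 * (-h2) - b 2 * h1
  · change γ 1 = 0
    linear_combination (-γ 1) * hc + c 1 * hb - b 0 * h2 + b 2 * h0
  · change γ 2 = 0
    linear_combination (-γ 2) * hc + c 2 * hb + b 0 * h1 - b 1 * h0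

/-- Modulo the forms `γ · x` and `c · x`, the vector `x` is proportional to the cross product. -/
theorem exists_cross_mul_sub (c γ : Fin 3 → ℂ) (l k : Fin 3) : ∃ α β : ℂ, ∀ x : Fin 3 → Poly,
    C (cross c γ l) * x k - C (cross c γ k) * x l
      = C α * (∑ i, C (γ i) * x i) + C β * (∑ i, C (c i) * x i) := by
  refine ⟨![![0, c 2, -c 1], ![-c 2, 0, c 0], ![c 1, -c 0, 0]] l k,
    -![![0, γ 2, -γ 1], ![-γ 2, 0, γ 0], ![γ 1, -γ 0, 0]] l k, fun x => ?_⟩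
  fin_cases l <;> fin_cases k <;>
  · simp [cross, Fin.sum_univ_three]
    try ring

variable {m : ℕ} {D : Fin 3 → Matrix (Fin m) (Fin m) ℂ} [hΔ : Fact (Irreducible (disc D))]
  {c a : Fin 3 → ℂ} (ha : eval a (disc D) = 0) (hca : c ⬝ᵥ a ≠ 0)

include ha hca

/-- The three coordinates centred at the point span the maximal ideal modulo its square. The
differential of Δ and the equation `ℓ = 1` give two independent relations, so one coordinate
suffices by Nakayama's lemma. -/
theorem exists_maximalIdeal_le (hreg : IsRegularAt D a) [IsLocalRing (localRing D a)] :
    ∃ x, IsLocalRing.maximalIdeal (localRing D a) = Ideal.span {x} := by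
  have hc := toFrac_linForm_ne_zero ha hca
  have := isNoetherianRing_localRing ha hca
  set θ := thetaLoc D c a ha hca
  set b := affRep c a
  set M := IsLocalRing.maximalIdeal (localRing D a)
  set γ : Fin 3 → ℂ := fun k => eval b (pderiv k (disc D))
  have hΔb : eval b (disc D) = 0 := (eval_affRep_eq_zero_iff hca disc_isHomogeneous).2 ha
  have hγ : ∃ k, γ k ≠ 0 := by
    obtain ⟨k, hk⟩ := hreg
    exact ⟨k, (eval_affRep_eq_zero_iff hca disc_isHomogeneous.pderiv).not.2 hk⟩
  -- Euler's identity for the form Δ at a zero of Δ.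
  have hγb : ∑ k, γ k * b k = 0 := by
    have h := congrArg (eval b) (disc_isHomogeneous (D := D)).sum_X_mul_pderiv
    rw [map_sum, nsmul_eq_mul, map_mul, hΔb, mul_zero] at h
    rw [← h]
    exact Finset.sum_congr rfl fun k _ => by rw [map_mul, eval_X, mul_comm]
  obtain ⟨l, hl⟩ := exists_cross_ne_zero (dotProduct_affRep hca) hγb hγ
  have hmem : ∀ f, eval b f = 0 → θ f ∈ M := fun f hf => by
    rw [IsLocalRing.mem_maximalIdeal, mem_nonunits_iff, isUnit_thetaLoc_iff, not_not]
    exact hf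
  have hx : ∀ k, θ (X k - C (b k)) ∈ M := fun k => hmem _ (by simp)
  have hsq : ∀ f ∈ pointIdeal b ^ 2, θ f ∈ M ^ 2 := by
    intro f hf
    have h1 : pointIdeal b ≤ M.comap θ := Ideal.span_le.2 (by rintro _ ⟨k, rfl⟩; exact hx k)
    exact Ideal.le_comap_pow θ 2 (Ideal.pow_right_mono h1 2 hf)
  set Q := Ideal.span {θ (X l - C (b l))} ⊔ M ^ 2
  have hdΔ : θ (∑ k, C (γ k) * (X k - C (b k))) ∈ Q := by
    refine Ideal.mem_sup_right ?_
    have h := hsq _ (sub_differential_mem b (disc D))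
    have h0 : θ (disc D) = 0 := Subtype.ext (theta_disc hc)
    rw [hΔb, map_zero, sub_zero, map_sub, h0, zero_sub] at h
    exact neg_mem_iff.1 h
  have hℓ : θ (∑ k, C (c k) * (X k - C (b k))) ∈ Q := by
    have h1 : (∑ k, C (c k) * (X k - C (b k)) : Poly) = linForm c - C 1 := by
      have h2 : (C 1 : Poly) = ∑ k, C (c k) * C (b k) := by
        rw [← dotProduct_affRep hca, dotProduct, map_sum]
        exact Finset.sum_congr rfl fun k _ => map_mul _ _ _
      rw [h2, linForm, ← Finset.sum_sub_distrib]
      exact Finset.sum_congr rfl fun k _ => mul_sub _ _ _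
    have h3 : θ (linForm c - C 1) = 0 := Subtype.ext (by
      rw [coe_thetaLoc, map_sub, theta_linForm hc, map_one, map_one, sub_self]; rfl)
    rw [h1, h3]
    exact Q.zero_mem
  have hxQ : ∀ k, θ (X k - C (b k)) ∈ Q := by
    intro k
    obtain ⟨α, β, h⟩ := exists_cross_mul_sub c γ l k
    have h1 := congrArg θ (h fun k => X k - C (b k))
    rw [map_sub, map_mul, map_mul, map_add, map_mul, map_mul, sub_eq_iff_eq_add] at h1
    have hunit : IsUnit (θ (C (cross c γ l))) := isUnit_thetaLoc ha hca (by simpa using hl)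
    rw [← Q.unit_mul_mem_iff_mem hunit, h1]
    refine Q.add_mem (Q.add_mem (Q.mul_mem_left _ hdΔ) (Q.mul_mem_left _ hℓ)) (Q.mul_mem_left _ ?_)
    exact Ideal.mem_sup_left (Ideal.mem_span_singleton_self _)
  have hle : M ≤ Ideal.span {θ (X l - C (b l))} ⊔ M • M := by
    intro z hz
    rw [smul_eq_mul, ← pow_two]
    obtain ⟨f, s, hs, hf⟩ := exists_mul_thetaLoc_eq ha hca z
    have hfb : eval b f = 0 := by
      by_contra h0
      have h1 := (isUnit_thetaLoc_iff ha hca).2 h0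
      rw [← hf] at h1
      exact (IsLocalRing.mem_maximalIdeal z).1 hz (isUnit_of_mul_isUnit_left h1)
    rw [← Q.mul_unit_mem_iff_mem (isUnit_thetaLoc ha hca hs), hf]
    have h2 := hsq _ (sub_differential_mem b f)
    rw [hfb, map_zero, sub_zero, map_sub] at h2
    have h3 : θ (∑ k, C (eval b (pderiv k f)) * (X k - C (b k))) ∈ Q := by
      rw [map_sum]
      exact Q.sum_mem fun k _ => by
        rw [map_mul]; exact Q.mul_mem_left _ (hxQ k)
    have h4 := Q.add_mem (Ideal.mem_sup_right h2) h3
    rwa [sub_add_cancel] at h4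
  refine ⟨θ (X l - C (b l)), le_antisymm ?_ ?_⟩
  · exact Submodule.le_of_le_smul_of_le_jacobson_bot (IsNoetherian.noetherian M)
      (IsLocalRing.maximalIdeal_le_jacobson ⊥) hle
  · rw [Ideal.span_singleton_le_iff_mem]
    exact hx l

theorem isIntegrallyClosed_localRing (hreg : IsRegularAt D a) :
    IsIntegrallyClosed (localRing D a) := by
  have := isNoetherianRing_localRing ha hca
  have := isLocalRing_localRing ha hca
  obtain ⟨x, hx⟩ := exists_maximalIdeal_le ha hca hreg
  have hM : (IsLocalRing.maximalIdeal (localRing D a)).IsPrincipal := ⟨⟨x, hx⟩⟩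
  have h : IsIntegrallyClosed (localRing D a) ∧ ∀ P : Ideal (localRing D a), P ≠ ⊥ → P.IsPrime →
      P = IsLocalRing.maximalIdeal (localRing D a) :=
    ((tfae_of_isNoetherianRing_of_isLocalRing_of_isDomain (localRing D a)).out 3 4).2 hM
  exact h.1

/-- An integrally closed local ring equals its normalization, so its conductor is the whole ring. -/
theorem isSaturatedAt_of_isRegularAt (hreg : IsRegularAt D a) : IsSaturatedAt D a := by
  have := isIntegrallyClosed_localRing ha hca hreg
  have hc := toFrac_linForm_ne_zero ha hca
  rintro i j u ⟨h, hh, hha, hu⟩ z ⟨hzF, hz⟩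
  refine Subring.mul_mem _ ?_ ⟨m - 1, _, h, adjugate_isHomogeneous i j, hh, hha, hu⟩
  obtain ⟨f, g, hg, hfg⟩ := exists_theta_mul_eq_of_mem_functionField hc hzF
  have : FaithfulSMul (localRing D a) (HomFrac D) :=
    (faithfulSMul_iff_algebraMap_injective _ _).2 Subtype.val_injective
  obtain ⟨w, hw⟩ := exists_algebraMap_eq_of_isIntegral (O := localRing D a)
    (x := thetaLoc D c a ha hca f) (y := thetaLoc D c a ha hca g)
    (fun h0 => hg (congrArg Subtype.val h0)) hfg hz
  rw [← hw]
  exact w.2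

end Regular

/-! ### Common zeros and the kernel of the Sylvester matrix -/

section CommonZeros

variable {m : ℕ} {D : Fin 3 → Matrix (Fin m) (Fin m) ℂ} {n : ℕ} {p q : Poly}

theorem pos_of_irreducible (hirr : Irreducible (disc D)) : 1 ≤ m := by
  obtain _ | m := m
  · refine absurd ?_ hirr.not_isUnit
    rw [disc, Matrix.det_isEmpty]
    exact isUnit_one
  · exact Nat.le_add_left _ _

theorem commonZeros_comm : commonZeros D p q = commonZeros D q p := by
  ext x
  simp only [commonZeros, Set.mem_ofPred_eq, and_comm (a := eval x.rep p = 0)]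

theorem zeroMult_comm (a : Fin 3 → ℂ) : zeroMult D n p q a = zeroMult D n q p a := by
  have : localRelations D n p q a = localRelations D n q p a := by
    simp only [localRelations, or_comm (a := IsGerm D a n p _)]
  rw [zeroMult, this, zeroMult]

theorem finrank_ker_sylvester_comm (hn : 1 ≤ n) (hp : p.IsHomogeneous n) (hq : q.IsHomogeneous n)
    (b : Module.Basis (Fin (n * m) ⊕ Fin (n * m)) ℂ (principal D (2 * n)))
    (c : Module.Basis (Fin (n * m)) ℂ (principal D n)) :
    Module.finrank ℂ (LinearMap.ker (sylvester D b c p q).mulVecLin)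
      = Module.finrank ℂ (LinearMap.ker (sylvester D b c q p).mulVecLin) := by
  have h1 := finrank_ker_sylvester hn hp hq b c
  have h2 := finrank_ker_sylvester hn hq hp b c
  rw [Set.pair_comm] at h2
  omega

theorem finrank_ker_sylvester_eq_sum_of_not_dvd (hirr : Irreducible (disc D)) (hn : 1 ≤ n)
    (hp : p.IsHomogeneous n) (hq : q.IsHomogeneous n) (hpD : ¬ disc D ∣ p)
    (b : Module.Basis (Fin (n * m) ⊕ Fin (n * m)) ℂ (principal D (2 * n)))
    (c : Module.Basis (Fin (n * m)) ℂ (principal D n)) :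
    (commonZeros D p q).Finite ∧
      (Module.finrank ℂ (LinearMap.ker (sylvester D b c p q).mulVecLin) : ℕ∞)
        = ∑ᶠ x ∈ commonZeros D p q, zeroMult D n p q x.rep := by
  have := Fact.mk hirr
  have hfin : (commonZeros D p q).Finite :=
    (finite_zeros hirr hp hn hpD).subset fun x hx => ⟨hx.1, hx.2.1⟩
  obtain ⟨e, he0, he⟩ := exists_linForm_avoiding hirr hp hn hpD
  have := (finite_affCoker_and_finrank hirr hp hq hn hpD he0 he).1
  refine ⟨hfin, ?_⟩
  rw [finrank_ker_sylvester_eq_affCoker hirr hp hq hn hpD he0 he]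
  exact finrank_affCoker_eq_sum hp hq (fun x hx => he _ x.rep_nonzero hx.1 hx.2.1) hfin

/-- Both sides are symmetric in `p` and `q`, so Δ may be assumed not to divide `p`. -/
theorem finrank_ker_sylvester_eq_sum (hirr : Irreducible (disc D)) (hn : 1 ≤ n)
    (hp : p.IsHomogeneous n) (hq : q.IsHomogeneous n) (hpq : ¬ (disc D ∣ p ∧ disc D ∣ q))
    (b : Module.Basis (Fin (n * m) ⊕ Fin (n * m)) ℂ (principal D (2 * n)))
    (c : Module.Basis (Fin (n * m)) ℂ (principal D n)) :
    (commonZeros D p q).Finite ∧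
      (Module.finrank ℂ (LinearMap.ker (sylvester D b c p q).mulVecLin) : ℕ∞)
        = ∑ᶠ x ∈ commonZeros D p q, zeroMult D n p q x.rep := by
  by_cases hpD : disc D ∣ p
  · have h := finrank_ker_sylvester_eq_sum_of_not_dvd hirr hn hq hp (fun h => hpq ⟨hpD, h⟩) b c
    rw [finrank_ker_sylvester_comm hn hp hq, commonZeros_comm]
    simp only [zeroMult_comm (p := p)]
    exact h
  · exact finrank_ker_sylvester_eq_sum_of_not_dvd hirr hn hp hq hpD b c

/-- Evaluation at `x`, paired with a kernel vector `κ`, kills all relations but not the vector with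
the single entry `X k ^ (2n - 1)` at a place where `κ` is nonzero. So the relations do not fill
degree `2n - 1`. -/
theorem finrank_ker_sylvester_ne_zero (hn : 1 ≤ n) (hp : p.IsHomogeneous n)
    (hq : q.IsHomogeneous n) (b : Module.Basis (Fin (n * m) ⊕ Fin (n * m)) ℂ (principal D (2 * n)))
    (c : Module.Basis (Fin (n * m)) ℂ (principal D n)) {x : Plane} (hx : x ∈ commonZeros D p q) :
    Module.finrank ℂ (LinearMap.ker (sylvester D b c p q).mulVecLin) ≠ 0 := by
  intro h0
  have h1 := finrank_ker_sylvester hn hp hq b c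
  rw [h0, zero_add, ← finrank_vecPart] at h1
  have h2 := Submodule.eq_of_le_of_finrank_eq inf_le_left h1
  obtain ⟨κ, hκ0, hκ⟩ := exists_kernel_vector hx.1
  obtain ⟨j, hj⟩ := Function.ne_iff.1 hκ0
  obtain ⟨k, hk⟩ := Function.ne_iff.1 x.rep_nonzero
  have hv : (Pi.single j (X k ^ (2 * n - 1)) : Fin m → Poly) ∈ vecPart m (2 * n) := by
    obtain ⟨l, hl⟩ : ∃ l, 2 * n = l + 1 := ⟨2 * n - 1, by omega⟩
    rw [hl, mem_vecPart_succ]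
    intro i
    by_cases hi : i = j
    · subst hi
      rw [Pi.single_eq_same]
      exact isHomogeneous_X_pow k l
    · rw [Pi.single_eq_of_ne hi]
      exact isHomogeneous_zero _ _ _
  rw [← h2] at hv
  have h3 := evalAt_eq_zero hκ (eval_eq_zero_of_mem_span (s := {p, q}) (by
    rintro f (rfl | rfl)
    exacts [hx.2.1, hx.2.2])) hv.2
  rw [evalAt_apply, Finset.sum_eq_single j] at h3
  · rw [Pi.single_eq_same, map_pow, eval_X] at h3
    exact mul_ne_zero (pow_ne_zero _ hk) hj h3
  · intro i _ hi
    rw [Pi.single_eq_of_ne hi, map_zero, zero_mul]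
  · exact fun h => absurd (Finset.mem_univ j) h

theorem nonempty_commonZeros_of_dvd (hm : 1 ≤ m) (hp : disc D ∣ p) (hq : disc D ∣ q) :
    (commonZeros D p q).Nonempty := by
  -- With the zero linear form the condition of lying on the plane is empty.
  obtain ⟨b, hb0, -, hb⟩ := exists_zero_on_plane (disc_isHomogeneous (D := D)) (by omega) 0
  obtain ⟨t, ht, hbt⟩ := exists_smul_rep hb0
  rw [hbt, eval_smul_of_isHomogeneous disc_isHomogeneous] at hb
  have h := (mul_eq_zero.1 hb).resolve_left (pow_ne_zero _ ht)
  refine ⟨_, h, ?_, ?_⟩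
  · obtain ⟨f, rfl⟩ := hp
    rw [map_mul, h, zero_mul]
  · obtain ⟨f, rfl⟩ := hq
    rw [map_mul, h, zero_mul]

theorem det_eq_zero_iff_finrank_ker {ι : Type*} [Fintype ι] [DecidableEq ι]
    (A : Matrix ι ι ℂ) : A.det = 0 ↔ Module.finrank ℂ (LinearMap.ker A.mulVecLin) ≠ 0 := by
  rw [Ne, Submodule.finrank_eq_zero, LinearMap.ker_eq_bot', ← Matrix.exists_mulVec_eq_zero_iff]
  push Not
  simp only [Matrix.mulVecLin_apply, and_comm]

theorem zeroMult_eq_branchMult (hirr : Irreducible (disc D)) (hp : p.IsHomogeneous n)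
    (hq : q.IsHomogeneous n) (hpq : ¬ (disc D ∣ p ∧ disc D ∣ q)) {x : Plane}
    (hx : eval x.rep (disc D) = 0) (h : IsRegularAt D x.rep ∨ IsSaturatedAt D x.rep) :
    zeroMult D n p q x.rep = branchMult D n p q x.rep := by
  have := Fact.mk hirr
  have := Fact.mk hx
  obtain ⟨k, hk⟩ := Function.ne_iff.1 x.rep_nonzero
  have hc : (Pi.single k 1 : Fin 3 → ℂ) ⬝ᵥ x.rep ≠ 0 := by
    rwa [single_one_dotProduct]
  exact zeroMult_eq_branchMult_of_isSaturatedAt hc hp hq hpq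
    (h.elim (isSaturatedAt_of_isRegularAt hx hc) id)

end CommonZeros

end DetCurve

end

/-! ### The theorem. -/

theorem theorem2p5 {m : ℕ} (D : Fin 3 → Matrix (Fin m) (Fin m) ℂ)
    (hD : ∀ k, (D k).IsHermitian) (hirr : Irreducible (DetCurve.disc D))
    {n : ℕ} (hn : 1 ≤ n) (p q : MvPolynomial (Fin 3) ℂ)
    (hp : p.IsHomogeneous n) (hq : q.IsHomogeneous n) :
    Module.finrank ℂ (DetCurve.principal D n) = n * m ∧
    Module.finrank ℂ (DetCurve.principal D (2 * n)) = 2 * n * m ∧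
    ∀ (b : Module.Basis (Fin (n * m) ⊕ Fin (n * m)) ℂ (DetCurve.principal D (2 * n)))
      (c : Module.Basis (Fin (n * m)) ℂ (DetCurve.principal D n)),
      (¬ (DetCurve.disc D ∣ p ∧ DetCurve.disc D ∣ q) →
        (DetCurve.commonZeros D p q).Finite ∧
        (Module.finrank ℂ (LinearMap.ker (DetCurve.sylvester D b c p q).mulVecLin) : ℕ∞) =
          ∑ᶠ x ∈ DetCurve.commonZeros D p q, DetCurve.zeroMult D n p q x.rep ∧
        (∀ x ∈ DetCurve.commonZeros D p q,
          DetCurve.IsRegularAt D x.rep ∨ DetCurve.IsSaturatedAt D x.rep →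
          DetCurve.zeroMult D n p q x.rep = DetCurve.branchMult D n p q x.rep)) ∧
      ((DetCurve.sylvester D b c p q).det = 0 ↔ (DetCurve.commonZeros D p q).Nonempty) := by
  obtain ⟨k, rfl⟩ : ∃ k, n = k + 1 := ⟨n - 1, by omega⟩
  refine ⟨DetCurve.finrank_principal_succ hirr.ne_zero k,
    DetCurve.finrank_principal_succ hirr.ne_zero (2 * k + 1), fun b c => ⟨fun hpq => ?_, ?_⟩⟩
  · obtain ⟨h1, h2⟩ := DetCurve.finrank_ker_sylvester_eq_sum hirr hn hp hq hpq b c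
    exact ⟨h1, h2, fun x hx h => DetCurve.zeroMult_eq_branchMult hirr hp hq hpq hx.1 h⟩
  · rw [DetCurve.det_eq_zero_iff_finrank_ker]
    refine ⟨fun h => ?_, fun ⟨x, hx⟩ => DetCurve.finrank_ker_sylvester_ne_zero hn hp hq b c hx⟩
    -- If both polynomials vanish on the curve, any of its points is a common zero. Otherwise an
    -- empty set of common zeros makes the sum, and with it the kernel, zero.
    by_cases hpq : DetCurve.disc D ∣ p ∧ DetCurve.disc D ∣ q
    · exact DetCurve.nonempty_commonZeros_of_dvd (DetCurve.pos_of_irreducible hirr) hpq.1 hpq.2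
    · by_contra hempty
      have h2 := (DetCurve.finrank_ker_sylvester_eq_sum hirr hn hp hq hpq b c).2
      rw [Set.not_nonempty_iff_eq_empty.1 hempty, finsum_mem_empty] at h2
      exact h (by exact_mod_cast h2)
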